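/- Let $(E,d)$ be a Polish metric space with its Borel $\sigma$-algebra, $\mu$ a Borel probability measure on $E$, $n\ge 1$, and let $X_1,\dots,X_n$ be i.i.d. $E$-valued random variables with law $\mu$ and empirical measure $L_n=\frac1n\sum_{i=1}^n\delta_{X_i}$. For $p\ge 1$ let $$W_p^p(\mu,\nu)=\inf_\pi\int d(x,y)^p\,\pi(dx,dy),$$ the infimum being over all couplings $\pi$ of $\mu$ and $\nu$. Let $B(x,t)$ denote the closed ball, fix $x_0\in E$, and set $$H(t)=\mu(B(x_0,t)^c),\qquad \|X\|_{q,w}^q=\sup_{t\ge 0}t^qH(t),\qquad \|d(x_0,X)\|_p^p=\int d(x_0,y)^p\,\mu(dy),$$ $$I_{\alpha,p}=\int_0^\infty H(t)^{\frac{\alpha-p}{\alpha}}t^{p-1}\,dt,\qquad I_{2p,p}=\int_0^\infty\sqrt{H(t)}\,t^{p-1}\,dt .$$ We say that $\mu$ has a weak moment of order $q$ if $\|X\|_{q,w}<\infty$. For a set $A\subset E$ let $N(A,\delta)$ be the minimal number of closed balls of radius $\delta$ with centres in $A$ needed to cover $A$. **Theorem.** Let $p\ge 1$, $\alpha>2p$,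 $\beta>0$, and let $S\subset E$ be such that $\mu(S)=1$ and $$N(S\cap B(x_0,r),\delta)\le\beta\Big(\frac{2r}{\delta}\Big)^{\alpha}\qquad\text{for all } r>0 \text{ and all } \delta\in(0,2r].$$ Below, $C_{a_1,\dots,a_k}$ denotes a positive constant depending only on $a_1,\dots,a_k$, possibly different at each occurrence; in particular no constant depends on $n$, $x$, $\mu$, $S$, $x_0$ or $(E,d)$. Put $$\mathcal E_n(x)=e^2\exp\left(-n\,C_{p,\alpha,\beta}\Big[\frac{x}{I_{\alpha,p}}\Big]^{\alpha/p}\right)\mathbf 1_{x\le C_p\|d(x_0,X)\|_p^p}.$$ In each of the following cases $\|d(x_0,X)\|_p<\infty$, the integrals $I_{\alpha,p}$, $I_{2p,p}$ occurring in the bound are finite, and the stated bound holds (in the degenerate case $I_{\alpha,p}=0$ one has $\mathcal E_n(x)=0$ for $x>0$). 1. If $\mu$ has a weak moment of order $rp$ with $r>2$, then for all $q>r$ and all $x>0$, $$\mathbb P\big(W_p^p(\mu,L_n)>x\big)\le\mathcal E_n(x)+C_{p,q,r}\left\{\frac{I_{2p,p}^q}{x^qn^{q/2}}+\frac{\|X\|_{rp,w}^{rp}}{x^rn^{r-1}}\right\}.$$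 2. If $I_{2p,p}<\infty$, then for all $x>0$, $$\mathbb P\big(W_p^p(\mu,L_n)>x\big)\le\mathcal E_n(x)+C_p\,\frac{I_{2p,p}^2}{x^2n}.$$ 3. If $\mu$ has a weak moment of order $rp$ with $r\in(\alpha/(\alpha-p),2)$, then for all $x>0$, $$\mathbb P\big(W_p^p(\mu,L_n)>x\big)\le\mathcal E_n(x)+C_{p,r}\,\frac{\|X\|_{rp,w}^{rp}}{x^rn^{r-1}}.$$ 4. If $I_{\alpha,p}<\infty$, then for all $x>0$, $$\mathbb P\big(W_p^p(\mu,L_n)>x\big)\le C_{p,\alpha,\beta}\,\frac{I_{\alpha,p}^{\alpha/(\alpha-p)}}{x^{\alpha/(\alpha-p)}\,n^{p/(\alpha-p)}}.$$ 5. If $\mu$ has a weak moment of order $rp$ with $r\in(1,\alpha/(\alpha-p))$, then for all $x>0$, $$\mathbb P\big(W_p^p(\mu,L_n)>x\big)\le C_{p,\alpha,\beta,r}\,\frac{\|X\|_{rp,w}^{rp}}{x^rn^{r-1}}.$$ -/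

import Mathlib

open MeasureTheory ProbabilityTheory Set
open scoped ENNReal NNReal

noncomputable section

namespace EmpiricalWasserstein

/-- The empirical measure `(1/n) ∑ᵢ δ_{xᵢ}` of an `n`-tuple of points. -/
def empiricalMeasure {E : Type*} [MeasurableSpace E] {n : ℕ} (x : Fin n → E) : Measure E :=
  (n : ℝ≥0∞)⁻¹ • ∑ i, Measure.dirac (x i)

/-- `W_p^p(μ, ν)`: the infimum of `∫ d(x,y)^p π(dx,dy)` over all measures `π` on `E × E` with
first marginal `μ` and second marginal `ν`. -/
def wassersteinPow {E : Type*} [MetricSpace E] [MeasurableSpace E] (p : ℝ) (μ ν : Measure E) :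
    ℝ≥0∞ :=
  ⨅ (π : Measure (E × E)) (_ : π.fst = μ ∧ π.snd = ν), ∫⁻ z, edist z.1 z.2 ^ p ∂π

/-- The covering numbers of `S ∩ B(x₀, r)` satisfy
`N(S ∩ B(x₀, r), δ) ≤ β (2r/δ)^α` for all `r > 0` and `δ ∈ (0, 2r]`.
The balls are closed, and the centres of the covering balls lie in the covered set. -/
def HasCoveringDim {E : Type*} [MetricSpace E] (S : Set E) (x₀ : E) (α β : ℝ) : Prop :=
  ∀ r δ : ℝ, 0 < r → 0 < δ → δ ≤ 2 * r →
    (Metric.coveringNumber δ.toNNReal (S ∩ Metric.closedBall x₀ r) : ℝ≥0∞) ≤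
      ENNReal.ofReal (β * (2 * r / δ) ^ α)

/-- The tail `H(t) = μ(B(x₀, t)ᶜ)`, with `B` the closed ball. -/
def tail {E : Type*} [MetricSpace E] [MeasurableSpace E] (x₀ : E) (μ : Measure E) (t : ℝ) :
    ℝ≥0∞ :=
  μ (Metric.closedBall x₀ t)ᶜ

/-- The `q`-th power `‖X‖_{q,w}^q = sup_{t ≥ 0} t^q H(t)` of the weak moment of order `q`. -/
def weakMomentPow {E : Type*} [MetricSpace E] [MeasurableSpace E] (x₀ : E) (μ : Measure E)
    (q : ℝ) : ℝ≥0∞ :=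
  ⨆ (t : ℝ) (_ : 0 ≤ t), ENNReal.ofReal (t ^ q) * tail x₀ μ t

/-- The `p`-th power `‖d(x₀, X)‖_p^p = ∫ d(x₀, y)^p μ(dy)` of the strong moment of order `p`. -/
def momentPow {E : Type*} [MetricSpace E] [MeasurableSpace E] (x₀ : E) (μ : Measure E)
    (p : ℝ) : ℝ≥0∞ :=
  ∫⁻ y, edist x₀ y ^ p ∂μ

/-- `I_{α,p} = ∫₀^∞ H(t)^{(α-p)/α} t^{p-1} dt`. For `α = 2p` the exponent of `H` is `1/2`. -/
def tailIntegral {E : Type*} [MetricSpace E] [MeasurableSpace E] (x₀ : E) (μ : Measure E)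
    (α p : ℝ) : ℝ≥0∞ :=
  ∫⁻ t in Ioi (0 : ℝ), tail x₀ μ t ^ ((α - p) / α) * ENNReal.ofReal (t ^ (p - 1))

/-- The deviation probability `ℙ(W_p^p(μ, L_n) > x)`. -/
def devProb {E Ω : Type*} [MetricSpace E] [MeasurableSpace E] [MeasurableSpace Ω]
    (P : Measure Ω) {n : ℕ} (X : Fin n → Ω → E) (μ : Measure E) (p x : ℝ) : ℝ :=
  P.real {ω | ENNReal.ofReal x < wassersteinPow p μ (empiricalMeasure fun i => X i ω)}

/-- The term `e² exp(-n c [x / I_{α,p}]^{α/p}) 1_{x ≤ κ ‖d(x₀, X)‖_p^p}`. -/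
def expTerm {E : Type*} [MetricSpace E] [MeasurableSpace E] (x₀ : E) (μ : Measure E)
    (p α c κ : ℝ) (n : ℕ) (x : ℝ) : ℝ :=
  Real.exp 2 * Real.exp (-(n * c * (x / (tailIntegral x₀ μ α p).toReal) ^ (α / p))) *
    (if x ≤ κ * (momentPow x₀ μ p).toReal then 1 else 0)

end EmpiricalWasserstein

end

open EmpiricalWasserstein

set_option linter.unusedSectionVars false

namespace EmpiricalWasserstein

/-! ### Partial couplings along nested finite partitions -/

section Coupling

/-! Cut the space into the dyadic shells 2^(k-1) < d(x₀,·) ≤ 2^k and transport μ to L_n shell by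
shell. Inside a shell, nested partitions with cells of diameter at most 4·2^k/2^l are matched from
the finest level upwards: mass common to both measures in a cell stays in that cell, and what a cell
of level l+1 lacks is supplied from within the enclosing cell of level l. The mass by which the
measures differ on a whole shell is routed through x₀. Hence W_p^p is controlled by three quantities
(`exists_innerCost_bound`): an inner cost, which is a weighted sum of cell deficits; the
fluctuations of the shell counts, weighted by 2^(kp)/n; and a remainder from a tiny ball around x₀
and from the outside of a large ball, provided that no sample point falls outside the large ball.

The inner cost yields the exponential term. A total deficit over disjoint cells is a maximum over
subfamilies of cells, so its Laplace transform exceeds a Gaussian one by at most a factor 2^(number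
of cells) (`lintegral_exp_deficit_le`). Levels and shells are combined by convexity of exp
(`lintegral_exp_sum_le`), without independence. Weights governed by 2^(kp) μ(shell k)^((α-p)/α) make
I_{α,p} appear (`chaining_term_le`). Each shell is refined until a cell is expected to hold about
one sample point, and α > 2p makes the finest level dominate. The log-Laplace transform is then of
order y + y^(α/(α-p)), and Chernoff's bound gives the power α/p (`measureReal_innerCost_le`).

The shell counts are binomial, with centered q-th moments of order m^(q/2) + m, where m is the mean;
Minkowski and Markov turn this into a tail bound (`measureReal_sum_centered_hits_le`). The m^(1/2)
part sums to I_{2p,p}, while under a weak moment of order rp a sum of powers γ of shell masses with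
rγ < 1 is geometric and dominated by the largest shell (`sum_shell_rpow_le_geomConst`). The large
radius T is chosen with T^p of order nx, so that the probability of a sample point outside is at
most a multiple of Q = ‖X‖_{rp,w}^{rp}/(x^r n^(r-1)) (`exists_devProb_le_add_truncConst`). The five
cases differ only in the choice of r and q and in how the two shell sums are bounded. When I_{α,p}
may be infinite, the truncated sum replaces it and the exponential itself becomes a multiple of Q.
-/

lemma inv_max_mul_le_one {a b : ℝ≥0∞} : (max a b)⁻¹ * b ≤ 1 := by
  rw [mul_comm, ← div_eq_mul_inv]
  exact ENNReal.div_le_of_le_mul (by rw [one_mul]; exact le_max_right _ _)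

/-- This is the mass kept in a cell when the product of the two restrictions is divided by the
larger of their masses. If both masses vanish, the infinite inverse is harmless because it
multiplies zero. -/
lemma inv_max_mul_mul_eq_min {a b : ℝ≥0∞} (ha : a ≠ ∞) (hb : b ≠ ∞) :
    (max a b)⁻¹ * b * a = min a b := by
  rcases le_total a b with h | h
  · rw [max_eq_right h, min_eq_left h]
    rcases eq_or_ne b 0 with rfl | h0
    · simp [nonpos_iff_eq_zero.1 h]
    · rw [ENNReal.inv_mul_cancel h0 hb, one_mul]
  · rw [max_eq_left h, min_eq_right h]
    rcases eq_or_ne a 0 with rfl | h0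
    · simp [nonpos_iff_eq_zero.1 h]
    · rw [mul_right_comm, ENNReal.inv_mul_cancel h0 ha, one_mul]

variable {E ι : Type*} [MeasurableSpace E]

lemma sum_restrict_fiber (μ : Measure E) (T : Finset ι) (g : E → ι) (hT : ∀ x, g x ∈ T)
    (hg : ∀ t, MeasurableSet (g ⁻¹' {t})) : ∑ t ∈ T, μ.restrict (g ⁻¹' {t}) = μ := by
  ext s hs
  have : s = ⋃ t ∈ T, s ∩ g ⁻¹' {t} := by
    ext x; simp only [mem_iUnion, mem_inter_iff, mem_preimage, mem_singleton_iff]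
    exact ⟨fun hx => ⟨g x, hT x, hx, rfl⟩, fun ⟨_, _, h, _⟩ => h⟩
  conv_rhs => rw [this]
  rw [measure_biUnion_finset, Measure.finsetSum_apply]
  · exact Finset.sum_congr rfl fun t _ => Measure.restrict_apply hs
  · intro t _ t' _ htt
    refine Set.disjoint_left.2 fun x hx hx' => htt ?_
    have h1 := hx.2
    have h2 := hx'.2
    simp only [mem_preimage, mem_singleton_iff] at h1 h2
    exact h1.symm.trans h2
  · exact fun t _ => hs.inter (hg t)

lemma sum_measure_fiber (μ : Measure E) (T : Finset ι) (g : E → ι) (hT : ∀ x, g x ∈ T)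
    (hg : ∀ t, MeasurableSet (g ⁻¹' {t})) : ∑ t ∈ T, μ (g ⁻¹' {t}) = μ univ := by
  conv_rhs => rw [← sum_restrict_fiber μ T g hT hg]
  simp [Measure.finsetSum_apply]

/-- Fractions at most 1 of the restrictions to disjoint fibers sum to a measure below μ, so the
subtraction of measures is exact and the remainder can be read off fiber by fiber. -/
lemma exists_sub_fiberwise (μ : Measure E) [IsFiniteMeasure μ] (T : Finset ι) (g : E → ι)
    (hT : ∀ x, g x ∈ T) (hg : ∀ t, MeasurableSet (g ⁻¹' {t})) (c : ι → ℝ≥0∞)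
    (hc : ∀ t, c t ≤ 1) :
    ∃ μ' : Measure E, ∑ t ∈ T, c t • μ.restrict (g ⁻¹' {t}) + μ' = μ ∧
      ∀ t ∈ T, μ' (g ⁻¹' {t}) = μ (g ⁻¹' {t}) - c t * μ (g ⁻¹' {t}) := by
  classical
  set ρ := ∑ t ∈ T, c t • μ.restrict (g ⁻¹' {t}) with hρ
  have hle : ρ ≤ μ := by
    conv_rhs => rw [← sum_restrict_fiber μ T g hT hg]
    refine Finset.sum_le_sum fun t _ => ?_
    calc c t • μ.restrict (g ⁻¹' {t}) ≤ (1 : ℝ≥0∞) • μ.restrict (g ⁻¹' {t}) := by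
          refine Measure.le_iff.2 fun s _ => ?_
          simp only [Measure.smul_apply, smul_eq_mul]
          gcongr
          exact hc t
      _ = _ := one_smul _ _
  have : IsFiniteMeasure ρ := isFiniteMeasure_of_le μ hle
  refine ⟨μ - ρ, by rw [add_comm, Measure.sub_add_cancel_of_le hle], fun t ht => ?_⟩
  rw [Measure.sub_apply (hg t) hle]
  congr 1
  rw [hρ, Measure.finsetSum_apply, Finset.sum_eq_single t]
  · simp [Measure.restrict_apply (hg t)]
  · intro t' _ htt
    have : g ⁻¹' {t} ∩ g ⁻¹' {t'} = ∅ := by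
      ext x; simp only [mem_inter_iff, mem_preimage, mem_singleton_iff, mem_empty_iff_false]
      exact iff_false_intro fun h => htt (h.2.symm.trans h.1)
    simp [Measure.restrict_apply (hg t), this]
  · exact fun h => absurd ht h

/-- Matching as much mass as possible inside each fiber of `g`. -/
lemma exists_coupling_fiberwise (μ ν : Measure E) [IsFiniteMeasure μ] [IsFiniteMeasure ν]
    (T : Finset ι) (g : E → ι) (hT : ∀ x, g x ∈ T) (hg : ∀ t, MeasurableSet (g ⁻¹' {t})) :
    ∃ (π : Measure (E × E)) (μ' ν' : Measure E), π.fst + μ' = μ ∧ π.snd + ν' = ν ∧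
      (∀ᵐ z ∂π, g z.1 = g z.2) ∧
      (∀ t ∈ T, μ' (g ⁻¹' {t}) = μ (g ⁻¹' {t}) - ν (g ⁻¹' {t})) ∧
      ∀ t ∈ T, ν' (g ⁻¹' {t}) = ν (g ⁻¹' {t}) - μ (g ⁻¹' {t}) := by
  classical
  set A : ι → Set E := fun t => g ⁻¹' {t} with hA
  -- With this weight the product on the square of a cell has mass min(μ(A t), ν(A t)), the largest
  -- that a coupling inside the cell can carry.
  set w : ι → ℝ≥0∞ := fun t => (max (μ (A t)) (ν (A t)))⁻¹ with hw
  set π : Measure (E × E) := ∑ t ∈ T, w t • (μ.restrict (A t)).prod (ν.restrict (A t)) with hπ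
  obtain ⟨μ', h1, h1'⟩ := exists_sub_fiberwise μ T g hT hg (fun t => w t * ν (A t))
    (fun t => inv_max_mul_le_one)
  obtain ⟨ν', h2, h2'⟩ := exists_sub_fiberwise ν T g hT hg (fun t => w t * μ (A t))
    (fun t => by simp only [hw]; rw [max_comm]; exact inv_max_mul_le_one)
  have hfst : π.fst = ∑ t ∈ T, (w t * ν (A t)) • μ.restrict (A t) := by
    ext s hs
    rw [Measure.fst_apply hs, hπ, Measure.finsetSum_apply, Measure.finsetSum_apply]
    refine Finset.sum_congr rfl fun t _ => ?_
    rw [Measure.smul_apply, Measure.smul_apply, ← Measure.fst_apply hs, Measure.fst, Measure.map_fst_prod]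
    simp [mul_assoc]
  have hsnd : π.snd = ∑ t ∈ T, (w t * μ (A t)) • ν.restrict (A t) := by
    ext s hs
    rw [Measure.snd_apply hs, hπ, Measure.finsetSum_apply, Measure.finsetSum_apply]
    refine Finset.sum_congr rfl fun t _ => ?_
    rw [Measure.smul_apply, Measure.smul_apply, ← Measure.snd_apply hs, Measure.snd, Measure.map_snd_prod]
    simp [mul_assoc]
  refine ⟨π, μ', ν', by rw [hfst, h1], by rw [hsnd, h2], ?_, fun t ht => ?_, fun t ht => ?_⟩
  · rw [hπ, ae_iff, Measure.finsetSum_apply]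
    refine Finset.sum_eq_zero fun t _ => ?_
    rw [Measure.smul_apply, Measure.prod_restrict, smul_eq_mul]
    refine mul_eq_zero_of_right _ ?_
    rw [← ae_iff]
    filter_upwards [ae_restrict_mem ((hg t).prod (hg t))] with z hz
    have h3 : g z.1 = t := hz.1
    have h4 : g z.2 = t := hz.2
    rw [h3, h4]
  · rw [h1' t ht, inv_max_mul_mul_eq_min (measure_ne_top _ _) (measure_ne_top _ _)]
    rcases le_total (μ (A t)) (ν (A t)) with h | h
    · rw [min_eq_left h, tsub_self, tsub_eq_zero_of_le h]
    · rw [min_eq_right h]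
  · rw [h2' t ht]
    simp only [hw]
    rw [max_comm, inv_max_mul_mul_eq_min (measure_ne_top _ _) (measure_ne_top _ _)]
    rcases le_total (μ (A t)) (ν (A t)) with h | h
    · rw [min_eq_right h]
    · rw [min_eq_left h, tsub_self, tsub_eq_zero_of_le h]

/-- Coupling along a chain of nested partitions, from the finest to the coarsest. -/
lemma exists_coupling_chain (cost : E × E → ℝ≥0∞) {G : Set E}
    (T : ℕ → Finset ι) (g : ℕ → E → ι) (Δ : ℕ → ℝ≥0∞) (M : ℕ)
    (hT : ∀ l ≤ M, ∀ x, g l x ∈ T l) (hg : ∀ l ≤ M, ∀ t, MeasurableSet (g l ⁻¹' {t}))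
    (hnest : ∀ l < M, ∀ x y, g (l + 1) x = g (l + 1) y → g l x = g l y)
    (hcost : ∀ l ≤ M, ∀ x ∈ G, ∀ y ∈ G, g l x = g l y → cost (x, y) ≤ Δ l)
    (μ ν : Measure E) [IsFiniteMeasure μ] [IsFiniteMeasure ν]
    (hμG : ∀ᵐ x ∂μ, x ∈ G) (hνG : ∀ᵐ x ∂ν, x ∈ G) :
    ∃ (π : Measure (E × E)) (μ' ν' : Measure E), π.fst + μ' = μ ∧ π.snd + ν' = ν ∧
      (∀ t ∈ T 0, μ' (g 0 ⁻¹' {t}) = μ (g 0 ⁻¹' {t}) - ν (g 0 ⁻¹' {t})) ∧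
      (∀ t ∈ T 0, ν' (g 0 ⁻¹' {t}) = ν (g 0 ⁻¹' {t}) - μ (g 0 ⁻¹' {t})) ∧
      ∫⁻ z, cost z ∂π ≤ Δ M * μ univ +
        ∑ l ∈ Finset.range M,
          Δ l * ∑ t ∈ T (l + 1), (μ (g (l + 1) ⁻¹' {t}) - ν (g (l + 1) ⁻¹' {t})) := by
  classical
  have key : ∀ (l : ℕ), l ≤ M → ∀ (μ ν μ' ν' : Measure E) [IsFiniteMeasure μ] [IsFiniteMeasure ν]
      (π : Measure (E × E)), (∀ᵐ x ∂μ, x ∈ G) → (∀ᵐ x ∂ν, x ∈ G) → π.fst + μ' = μ →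
      π.snd + ν' = ν → (∀ᵐ z ∂π, g l z.1 = g l z.2) →
      ∫⁻ z, cost z ∂π ≤ Δ l * μ univ := by
    intro l hl μ ν μ' ν' _ _ π hμ hν h1 h2 h3
    have hμ1 : ∀ᵐ z ∂π, z.1 ∈ G := by
      have : ∀ᵐ x ∂π.fst, x ∈ G :=
        ae_mono (by rw [← h1]; exact Measure.le_add_right le_rfl) hμ
      exact ae_of_ae_map measurable_fst.aemeasurable this
    have hν1 : ∀ᵐ z ∂π, z.2 ∈ G := by
      have : ∀ᵐ x ∂π.snd, x ∈ G :=
        ae_mono (by rw [← h2]; exact Measure.le_add_right le_rfl) hν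
      exact ae_of_ae_map measurable_snd.aemeasurable this
    calc ∫⁻ z, cost z ∂π ≤ ∫⁻ _, Δ l ∂π := by
          refine lintegral_mono_ae ?_
          filter_upwards [hμ1, hν1, h3] with z hz1 hz2 hz3
          exact hcost l hl z.1 hz1 z.2 hz2 hz3
      _ = Δ l * π univ := lintegral_const _
      _ ≤ Δ l * μ univ := by
          gcongr
          rw [← Measure.fst_univ, ← h1]
          exact (Measure.le_add_right le_rfl : π.fst ≤ π.fst + μ') univ
  induction M generalizing μ ν with
  | zero =>
    obtain ⟨π, μ', ν', h1, h2, h3, h4, h5⟩ :=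
      exists_coupling_fiberwise μ ν (T 0) (g 0) (hT 0 le_rfl) (hg 0 le_rfl)
    exact ⟨π, μ', ν', h1, h2, h4, h5, by
      simpa using key 0 le_rfl μ ν μ' ν' π hμG hνG h1 h2 h3⟩
  | succ M ih =>
    obtain ⟨π₁, μ₁, ν₁, h1, h2, h3, h4, h5⟩ :=
      exists_coupling_fiberwise μ ν (T (M + 1)) (g (M + 1)) (hT _ le_rfl) (hg _ le_rfl)
    have hμ₁ : μ₁ ≤ μ := by rw [← h1]; exact Measure.le_add_left le_rfl
    have hν₁ : ν₁ ≤ ν := by rw [← h2]; exact Measure.le_add_left le_rfl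
    have hπ₁ : IsFiniteMeasure π₁ := ⟨by
      rw [← Measure.fst_univ]
      refine lt_of_le_of_lt ?_ (measure_lt_top μ univ)
      rw [← h1]
      exact (Measure.le_add_right le_rfl : π₁.fst ≤ π₁.fst + μ₁) univ⟩
    have := isFiniteMeasure_of_le μ hμ₁
    have := isFiniteMeasure_of_le ν hν₁
    obtain ⟨π₂, μ₂, ν₂, k1, k2, k4, k5, k6⟩ := ih (fun l hl => hT l (by omega))
      (fun l hl => hg l (by omega)) (fun l hl => hnest l (by omega))
      (fun l hl => hcost l (by omega)) μ₁ ν₁ (ae_mono hμ₁ hμG) (ae_mono hν₁ hνG)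
      (fun l hl => key l (by omega))
    have hnest' : ∀ l ≤ M + 1, ∀ x y, g (M + 1) x = g (M + 1) y → g l x = g l y := by
      intro l hl x y hxy
      induction hl using Nat.decreasingInduction with
      | self => exact hxy
      | of_succ k hk ih' => exact hnest k hk x y ih'
    -- The coupling already built preserves the cells of level M+1, hence by nesting all coarser
    -- cells. It removes equal masses from both measures in each of them, so the differences seen at
    -- coarser levels are unchanged.
    have hsub : ∀ l ≤ M + 1, ∀ t, μ₁ (g l ⁻¹' {t}) - ν₁ (g l ⁻¹' {t}) =
          μ (g l ⁻¹' {t}) - ν (g l ⁻¹' {t}) ∧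
        ν₁ (g l ⁻¹' {t}) - μ₁ (g l ⁻¹' {t}) = ν (g l ⁻¹' {t}) - μ (g l ⁻¹' {t}) := by
      intro l hl t
      have e : π₁.fst (g l ⁻¹' {t}) = π₁.snd (g l ⁻¹' {t}) := by
        rw [Measure.fst_apply (hg l hl t), Measure.snd_apply (hg l hl t)]
        refine measure_congr ?_
        filter_upwards [h3] with z hz
        have := hnest' l hl _ _ hz
        simp only [eq_iff_iff]
        change g l z.1 = t ↔ g l z.2 = t
        rw [this]
      have e2 : π₁.snd (g l ⁻¹' {t}) ≠ ∞ := measure_ne_top _ _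
      rw [← h1, ← h2, Measure.add_apply, Measure.add_apply, e,
        ENNReal.add_sub_add_eq_sub_left e2, ENNReal.add_sub_add_eq_sub_left e2]
      exact ⟨rfl, rfl⟩
    refine ⟨π₁ + π₂, μ₂, ν₂, ?_, ?_, fun t ht => ?_, fun t ht => ?_, ?_⟩
    · rw [Measure.fst_add, add_assoc, k1, h1]
    · rw [Measure.snd_add, add_assoc, k2, h2]
    · rw [k4 t ht, (hsub 0 (by omega) t).1]
    · rw [k5 t ht, (hsub 0 (by omega) t).2]
    · rw [lintegral_add_measure, Finset.sum_range_succ]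
      -- Mass unmatched at level M+1 is moved at level M or coarser. This explains why `Δ l`
      -- multiplies deficits of level l+1.
      have hm : μ₁ univ = ∑ t ∈ T (M + 1),
          (μ (g (M + 1) ⁻¹' {t}) - ν (g (M + 1) ⁻¹' {t})) := by
        rw [← sum_measure_fiber μ₁ (T (M + 1)) (g (M + 1)) (hT _ le_rfl) (hg _ le_rfl)]
        exact Finset.sum_congr rfl h4
      refine (add_le_add (key (M + 1) le_rfl μ ν μ₁ ν₁ π₁ hμG hνG h1 h2 h3) k6).trans
        (le_of_eq ?_)
      rw [hm, add_comm (Δ M * _)]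
      congr 2
      refine Finset.sum_congr rfl fun l hl => ?_
      congr 1
      refine Finset.sum_congr rfl fun t _ => (hsub (l + 1) ?_ t).1
      have := Finset.mem_range.1 hl
      omega

end Coupling

end EmpiricalWasserstein

namespace EmpiricalWasserstein

/-! ### From partial couplings to the transport cost -/

section Transport

lemma edist_rpow_le {E : Type*} [MetricSpace E] {p : ℝ} (hp : 1 ≤ p) (x₀ x y : E) :
    edist x y ^ p ≤ 2 ^ (p - 1) * (edist x₀ x ^ p + edist x₀ y ^ p) :=
  calc edist x y ^ p ≤ (edist x₀ x + edist x₀ y) ^ p := by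
        refine ENNReal.rpow_le_rpow ?_ (by linarith)
        rw [edist_comm x₀ x]
        exact edist_triangle x x₀ y
    _ ≤ _ := ENNReal.rpow_add_le_mul_rpow_add_rpow _ _ hp

variable {E : Type*} [MetricSpace E] [MeasurableSpace E]

/-- Both measures have mass 1 and the two marginals of `π` have equal mass, so the two leftovers
have equal mass and their normalised product couples them. The triangle inequality through `x₀`
splits its cost into one integral per leftover. -/
lemma wassersteinPow_le_of_partial [OpensMeasurableSpace E] {p : ℝ} (hp : 1 ≤ p) (x₀ : E)
    (μ ν : Measure E) [IsProbabilityMeasure μ] [IsProbabilityMeasure ν]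
    (π : Measure (E × E)) (μ' ν' : Measure E) (h1 : π.fst + μ' = μ) (h2 : π.snd + ν' = ν) :
    wassersteinPow p μ ν ≤ ∫⁻ z, edist z.1 z.2 ^ p ∂π +
      2 ^ (p - 1) * (∫⁻ x, edist x₀ x ^ p ∂μ' + ∫⁻ x, edist x₀ x ^ p ∂ν') := by
  have hμ' : μ' ≤ μ := by rw [← h1]; exact Measure.le_add_left le_rfl
  have hν' : ν' ≤ ν := by rw [← h2]; exact Measure.le_add_left le_rfl
  have := isFiniteMeasure_of_le μ hμ'
  have := isFiniteMeasure_of_le ν hν'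
  have hπ : π univ ≠ ∞ := by
    rw [← Measure.fst_univ]
    refine ne_top_of_le_ne_top (measure_ne_top μ univ) ?_
    rw [← h1]
    exact (Measure.le_add_right le_rfl : π.fst ≤ π.fst + μ') univ
  have hmass : μ' univ = ν' univ := by
    have e1 : π univ + μ' univ = 1 := by
      rw [← Measure.fst_univ, ← Measure.add_apply, h1, measure_univ]
    have e2 : π univ + ν' univ = 1 := by
      rw [← Measure.snd_univ, ← Measure.add_apply, h2, measure_univ]
    exact (ENNReal.add_right_inj hπ).1 (e1.trans e2.symm)
  rcases eq_or_ne (μ' univ) 0 with h0 | h0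
  · have hμ0 : μ' = 0 := Measure.measure_univ_eq_zero.1 h0
    have hν0 : ν' = 0 := Measure.measure_univ_eq_zero.1 (hmass ▸ h0)
    rw [hμ0, add_zero] at h1
    rw [hν0, add_zero] at h2
    exact (iInf₂_le π ⟨h1, h2⟩).trans le_self_add
  · have hfin : μ' univ ≠ ∞ := measure_ne_top _ _
    set ρ : Measure (E × E) := (μ' univ)⁻¹ • μ'.prod ν' with hρ
    have hρ1 : ρ.map Prod.fst = μ' := by
      rw [hρ, Measure.map_smul, Measure.map_fst_prod, smul_smul, ← hmass,
        ENNReal.inv_mul_cancel h0 hfin, one_smul]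
    have hρ2 : ρ.map Prod.snd = ν' := by
      rw [hρ, Measure.map_smul, Measure.map_snd_prod, smul_smul,
        ENNReal.inv_mul_cancel h0 hfin, one_smul]
    have hm : Measurable fun x : E => edist x₀ x ^ p :=
      (measurable_edist_right (x := x₀)).pow_const p
    calc wassersteinPow p μ ν ≤ ∫⁻ z, edist z.1 z.2 ^ p ∂(π + ρ) := by
          refine iInf₂_le (π + ρ) ⟨?_, ?_⟩
          · rw [Measure.fst_add, Measure.fst, Measure.fst, hρ1]; exact h1
          · rw [Measure.snd_add, Measure.snd, Measure.snd, hρ2]; exact h2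
      _ = ∫⁻ z, edist z.1 z.2 ^ p ∂π + ∫⁻ z, edist z.1 z.2 ^ p ∂ρ := lintegral_add_measure _ _ _
      _ ≤ _ := by
          gcongr
          calc ∫⁻ z, edist z.1 z.2 ^ p ∂ρ
              ≤ ∫⁻ z, 2 ^ (p - 1) * (edist x₀ z.1 ^ p + edist x₀ z.2 ^ p) ∂ρ :=
                lintegral_mono fun z => edist_rpow_le hp x₀ z.1 z.2
            _ = 2 ^ (p - 1) * (∫⁻ z, edist x₀ z.1 ^ p ∂ρ + ∫⁻ z, edist x₀ z.2 ^ p ∂ρ) := by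
                rw [lintegral_const_mul, lintegral_add_left]
                · exact hm.comp measurable_fst
                · exact (hm.comp measurable_fst).add (hm.comp measurable_snd)
            _ = _ := by
                rw [← lintegral_map hm measurable_fst, ← lintegral_map hm measurable_snd, hρ1, hρ2]

/-- Gluing partial couplings living on finitely many disjoint shells. -/
lemma wassersteinPow_le_of_shells [OpensMeasurableSpace E] {κ : Type*} {p : ℝ} (hp : 1 ≤ p)
    (x₀ : E) (μ ν : Measure E) [IsProbabilityMeasure μ] [IsProbabilityMeasure ν] (K : Finset κ)
    (A : κ → Set E) (hA : ∀ k, MeasurableSet (A k))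
    (hdisj : Pairwise (Function.onFun Disjoint A))
    (π : κ → Measure (E × E)) (μ' ν' : κ → Measure E) (R : κ → ℝ≥0∞)
    (hR : ∀ k, ∀ x ∈ A k, edist x₀ x ≤ R k)
    (h1 : ∀ k ∈ K, (π k).fst + μ' k = μ.restrict (A k))
    (h2 : ∀ k ∈ K, (π k).snd + ν' k = ν.restrict (A k)) :
    wassersteinPow p μ ν ≤ ∑ k ∈ K, ∫⁻ z, edist z.1 z.2 ^ p ∂(π k) +
      2 ^ (p - 1) * (∑ k ∈ K, R k ^ p * (μ' k univ + ν' k univ) +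
        (∫⁻ x in (⋃ k ∈ K, A k)ᶜ, edist x₀ x ^ p ∂μ +
          ∫⁻ x in (⋃ k ∈ K, A k)ᶜ, edist x₀ x ^ p ∂ν)) := by
  classical
  set U := ⋃ k ∈ K, A k with hU
  have hUm : MeasurableSet U := Finset.measurableSet_biUnion K fun k _ => hA k
  have hsum : ∀ m : Measure E, ∑ k ∈ K, m.restrict (A k) + m.restrict Uᶜ = m := by
    intro m
    have : ∑ k ∈ K, m.restrict (A k) = m.restrict U := by
      ext s hs
      rw [Measure.restrict_apply hs, hU, inter_iUnion₂, measure_biUnion_finset,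
        Measure.finsetSum_apply]
      · exact Finset.sum_congr rfl fun k _ => Measure.restrict_apply hs
      · exact fun i _ j _ hij => (hdisj hij).mono inter_subset_right inter_subset_right
      · exact fun k _ => hs.inter (hA k)
    rw [this, Measure.restrict_add_restrict_compl hUm]
  have hfst : (∑ k ∈ K, π k).fst + (∑ k ∈ K, μ' k + μ.restrict Uᶜ) = μ := by
    have e : (∑ k ∈ K, π k).fst = ∑ k ∈ K, (π k).fst := by
      ext s hs
      simp [Measure.fst_apply hs, Measure.finsetSum_apply]
    conv_rhs => rw [← hsum μ, ← Finset.sum_congr rfl h1, Finset.sum_add_distrib]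
    rw [e, add_assoc]
  have hsnd : (∑ k ∈ K, π k).snd + (∑ k ∈ K, ν' k + ν.restrict Uᶜ) = ν := by
    have e : (∑ k ∈ K, π k).snd = ∑ k ∈ K, (π k).snd := by
      ext s hs
      simp [Measure.snd_apply hs, Measure.finsetSum_apply]
    conv_rhs => rw [← hsum ν, ← Finset.sum_congr rfl h2, Finset.sum_add_distrib]
    rw [e, add_assoc]
  have hint : ∀ (m m' : Measure E) (k : κ), m' ≤ m.restrict (A k) →
      ∫⁻ x, edist x₀ x ^ p ∂m' ≤ R k ^ p * m' univ := by
    intro m m' k hle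
    rw [← lintegral_const]
    refine lintegral_mono_ae ?_
    filter_upwards [ae_mono hle (ae_restrict_mem (hA k))] with x hx
    exact ENNReal.rpow_le_rpow (hR k x hx) (by linarith)
  refine (wassersteinPow_le_of_partial hp x₀ μ ν _ _ _ hfst hsnd).trans ?_
  rw [lintegral_finsetSum_measure, lintegral_add_measure, lintegral_add_measure,
    lintegral_finsetSum_measure, lintegral_finsetSum_measure, add_add_add_comm,
    ← Finset.sum_add_distrib]
  gcongr with k hk
  rw [mul_add]
  refine add_le_add (hint μ _ k ?_) (hint ν _ k ?_)
  · rw [← h1 k hk]; exact Measure.le_add_left le_rfl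
  · rw [← h2 k hk]; exact Measure.le_add_left le_rfl

end Transport

/-! ### Finite nets and nested measurable partitions of a ball -/

section Nets

/-- At scale δ = R/2^l the ratio 2R/δ is 2·2^l, so the cardinality bound does not depend on the
radius and is uniform over the shells. -/
lemma exists_finset_net {E : Type*} [MetricSpace E] {S : Set E} {x₀ : E} {α β : ℝ} (h : HasCoveringDim S x₀ α β) {R : ℝ}
    (hR : 0 < R) (l : ℕ) (hβ : 0 < β) :
    ∃ T : Finset E, (↑T ⊆ S ∩ Metric.closedBall x₀ R) ∧
      (∀ x ∈ S ∩ Metric.closedBall x₀ R, ∃ t ∈ T, dist x t ≤ R / 2 ^ l) ∧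
      (T.card : ℝ) ≤ β * (2 * 2 ^ l : ℝ) ^ α := by
  have hδ : 0 < R / 2 ^ l := by positivity
  have hle := h R (R / 2 ^ l) hR hδ (by
    have : R / 2 ^ l ≤ R := div_le_self hR.le (one_le_pow₀ one_le_two)
    linarith)
  have hfin : Metric.coveringNumber (R / 2 ^ l).toNNReal (S ∩ Metric.closedBall x₀ R) ≠ ⊤ := by
    intro htop
    rw [htop] at hle
    simp at hle
  obtain ⟨C, hC, hCfin, hcov, hcard⟩ := Metric.exists_set_encard_eq_coveringNumber hfin
  refine ⟨hCfin.toFinset, by simpa using hC, fun x hx => ?_, ?_⟩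
  · obtain ⟨t, ht, hxt⟩ := hcov hx
    refine ⟨t, by simpa using ht, ?_⟩
    have hxt' : edist x t ≤ ((R / 2 ^ l).toNNReal : ℝ≥0∞) := hxt
    rw [edist_dist] at hxt'
    exact (ENNReal.ofReal_le_ofReal_iff hδ.le).1 hxt'
  · rw [← hcard, hCfin.encard_eq_coe_toFinset_card] at hle
    have e : 2 * R / (R / 2 ^ l) = 2 * 2 ^ l := by field_simp
    rw [e] at hle
    have : ENNReal.ofReal (hCfin.toFinset.card : ℝ) ≤ ENNReal.ofReal (β * (2 * 2 ^ l : ℝ) ^ α) := by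
      simpa using hle
    exact (ENNReal.ofReal_le_ofReal_iff (by positivity)).1 this

variable {E : Type*} [MetricSpace E] [MeasurableSpace E]

/-- A finite measurable selection of a nearest point in a finite set. -/
lemma exists_nearest_map [OpensMeasurableSpace E] (T : Finset E) (hT : T.Nonempty) :
    ∃ z : E → E, (∀ x, z x ∈ T) ∧ (∀ t, MeasurableSet (z ⁻¹' {t})) ∧
      ∀ x, ∀ t ∈ T, dist x (z x) ≤ dist x t := by
  classical
  obtain ⟨t₀, ht₀⟩ := hT
  obtain ⟨N, e, he, heT⟩ : ∃ (N : ℕ) (e : ℕ → E), (∀ i, e i ∈ T) ∧ ∀ t ∈ T, ∃ i ≤ N, e i = t := by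
    refine ⟨T.card, fun i => if h : i < T.card then (T.equivFin.symm ⟨i, h⟩ : E) else t₀, ?_, ?_⟩
    · intro i
      by_cases h : i < T.card
      · simp [h]
      · simp [h, ht₀]
    · intro t ht
      refine ⟨T.equivFin ⟨t, ht⟩, (T.equivFin ⟨t, ht⟩).2.le, ?_⟩
      simp
  refine ⟨SimpleFunc.nearestPt e N, fun x => ?_, fun t => SimpleFunc.measurableSet_fiber _ _,
    fun x t ht => ?_⟩
  · exact he _
  · obtain ⟨i, hi, rfl⟩ := heT t ht
    have := SimpleFunc.edist_nearestPt_le e x hi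
    rw [edist_dist, edist_dist, ENNReal.ofReal_le_ofReal_iff dist_nonneg] at this
    rwa [dist_comm x, dist_comm x]

/-- A nested chain of finite partitions of a ball, with geometrically decreasing cells. -/
lemma exists_nested_nets [OpensMeasurableSpace E] {S : Set E} {x₀ : E} {α β : ℝ}
    (h : HasCoveringDim S x₀ α β) (hβ : 0 < β) {R : ℝ} (hR : 0 < R)
    (hne : (S ∩ Metric.closedBall x₀ R).Nonempty) (M : ℕ) :
    ∃ (T : ℕ → Finset E) (g : ℕ → E → E) (G : Set E),
      MeasurableSet G ∧ S ∩ Metric.closedBall x₀ R ⊆ G ∧ G ⊆ Metric.closedBall x₀ R ∧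
      (∀ l ≤ M, ∀ x, g l x ∈ T l) ∧ (∀ l ≤ M, ∀ t, MeasurableSet (g l ⁻¹' {t})) ∧
      (∀ l < M, ∀ x y, g (l + 1) x = g (l + 1) y → g l x = g l y) ∧
      (∀ l ≤ M, ∀ x ∈ G, ∀ y ∈ G, g l x = g l y → dist x y ≤ 4 * R / 2 ^ l) ∧
      T 0 = {x₀} ∧ ∀ l, 1 ≤ l → ((T l).card : ℝ) ≤ β * (2 * 2 ^ l : ℝ) ^ α := by
  classical
  choose N hN1 hN2 hN3 using fun l => exists_finset_net h hR l hβ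
  have hNne : ∀ l, (N l).Nonempty := fun l => by
    obtain ⟨x, hx⟩ := hne
    obtain ⟨t, ht, -⟩ := hN2 l x hx
    exact ⟨t, ht⟩
  have hpar : ∀ l (x : E), ∃ t ∈ N l, x ∈ S ∩ Metric.closedBall x₀ R → dist x t ≤ R / 2 ^ l := by
    intro l x
    by_cases hx : x ∈ S ∩ Metric.closedBall x₀ R
    · obtain ⟨t, ht, hd⟩ := hN2 l x hx
      exact ⟨t, ht, fun _ => hd⟩
    · obtain ⟨t, ht⟩ := hNne l
      exact ⟨t, ht, fun h => absurd h hx⟩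
  choose par hpar1 hpar2 using hpar
  obtain ⟨z, hz1, hz2, hz3⟩ := exists_nearest_map (N M) (hNne M)
  -- The index j counts coarsening steps: `u j` takes values in the net of level M - j. Every map
  -- factors through the finest projection `z`, which has finite range, so nesting and measurability
  -- come for free although the parents are chosen arbitrarily.
  let u : ℕ → E → E := fun j => Nat.rec z (fun j f => par (M - (j + 1)) ∘ f) j
  have u0 : u 0 = z := rfl
  have us : ∀ j, u (j + 1) = par (M - (j + 1)) ∘ u j := fun j => rfl
  have huT : ∀ j, ∀ x, u j x ∈ N (M - j) := by
    intro j x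
    cases j with
    | zero => exact hz1 x
    | succ j => rw [us]; exact hpar1 _ _
  have hum : ∀ j, ∃ φ : E → E, u j = φ ∘ z := by
    intro j
    induction j with
    | zero => exact ⟨id, rfl⟩
    | succ j ih =>
      obtain ⟨φ, hφ⟩ := ih
      exact ⟨par (M - (j + 1)) ∘ φ, by rw [us, hφ]; rfl⟩
  have hzm : ∀ B : Set E, MeasurableSet (z ⁻¹' B) := by
    intro B
    have : z ⁻¹' B = ⋃ t ∈ (N M).filter (· ∈ B), z ⁻¹' {t} := by
      ext x
      simp only [mem_preimage, Finset.mem_filter, mem_iUnion, mem_singleton_iff, exists_prop]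
      exact ⟨fun hx => ⟨z x, ⟨hz1 x, hx⟩, rfl⟩, fun ⟨t, ⟨_, ht⟩, e⟩ => e ▸ ht⟩
    rw [this]
    exact Finset.measurableSet_biUnion _ fun t _ => hz2 t
  -- `S` need not be measurable. This closed set contains the relevant part of it and is all that
  -- the distance estimates need.
  set G : Set E := {x | ∃ t ∈ N M, dist x t ≤ R / 2 ^ M} ∩ Metric.closedBall x₀ R with hG
  -- The steps towards the root form a geometric series, so the total displacement is at most twice
  -- the last scale.
  have hud : ∀ j ≤ M, ∀ x ∈ G, dist x (u j x) ≤ 2 * (R / 2 ^ (M - j)) := by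
    intro j hj x hx
    induction j with
    | zero =>
      obtain ⟨t, ht, hd⟩ := hx.1
      have := hz3 x t ht
      rw [u0]
      have : 0 < R / 2 ^ M := by positivity
      simp only [tsub_zero]
      linarith
    | succ j ih =>
      have h1 := ih (by omega)
      have h2 := hpar2 (M - (j + 1)) (u j x) (hN1 _ (huT j x))
      have e : M - j = M - (j + 1) + 1 := by omega
      have e2 : 2 * (R / 2 ^ (M - j)) = R / 2 ^ (M - (j + 1)) := by
        rw [e, pow_succ]; field_simp
      rw [us]
      calc dist x (par (M - (j + 1)) (u j x)) ≤ dist x (u j x) + dist (u j x) _ :=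
            dist_triangle _ _ _
        _ ≤ R / 2 ^ (M - (j + 1)) + R / 2 ^ (M - (j + 1)) := by
            rw [e2] at h1; exact add_le_add h1 h2
        _ = _ := by ring
  -- Level 0 is replaced by the trivial one-cell partition, so that the mass left after the whole
  -- chain is exactly the difference of the total masses.
  refine ⟨fun l => if l = 0 then {x₀} else N l, fun l => if l = 0 then fun _ => x₀ else u (M - l),
    G, ?_, ?_, inter_subset_right, ?_, ?_, ?_, ?_, by simp, ?_⟩
  · refine MeasurableSet.inter ?_ Metric.isClosed_closedBall.measurableSet
    have : {x | ∃ t ∈ N M, dist x t ≤ R / 2 ^ M} = ⋃ t ∈ N M, Metric.closedBall t (R / 2 ^ M) := by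
      ext x; simp
    rw [this]
    exact Finset.measurableSet_biUnion _ fun t _ => Metric.isClosed_closedBall.measurableSet
  · exact fun x hx => ⟨hN2 M x hx, hx.2⟩
  · intro l hl x
    by_cases h0 : l = 0
    · simp [h0]
    · have := huT (M - l) x
      rw [Nat.sub_sub_self hl] at this
      simpa [h0] using this
  · intro l hl t
    by_cases h0 : l = 0
    · simp only [h0, if_true]
      exact MeasurableSet.const (x₀ = t)
    · obtain ⟨φ, hφ⟩ := hum (M - l)
      simp only [h0, if_false, hφ, preimage_comp]
      exact hzm _
  · intro l hl x y hxy
    by_cases h0 : l = 0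
    · simp [h0]
    · have e : M - l = M - (l + 1) + 1 := by omega
      simp only [h0, if_false, Nat.add_eq_zero_iff, one_ne_zero, and_false] at hxy ⊢
      rw [e, us, Function.comp, Function.comp, hxy]
  · intro l hl x hx y hy hxy
    by_cases h0 : l = 0
    · have h1 := hx.2
      have h2 := hy.2
      rw [Metric.mem_closedBall] at h1 h2
      have := dist_triangle_right x y x₀
      subst h0
      simp only [pow_zero, div_one]
      linarith
    · simp only [h0, if_false] at hxy
      have h1 := hud (M - l) (by omega) x hx
      have h2 := hud (M - l) (by omega) y hy
      rw [Nat.sub_sub_self hl] at h1 h2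
      rw [← hxy] at h2
      have := dist_triangle_right x y (u (M - l) x)
      have e : 4 * R / 2 ^ l = 2 * (R / 2 ^ l) + 2 * (R / 2 ^ l) := by ring
      linarith
  · intro l hl
    have h0 : l ≠ 0 := by omega
    simpa [h0] using hN3 l

end Nets

end EmpiricalWasserstein

namespace EmpiricalWasserstein

/-! ### Laplace transforms and moments of binomial counts -/

section Counting

/-- The number of sample points in `A`. -/
noncomputable def hits {E Ω : Type*} {n : ℕ} (X : Fin n → Ω → E) (A : Set E) (ω : Ω) : ℝ :=
  ∑ i, A.indicator (fun _ => (1 : ℝ)) (X i ω)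

variable {E Ω : Type*} {n : ℕ} {X : Fin n → Ω → E}

lemma hits_nonneg (A : Set E) (ω : Ω) : 0 ≤ hits X A ω :=
  Finset.sum_nonneg fun _ _ => indicator_nonneg (fun _ _ => zero_le_one) _

/-- Integrality is what makes the q-th moment of a count with small mean m of order m, rather than
m^q or m^(q/2). -/
lemma hits_eq_zero_or_one_le (A : Set E) (ω : Ω) : hits X A ω = 0 ∨ 1 ≤ hits X A ω := by
  by_cases h : ∀ i, X i ω ∉ A
  · left
    exact Finset.sum_eq_zero fun i _ => indicator_of_notMem (h i) _
  · right
    push Not at h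
    obtain ⟨i, hi⟩ := h
    have := Finset.single_le_sum (f := fun i => A.indicator (fun _ => (1 : ℝ)) (X i ω))
      (fun i _ => indicator_nonneg (fun _ _ => zero_le_one) _) (Finset.mem_univ i)
    simpa [hi, hits] using this

lemma sum_hits_eq {ι : Type*} (B : Finset ι) (A : ι → Set E)
    (hd : Pairwise (Function.onFun Disjoint A)) (ω : Ω) :
    ∑ t ∈ B, hits X (A t) ω = hits X (⋃ t ∈ B, A t) ω := by
  unfold hits
  rw [Finset.sum_comm]
  refine Finset.sum_congr rfl fun i _ => ?_
  rw [Finset.indicator_biUnion_apply]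
  exact fun i _ j _ hij => hd hij

variable [MeasurableSpace E]

lemma empiricalMeasure_apply (hn : 0 < n) {A : Set E} (hA : MeasurableSet A) (ω : Ω) :
    empiricalMeasure (fun i => X i ω) A = ENNReal.ofReal (hits X A ω / n) := by
  have hn' : (0 : ℝ) < n := by exact_mod_cast hn
  rw [empiricalMeasure, Measure.smul_apply, Measure.finsetSum_apply, hits,
    ENNReal.ofReal_div_of_pos hn', ENNReal.ofReal_sum_of_nonneg, ENNReal.ofReal_natCast,
    smul_eq_mul, mul_comm, div_eq_mul_inv]
  · congr 1
    refine Finset.sum_congr rfl fun i _ => ?_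
    rw [Measure.dirac_apply' _ hA]
    by_cases h : X i ω ∈ A <;> simp [h]
  · exact fun i _ => indicator_nonneg (fun _ _ => zero_le_one) _

lemma isProbabilityMeasure_empiricalMeasure (hn : 0 < n) (ω : Ω) :
    IsProbabilityMeasure (empiricalMeasure fun i => X i ω) := by
  refine ⟨?_⟩
  rw [empiricalMeasure_apply hn MeasurableSet.univ]
  have hn' : (n : ℝ) ≠ 0 := by exact_mod_cast hn.ne'
  simp [hits, hn']

variable [MeasurableSpace Ω]

lemma measurable_hits (hX : ∀ i, Measurable (X i)) {A : Set E} (hA : MeasurableSet A) :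
    Measurable (hits X A) :=
  Finset.measurable_sum _ fun i _ => (measurable_const.indicator hA).comp (hX i)

variable {P : Measure Ω} [IsProbabilityMeasure P] {μ : Measure E} [IsProbabilityMeasure μ]

/-- The exponential moments of a binomial variable are dominated by Poisson ones. -/
lemma lintegral_exp_hits_le (hX : ∀ i, Measurable (X i)) (hind : iIndepFun X P)
    (hlaw : ∀ i, P.map (X i) = μ) {A : Set E} (hA : MeasurableSet A) (s : ℝ) :
    ∫⁻ ω, ENNReal.ofReal (Real.exp (s * hits X A ω)) ∂P ≤
      ENNReal.ofReal (Real.exp (n * μ.real A * (Real.exp s - 1))) := by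
  set φ : E → ℝ := A.indicator fun _ => 1 with hφ
  have hφm : Measurable φ := measurable_const.indicator hA
  have hm : ∀ i, Measurable (fun ω => φ (X i ω)) := fun i => hφm.comp (hX i)
  have hind' : iIndepFun (fun i ω => φ (X i ω)) P := hind.comp (fun _ => φ) fun _ => hφm
  have hmgf := hind'.mgf_sum (t := s) hm Finset.univ
  have h1 : ∀ i, mgf (fun ω => φ (X i ω)) P s = 1 + (Real.exp s - 1) * μ.real A := by
    intro i
    have e : ∀ x, Real.exp (s * φ x) = 1 + (Real.exp s - 1) * φ x := by
      intro x
      by_cases hx : x ∈ A <;> simp [hφ, hx]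
    rw [mgf]
    rw [show (fun ω => Real.exp (s * φ (X i ω))) = (fun x => 1 + (Real.exp s - 1) * φ x) ∘ X i
      from funext fun ω => e _]
    have hi : Integrable φ μ := (integrable_const 1).indicator hA
    have : ∫ x, (1 + (Real.exp s - 1) * φ x) ∂μ = 1 + (Real.exp s - 1) * μ.real A := by
      rw [integral_add (integrable_const _) (hi.const_mul _), integral_const_mul,
        hφ, integral_indicator hA]
      simp
    rw [← this, ← hlaw i, integral_map (hX i).aemeasurable]
    · rfl
    · exact ((hφm.const_mul _).const_add _).aestronglyMeasurable
  have hfun : (∑ i, fun ω => φ (X i ω)) = hits X A := by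
    ext ω; simp [hits, hφ]
  rw [hfun] at hmgf
  have hint : Integrable (fun ω => Real.exp (s * hits X A ω)) P := by
    refine Integrable.of_bound (C := Real.exp (|s| * n))
      ((measurable_hits hX hA).const_mul s).exp.aestronglyMeasurable (Filter.Eventually.of_forall
        fun ω => ?_)
    rw [Real.norm_eq_abs, Real.abs_exp, Real.exp_le_exp]
    have h2 : hits X A ω ≤ n := by
      calc hits X A ω ≤ ∑ _i : Fin n, (1 : ℝ) :=
            Finset.sum_le_sum fun i _ => indicator_le_self' (fun _ _ => zero_le_one) _
        _ = n := by simp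
    calc s * hits X A ω ≤ |s| * hits X A ω :=
          mul_le_mul_of_nonneg_right (le_abs_self s) (hits_nonneg _ _)
      _ ≤ |s| * n := mul_le_mul_of_nonneg_left h2 (abs_nonneg s)
  rw [← ofReal_integral_eq_lintegral_ofReal hint
    (Filter.Eventually.of_forall fun ω => (Real.exp_pos _).le)]
  refine ENNReal.ofReal_le_ofReal ?_
  rw [← mgf, hmgf, Finset.prod_congr rfl fun i _ => h1 i, Finset.prod_const, Finset.card_univ,
    Fintype.card_fin, mul_assoc, Real.exp_nat_mul]
  refine pow_le_pow_left₀ ?_ ?_ n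
  · have h3 : μ.real A ≤ 1 := measureReal_le_one
    have h4 : 0 ≤ μ.real A := measureReal_nonneg
    have := Real.exp_pos s
    nlinarith
  · rw [mul_comm (μ.real A), add_comm]
    exact Real.add_one_le_exp _

/-- Raise y/q ≤ exp(y/q) to the power q. The inequality serves twice: to pass from exponential
moments to q-th moments, and to turn exponential decay into polynomial decay. -/
lemma rpow_le_rpow_self_mul_exp {q y : ℝ} (hq : 0 < q) (hy : 0 ≤ y) :
    y ^ q ≤ q ^ q * Real.exp y := by
  have h : y / q ≤ Real.exp (y / q) := by linarith [Real.add_one_le_exp (y / q)]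
  calc y ^ q = (q * (y / q)) ^ q := by rw [mul_div_cancel₀ _ hq.ne']
    _ = q ^ q * (y / q) ^ q := Real.mul_rpow hq.le (by positivity)
    _ ≤ q ^ q * (Real.exp (y / q)) ^ q := by gcongr
    _ = q ^ q * Real.exp y := by rw [← Real.exp_mul, div_mul_cancel₀ _ hq.ne']

lemma lintegral_exp_centered_hits_le (hX : ∀ i, Measurable (X i)) (hind : iIndepFun X P)
    (hlaw : ∀ i, P.map (X i) = μ) {A : Set E} (hA : MeasurableSet A) (s : ℝ) :
    ∫⁻ ω, ENNReal.ofReal (Real.exp (s * (hits X A ω - n * μ.real A))) ∂P ≤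
      ENNReal.ofReal (Real.exp (n * μ.real A * (Real.exp s - 1 - s))) := by
  have e : ∀ ω, ENNReal.ofReal (Real.exp (s * (hits X A ω - n * μ.real A))) =
      ENNReal.ofReal (Real.exp (-(s * (n * μ.real A)))) *
        ENNReal.ofReal (Real.exp (s * hits X A ω)) := by
    intro ω
    rw [← ENNReal.ofReal_mul (Real.exp_pos _).le, ← Real.exp_add]
    ring_nf
  simp_rw [e]
  rw [lintegral_const_mul _ (((measurable_hits hX hA).const_mul s).exp.ennreal_ofReal)]
  refine (mul_le_mul_right (lintegral_exp_hits_le hX hind hlaw hA s) _).trans (le_of_eq ?_)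
  rw [← ENNReal.ofReal_mul (Real.exp_pos _).le, ← Real.exp_add]
  ring_nf

/-- A Rosenthal type bound for the centered moments of a binomial variable. -/
lemma lintegral_abs_centered_hits_rpow_le {q : ℝ} (hq : 1 ≤ q) (hX : ∀ i, Measurable (X i))
    (hind : iIndepFun X P) (hlaw : ∀ i, P.map (X i) = μ) {A : Set E} (hA : MeasurableSet A) :
    ∫⁻ ω, ENNReal.ofReal (|hits X A ω - n * μ.real A| ^ q) ∂P ≤
      ENNReal.ofReal ((4 * Real.exp 2 * q ^ q + 1) *
        ((n * μ.real A) ^ (q / 2) + n * μ.real A)) := by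
  set m := n * μ.real A with hm
  have hq0 : 0 < q := by linarith
  have hm0 : 0 ≤ m := by positivity
  have hmeas := measurable_hits (X := X) hX hA
  have hqq : 0 < q ^ q := by positivity
  have hexp2 : Real.exp 1 ≤ Real.exp 2 := Real.exp_le_exp.2 (by norm_num)
  rcases le_total 1 m with h1 | h1
  -- For m ≥ 1 the count is measured in units of its standard deviation: since s ≤ 1, the exponent
  -- m(e^s - 1 - s) is at most m s² = 1.
  · set s := m ^ (-(1 / 2) : ℝ) with hs
    have hs0 : 0 < s := by positivity
    have hs1 : s ≤ 1 := Real.rpow_le_one_of_one_le_of_nonpos h1 (by norm_num)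
    have hms : m * s ^ 2 = 1 := by
      rw [hs, ← Real.rpow_natCast, ← Real.rpow_mul hm0]
      norm_num
      rw [Real.rpow_neg_one, mul_inv_cancel₀ (by linarith)]
    have hsq : s ^ (-q) = m ^ (q / 2) := by
      rw [hs, ← Real.rpow_mul hm0]; ring_nf
    have hpt : ∀ y : ℝ, |y| ^ q ≤ m ^ (q / 2) * q ^ q * (Real.exp (s * y) + Real.exp (-s * y)) := by
      intro y
      have h2 := rpow_le_rpow_self_mul_exp hq0 (y := s * |y|) (by positivity)
      rw [Real.mul_rpow hs0.le (abs_nonneg y)] at h2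
      have h3 : Real.exp (s * |y|) ≤ Real.exp (s * y) + Real.exp (-s * y) := by
        rcases abs_cases y with h | h <;> rw [h.1]
        · linarith [Real.exp_pos (-s * y)]
        · rw [show s * -y = -s * y by ring]; linarith [Real.exp_pos (s * y)]
      calc |y| ^ q = s ^ (-q) * (s ^ q * |y| ^ q) := by
            rw [← mul_assoc, ← Real.rpow_add hs0]; simp
        _ ≤ s ^ (-q) * (q ^ q * Real.exp (s * |y|)) := by gcongr
        _ ≤ s ^ (-q) * (q ^ q * (Real.exp (s * y) + Real.exp (-s * y))) := by gcongr
        _ = _ := by rw [hsq]; ring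
    have hE : ∀ σ : ℝ, |σ| = s →
        ∫⁻ ω, ENNReal.ofReal (Real.exp (σ * (hits X A ω - m))) ∂P ≤
          ENNReal.ofReal (Real.exp 1) := by
      intro σ hσ
      refine (lintegral_exp_centered_hits_le hX hind hlaw hA σ).trans (ENNReal.ofReal_le_ofReal ?_)
      rw [Real.exp_le_exp]
      have := Real.abs_exp_sub_one_sub_id_le (x := σ) (by rw [hσ]; exact hs1)
      have h5 : σ ^ 2 = s ^ 2 := by rw [← hσ, sq_abs]
      rw [h5] at this
      calc m * (Real.exp σ - 1 - σ) ≤ m * s ^ 2 :=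
            mul_le_mul_of_nonneg_left ((le_abs_self _).trans this) hm0
        _ = 1 := hms
    have hc : 0 ≤ m ^ (q / 2) * q ^ q := by positivity
    have hmE : ∀ σ : ℝ, Measurable fun ω =>
        ENNReal.ofReal (Real.exp (σ * (hits X A ω - m))) := fun σ =>
      ((hmeas.sub_const m).const_mul σ).exp.ennreal_ofReal
    calc ∫⁻ ω, ENNReal.ofReal (|hits X A ω - m| ^ q) ∂P
        ≤ ∫⁻ ω, ENNReal.ofReal (m ^ (q / 2) * q ^ q) *
            (ENNReal.ofReal (Real.exp (s * (hits X A ω - m))) +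
              ENNReal.ofReal (Real.exp (-s * (hits X A ω - m)))) ∂P := by
          refine lintegral_mono fun ω => ?_
          rw [← ENNReal.ofReal_add (Real.exp_pos _).le (Real.exp_pos _).le, ← ENNReal.ofReal_mul hc]
          exact ENNReal.ofReal_le_ofReal (hpt _)
      _ = ENNReal.ofReal (m ^ (q / 2) * q ^ q) *
            (∫⁻ ω, ENNReal.ofReal (Real.exp (s * (hits X A ω - m))) ∂P +
              ∫⁻ ω, ENNReal.ofReal (Real.exp (-s * (hits X A ω - m))) ∂P) := by
          rw [lintegral_const_mul' _ _ ENNReal.ofReal_ne_top, lintegral_add_left (hmE s)]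
      _ ≤ ENNReal.ofReal (m ^ (q / 2) * q ^ q) *
            (ENNReal.ofReal (Real.exp 1) + ENNReal.ofReal (Real.exp 1)) := by
          gcongr
          · exact hE s (abs_of_pos hs0)
          · exact hE (-s) (by rw [abs_neg, abs_of_pos hs0])
      _ ≤ _ := by
          rw [← ENNReal.ofReal_add (Real.exp_pos _).le (Real.exp_pos _).le, ← ENNReal.ofReal_mul hc]
          refine ENNReal.ofReal_le_ofReal ?_
          have h6 : 0 ≤ m ^ (q / 2) := by positivity
          have h7 := Real.exp_pos 1
          have h8 : 0 ≤ m ^ (q / 2) * q ^ q * (Real.exp 2 - Real.exp 1) :=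
            mul_nonneg hc (by linarith)
          have h9 : 0 ≤ m ^ (q / 2) * q ^ q * Real.exp 2 := by positivity
          have h10 : 0 ≤ Real.exp 2 * q ^ q * m := by positivity
          nlinarith
  -- For m ≤ 1 the count is either 0, with deviation m, or at least 1, where exp(count) ≤
  -- 2(exp(count) - 1). Subtracting 1 matters: the mean of exp(count) - 1 is O(m).
  · have hpt : ∀ ω, |hits X A ω - m| ^ q ≤
        2 * q ^ q * (Real.exp (1 * hits X A ω) - 1) + m := by
      intro ω
      have h2 : m ^ q ≤ m := by
        rcases hm0.eq_or_lt with h | h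
        · rw [← h, Real.zero_rpow hq0.ne']
        · calc m ^ q ≤ m ^ (1 : ℝ) := Real.rpow_le_rpow_of_exponent_ge h h1 hq
            _ = m := Real.rpow_one m
      rw [one_mul]
      rcases hits_eq_zero_or_one_le (X := X) A ω with h | h
      · rw [h, zero_sub, abs_neg, abs_of_nonneg hm0]
        simpa using h2
      · have h3 : |hits X A ω - m| ≤ hits X A ω := abs_le.2 ⟨by linarith, by linarith⟩
        have h4 := rpow_le_rpow_self_mul_exp hq0 (hits_nonneg (X := X) A ω)
        have h5 : 2 ≤ Real.exp (hits X A ω) := by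
          linarith [Real.add_one_le_exp (hits X A ω)]
        calc |hits X A ω - m| ^ q ≤ hits X A ω ^ q := by gcongr
          _ ≤ q ^ q * Real.exp (hits X A ω) := h4
          _ ≤ q ^ q * (2 * (Real.exp (hits X A ω) - 1)) := by gcongr; linarith
          _ ≤ _ := by linarith
    have hge : ∀ ω, 0 ≤ Real.exp (1 * hits X A ω) - 1 := fun ω => by
      linarith [Real.add_one_le_exp (1 * hits X A ω), hits_nonneg (X := X) A ω]
    have hmE : Measurable fun ω => ENNReal.ofReal (Real.exp (1 * hits X A ω)) :=
      (hmeas.const_mul 1).exp.ennreal_ofReal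
    have hE : ∫⁻ ω, ENNReal.ofReal (Real.exp (1 * hits X A ω) - 1) ∂P ≤
        ENNReal.ofReal (2 * Real.exp 2 * m) := by
      have e : ∀ ω, ENNReal.ofReal (Real.exp (1 * hits X A ω) - 1) =
          ENNReal.ofReal (Real.exp (1 * hits X A ω)) - 1 := fun ω => by
        rw [ENNReal.ofReal_sub _ zero_le_one, ENNReal.ofReal_one]
      simp_rw [e]
      rw [lintegral_sub measurable_const (by simp)]
      · simp only [lintegral_const, measure_univ, mul_one]
        refine (tsub_le_tsub_right (lintegral_exp_hits_le hX hind hlaw hA 1) 1).trans ?_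
        rw [← ENNReal.ofReal_one, ← ENNReal.ofReal_sub _ zero_le_one]
        refine ENNReal.ofReal_le_ofReal ?_
        rw [← hm]
        have h2 : Real.exp 1 - 1 ≤ 2 := by linarith [Real.exp_one_lt_d9]
        have h3 : m * (Real.exp 1 - 1) ≤ 2 * m := by nlinarith
        have h4 : Real.exp (m * (Real.exp 1 - 1)) ≤ Real.exp (2 * m) := Real.exp_le_exp.2 h3
        have h5 : 1 - Real.exp (-(2 * m)) ≤ 2 * m := by linarith [Real.add_one_le_exp (-(2 * m))]
        have h6 : Real.exp (2 * m) * Real.exp (-(2 * m)) = 1 := by rw [← Real.exp_add]; simp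
        have h7 : Real.exp (2 * m) ≤ Real.exp 2 := Real.exp_le_exp.2 (by linarith)
        have h8 := Real.exp_pos (2 * m)
        calc Real.exp (m * (Real.exp 1 - 1)) - 1 ≤ Real.exp (2 * m) - 1 := by linarith
          _ = Real.exp (2 * m) * (1 - Real.exp (-(2 * m))) := by rw [mul_sub, h6]; ring
          _ ≤ Real.exp 2 * (2 * m) := by
              refine mul_le_mul h7 h5 ?_ (Real.exp_pos _).le
              have : Real.exp (-(2 * m)) ≤ 1 := Real.exp_le_one_iff.2 (by linarith)
              linarith
          _ = _ := by ring
      · refine Filter.Eventually.of_forall fun ω => ?_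
        rw [← ENNReal.ofReal_one]
        exact ENNReal.ofReal_le_ofReal (by linarith [hge ω])
    have hc : 0 ≤ 2 * q ^ q := by positivity
    calc ∫⁻ ω, ENNReal.ofReal (|hits X A ω - m| ^ q) ∂P
        ≤ ∫⁻ ω, (ENNReal.ofReal (2 * q ^ q) * ENNReal.ofReal (Real.exp (1 * hits X A ω) - 1) +
            ENNReal.ofReal m) ∂P := by
          refine lintegral_mono fun ω => ?_
          rw [← ENNReal.ofReal_mul hc, ← ENNReal.ofReal_add (mul_nonneg hc (hge ω)) hm0]
          exact ENNReal.ofReal_le_ofReal (hpt ω)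
      _ = ENNReal.ofReal (2 * q ^ q) * ∫⁻ ω, ENNReal.ofReal (Real.exp (1 * hits X A ω) - 1) ∂P +
            ENNReal.ofReal m := by
          rw [lintegral_add_right _ measurable_const, lintegral_const_mul]
          · simp
          · exact ((hmeas.const_mul 1).exp.sub_const 1).ennreal_ofReal
      _ ≤ ENNReal.ofReal (2 * q ^ q) * ENNReal.ofReal (2 * Real.exp 2 * m) +
            ENNReal.ofReal m := by gcongr
      _ ≤ _ := by
          rw [← ENNReal.ofReal_mul hc, ← ENNReal.ofReal_add (by positivity) hm0]
          refine ENNReal.ofReal_le_ofReal ?_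
          have : 0 ≤ (4 * Real.exp 2 * q ^ q + 1) * m ^ (q / 2) := by positivity
          nlinarith

end Counting

end EmpiricalWasserstein

namespace EmpiricalWasserstein

/-! ### Deviations of sums of counts and of cell deficits -/

section Deviations

variable {E Ω : Type*} {n : ℕ} {X : Fin n → Ω → E} [MeasurableSpace E] [MeasurableSpace Ω]
  {P : Measure Ω} [IsProbabilityMeasure P] {μ : Measure E} [IsProbabilityMeasure μ]

lemma eLpNorm_centered_hits_le {q : ℝ} (hq : 1 ≤ q) (hX : ∀ i, Measurable (X i))
    (hind : iIndepFun X P) (hlaw : ∀ i, P.map (X i) = μ) {A : Set E} (hA : MeasurableSet A) :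
    eLpNorm (fun ω => |hits X A ω - n * μ.real A|) (ENNReal.ofReal q) P ≤
      ENNReal.ofReal ((4 * Real.exp 2 * q ^ q + 1) ^ (1 / q) *
        ((n * μ.real A) ^ (1 / 2 : ℝ) + (n * μ.real A) ^ (1 / q))) := by
  have hq0 : 0 < q := by linarith
  have hm0 : 0 ≤ n * μ.real A := by positivity
  have hC : 0 ≤ 4 * Real.exp 2 * q ^ q + 1 := by positivity
  rw [eLpNorm_eq_lintegral_rpow_enorm_toReal (by simpa using hq0) ENNReal.ofReal_ne_top,
    ENNReal.toReal_ofReal hq0.le]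
  have e : ∀ ω, ‖|hits X A ω - n * μ.real A|‖ₑ ^ q =
      ENNReal.ofReal (|hits X A ω - n * μ.real A| ^ q) := fun ω => by
    rw [Real.enorm_eq_ofReal (abs_nonneg _), ENNReal.ofReal_rpow_of_nonneg (abs_nonneg _) hq0.le]
  simp_rw [e]
  refine (ENNReal.rpow_le_rpow (lintegral_abs_centered_hits_rpow_le hq hX hind hlaw hA)
    (by positivity)).trans ?_
  rw [ENNReal.ofReal_rpow_of_nonneg (by positivity) (by positivity)]
  refine ENNReal.ofReal_le_ofReal ?_
  rw [Real.mul_rpow hC (by positivity)]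
  refine mul_le_mul_of_nonneg_left ?_ (by positivity)
  refine (Real.rpow_add_le_add_rpow (by positivity) hm0 (by positivity)
    ((div_le_one hq0).2 hq)).trans (le_of_eq ?_)
  rw [← Real.rpow_mul hm0]
  congr 2
  field_simp

/-- Minkowski's inequality in L^q adds the norms of the counts whatever their dependence; Markov's
inequality at the power q then gives the tail. -/
lemma measureReal_sum_centered_hits_le {κ : Type*} (K : Finset κ) (A : κ → Set E)
    (hA : ∀ k, MeasurableSet (A k)) (a : κ → ℝ) (ha : ∀ k, 0 ≤ a k) {q x : ℝ} (hq : 1 ≤ q)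
    (hx : 0 < x) (hX : ∀ i, Measurable (X i)) (hind : iIndepFun X P)
    (hlaw : ∀ i, P.map (X i) = μ) :
    P.real {ω | x ≤ ∑ k ∈ K, a k * |hits X (A k) ω - n * μ.real (A k)|} ≤
      (4 * Real.exp 2 * q ^ q + 1) *
        (∑ k ∈ K, a k * ((n * μ.real (A k)) ^ (1 / 2 : ℝ) + (n * μ.real (A k)) ^ (1 / q))) ^ q /
          x ^ q := by
  have hq0 : 0 < q := by linarith
  have hC : 0 ≤ 4 * Real.exp 2 * q ^ q + 1 := by positivity
  set f : κ → Ω → ℝ := fun k ω => a k * |hits X (A k) ω - n * μ.real (A k)| with hf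
  have hfm : ∀ k, Measurable (f k) := fun k => by
    have := measurable_hits (X := X) hX (hA k)
    fun_prop
  set s : κ → ℝ := fun k =>
    a k * ((n * μ.real (A k)) ^ (1 / 2 : ℝ) + (n * μ.real (A k)) ^ (1 / q)) with hs
  have hs0 : ∀ k, 0 ≤ s k := fun k => mul_nonneg (ha k) (by positivity)
  have h1 : eLpNorm (∑ k ∈ K, f k) (ENNReal.ofReal q) P ≤
      ENNReal.ofReal ((4 * Real.exp 2 * q ^ q + 1) ^ (1 / q) * ∑ k ∈ K, s k) := by
    refine (eLpNorm_sum_le (fun k _ => (hfm k).aestronglyMeasurable)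
      (by rw [← ENNReal.ofReal_one]; exact ENNReal.ofReal_le_ofReal hq)).trans ?_
    rw [Finset.mul_sum, ENNReal.ofReal_sum_of_nonneg fun k _ => mul_nonneg (by positivity) (hs0 k)]
    refine Finset.sum_le_sum fun k _ => ?_
    have : f k = a k • fun ω => |hits X (A k) ω - n * μ.real (A k)| := by
      ext ω; simp [hf]
    rw [this, eLpNorm_const_smul, Real.enorm_eq_ofReal (ha k)]
    refine (mul_le_mul_right (eLpNorm_centered_hits_le hq hX hind hlaw (hA k)) _).trans
      (le_of_eq ?_)
    rw [← ENNReal.ofReal_mul (ha k)]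
    congr 1
    simp only [hs]
    ring
  have hsm : Measurable (∑ k ∈ K, f k) := by
    convert Finset.measurable_sum K fun k _ => hfm k using 1
    ext; simp
  have h2 := mul_meas_ge_le_pow_eLpNorm' P (p := ENNReal.ofReal q) (by simpa using hq0)
    ENNReal.ofReal_ne_top hsm.aestronglyMeasurable
    (ENNReal.ofReal x)
  rw [ENNReal.toReal_ofReal hq0.le] at h2
  have h3 : {ω | x ≤ ∑ k ∈ K, f k ω} = {ω | ENNReal.ofReal x ≤ ‖(∑ k ∈ K, f k) ω‖ₑ} := by
    ext ω
    have : 0 ≤ (∑ k ∈ K, f k) ω := by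
      rw [Finset.sum_apply]
      exact Finset.sum_nonneg fun k _ => mul_nonneg (ha k) (abs_nonneg _)
    rw [mem_ofPred_eq, mem_ofPred_eq, Real.enorm_eq_ofReal this, ENNReal.ofReal_le_ofReal_iff this,
      Finset.sum_apply]
  have h4 : ENNReal.ofReal (x ^ q) * P {ω | x ≤ ∑ k ∈ K, f k ω} ≤
      ENNReal.ofReal ((4 * Real.exp 2 * q ^ q + 1) * (∑ k ∈ K, s k) ^ q) := by
    rw [h3, ← ENNReal.ofReal_rpow_of_nonneg hx.le hq0.le]
    refine h2.trans ((ENNReal.rpow_le_rpow h1 hq0.le).trans (le_of_eq ?_))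
    rw [ENNReal.ofReal_rpow_of_nonneg (mul_nonneg (by positivity)
      (Finset.sum_nonneg fun k _ => hs0 k)) hq0.le, Real.mul_rpow (by positivity)
      (Finset.sum_nonneg fun k _ => hs0 k), ← Real.rpow_mul hC, one_div_mul_cancel hq0.ne',
      Real.rpow_one]
  rw [le_div_iff₀ (by positivity), mul_comm]
  have h5 := ENNReal.toReal_mono ENNReal.ofReal_ne_top h4
  rwa [ENNReal.toReal_mul, ENNReal.toReal_ofReal (by positivity), ENNReal.toReal_ofReal
    (mul_nonneg hC (Real.rpow_nonneg (Finset.sum_nonneg fun k _ => hs0 k) _))] at h5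

/-- Total deficit of the sample over the cells `A t`, `t ∈ T`. -/
noncomputable def deficit {ι : Type*} (μ : Measure E) (X : Fin n → Ω → E) (T : Finset ι)
    (A : ι → Set E) (ω : Ω) : ℝ :=
  ∑ t ∈ T, max (n * μ.real (A t) - hits X (A t) ω) 0

lemma measurable_deficit {ι : Type*} (T : Finset ι) {A : ι → Set E}
    (hA : ∀ t, MeasurableSet (A t)) (hX : ∀ i, Measurable (X i)) :
    Measurable (deficit μ X T A) :=
  Finset.measurable_sum _ fun t _ =>
    ((measurable_hits hX (hA t)).const_sub _).max measurable_const

lemma deficit_nonneg {ι : Type*} (T : Finset ι) (A : ι → Set E) (ω : Ω) :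
    0 ≤ deficit μ X T A ω :=
  Finset.sum_nonneg fun _ _ => le_max_right _ _

lemma deficit_le {ι : Type*} (T : Finset ι) {A : ι → Set E} (hA : ∀ t, MeasurableSet (A t))
    (hd : Pairwise (Function.onFun Disjoint A)) {U : Set E} (hU : ∀ t, A t ⊆ U) (ω : Ω) :
    deficit μ X T A ω ≤ n * μ.real U := by
  calc deficit μ X T A ω ≤ ∑ t ∈ T, n * μ.real (A t) :=
        Finset.sum_le_sum fun t _ => max_le (by linarith [hits_nonneg (X := X) (A t) ω])
          (by positivity)
    _ = n * μ.real (⋃ t ∈ T, A t) := by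
        rw [← Finset.mul_sum, measureReal_biUnion_finset (fun i _ j _ h => hd h) fun t _ => hA t]
    _ ≤ n * μ.real U := by
        gcongr
        · exact measure_ne_top _ _
        · exact iUnion₂_subset fun t _ => hU t

/-- On the negative side the Poisson exponent is Gaussian for every s, with no restriction on its
size. This is the reason for following deficits instead of excesses. -/
lemma exp_neg_sub_one_add_le {s : ℝ} (hs : 0 ≤ s) : Real.exp (-s) - 1 + s ≤ s ^ 2 / 2 := by
  have h : MonotoneOn (fun t : ℝ => t ^ 2 / 2 + 1 - t - Real.exp (-t)) (Ici 0) := by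
    refine monotoneOn_of_deriv_nonneg (convex_Ici 0) (by fun_prop) (by fun_prop) fun t _ => ?_
    have : HasDerivAt (fun t : ℝ => t ^ 2 / 2 + 1 - t - Real.exp (-t))
        (2 * t / 2 - 1 - Real.exp (-t) * (-1)) t := by
      have h1 := ((hasDerivAt_pow 2 t).div_const 2).add_const 1
      have h2 := (hasDerivAt_neg t).exp
      exact ((h1.sub (hasDerivAt_id t)).sub h2).congr_deriv (by simp)
    rw [this.deriv]
    linarith [Real.add_one_le_exp (-t)]
  have := h self_mem_Ici hs hs
  simp at this
  linarith

/-- Bounding exp(s·max(a,0)) by 1 + exp(sa) and expanding the product gives a sum over subfamilies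
of cells. For each one the deficits add up to that of a single set, so its binomial estimate
applies; there are 2^(number of cells) of them. -/
lemma lintegral_exp_deficit_le {ι : Type*} (T : Finset ι) {A : ι → Set E}
    (hA : ∀ t, MeasurableSet (A t)) (hd : Pairwise (Function.onFun Disjoint A)) {U : Set E}
    (hU : ∀ t, A t ⊆ U) (hX : ∀ i, Measurable (X i)) (hind : iIndepFun X P)
    (hlaw : ∀ i, P.map (X i) = μ) {s : ℝ} (hs : 0 ≤ s) :
    ∫⁻ ω, ENNReal.ofReal (Real.exp (s * deficit μ X T A ω)) ∂P ≤
      ENNReal.ofReal (2 ^ T.card * Real.exp (n * μ.real U * (s ^ 2 / 2))) := by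
  classical
  have hpt : ∀ ω, Real.exp (s * deficit μ X T A ω) ≤ ∑ B ∈ T.powerset,
      Real.exp (-s * (hits X (⋃ t ∈ B, A t) ω - n * μ.real (⋃ t ∈ B, A t))) := by
    intro ω
    have h1 : ∀ t, Real.exp (s * max (n * μ.real (A t) - hits X (A t) ω) 0) ≤
        1 + Real.exp (s * (n * μ.real (A t) - hits X (A t) ω)) := by
      intro t
      rcases max_cases (n * μ.real (A t) - hits X (A t) ω) 0 with h | h <;> rw [h.1]
      · linarith
      · simp [(Real.exp_pos _).le]
    calc Real.exp (s * deficit μ X T A ω)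
        = ∏ t ∈ T, Real.exp (s * max (n * μ.real (A t) - hits X (A t) ω) 0) := by
          rw [deficit, Finset.mul_sum, Real.exp_sum]
      _ ≤ ∏ t ∈ T, (1 + Real.exp (s * (n * μ.real (A t) - hits X (A t) ω))) :=
          Finset.prod_le_prod (fun _ _ => (Real.exp_pos _).le) fun t _ => h1 t
      _ = _ := by
          rw [Finset.prod_one_add]
          refine Finset.sum_congr rfl fun B _ => ?_
          rw [← Real.exp_sum, ← sum_hits_eq B A hd ω,
            measureReal_biUnion_finset (fun i _ j _ h => hd h) fun t _ => hA t, ← Finset.mul_sum,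
            Finset.sum_sub_distrib, Finset.mul_sum]
          ring_nf
  have hmeasB : ∀ B : Finset ι, MeasurableSet (⋃ t ∈ B, A t) := fun B =>
    Finset.measurableSet_biUnion B fun t _ => hA t
  calc ∫⁻ ω, ENNReal.ofReal (Real.exp (s * deficit μ X T A ω)) ∂P
      ≤ ∫⁻ ω, ∑ B ∈ T.powerset, ENNReal.ofReal (Real.exp
          (-s * (hits X (⋃ t ∈ B, A t) ω - n * μ.real (⋃ t ∈ B, A t)))) ∂P := by
        refine lintegral_mono fun ω => ?_
        rw [← ENNReal.ofReal_sum_of_nonneg fun _ _ => (Real.exp_pos _).le]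
        exact ENNReal.ofReal_le_ofReal (hpt ω)
    _ = ∑ B ∈ T.powerset, ∫⁻ ω, ENNReal.ofReal (Real.exp
          (-s * (hits X (⋃ t ∈ B, A t) ω - n * μ.real (⋃ t ∈ B, A t)))) ∂P := by
        refine lintegral_finsetSum _ fun B _ => ?_
        exact (((measurable_hits hX (hmeasB B)).sub_const _).const_mul _).exp.ennreal_ofReal
    _ ≤ ∑ B ∈ T.powerset, ENNReal.ofReal (Real.exp (n * μ.real U * (s ^ 2 / 2))) := by
        refine Finset.sum_le_sum fun B _ => ?_
        refine (lintegral_exp_centered_hits_le hX hind hlaw (hmeasB B) (-s)).trans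
          (ENNReal.ofReal_le_ofReal (Real.exp_le_exp.2 ?_))
        have h1 := exp_neg_sub_one_add_le hs
        have h2 : μ.real (⋃ t ∈ B, A t) ≤ μ.real U :=
          measureReal_mono (iUnion₂_subset fun t _ => hU t)
        rw [sub_neg_eq_add]
        calc n * μ.real (⋃ t ∈ B, A t) * (Real.exp (-s) - 1 + s)
            ≤ n * μ.real (⋃ t ∈ B, A t) * (s ^ 2 / 2) := by gcongr
          _ ≤ _ := by gcongr
    _ = _ := by
        rw [Finset.sum_const, Finset.card_powerset, nsmul_eq_mul, ENNReal.ofReal_mul (by positivity)]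
        congr 1
        rw [ENNReal.ofReal_pow (by norm_num)]
        simp

/-- A Hölder type inequality for exponential moments of subconvex combinations. -/
lemma lintegral_exp_sum_le {κ : Type*} (J : Finset κ) (w ψ : κ → ℝ) (u : κ → Ω → ℝ)
    (hw : ∀ j ∈ J, 0 ≤ w j) (hw1 : ∑ j ∈ J, w j ≤ 1) (hu : ∀ j ∈ J, Measurable (u j))
    (hψ : ∀ j ∈ J, ∫⁻ ω, ENNReal.ofReal (Real.exp (u j ω)) ∂P ≤
      ENNReal.ofReal (Real.exp (ψ j))) :
    ∫⁻ ω, ENNReal.ofReal (Real.exp (∑ j ∈ J, w j * u j ω)) ∂P ≤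
      ENNReal.ofReal (Real.exp (∑ j ∈ J, w j * ψ j)) := by
  classical
  set W := ∑ j ∈ J, w j with hW
  have hconv : ∀ v : κ → ℝ, Real.exp (∑ j ∈ J, w j * v j) ≤
      (1 - W) + ∑ j ∈ J, w j * Real.exp (v j) := by
    intro v
    -- The missing weight 1 - W is put on an additional point with value 0, so that Jensen's
    -- inequality also covers weights of sum less than 1.
    have := convexOn_exp.map_sum_le (t := Finset.insertNone J)
      (w := fun o => o.elim (1 - W) w) (p := fun o => o.elim 0 v) ?_ ?_ (fun _ _ => mem_univ _)
    · simpa [Finset.sum_insertNone] using this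
    · intro o ho
      cases o with
      | none => simpa using hw1
      | some j => exact hw j (by simpa using ho)
    · simp [Finset.sum_insertNone, ← hW]
  have hpt : ∀ ω, ENNReal.ofReal (Real.exp (∑ j ∈ J, w j * u j ω)) ≤
      ENNReal.ofReal (Real.exp (∑ j ∈ J, w j * ψ j)) * (ENNReal.ofReal (1 - W) +
        ∑ j ∈ J, ENNReal.ofReal (w j * Real.exp (-ψ j)) * ENNReal.ofReal (Real.exp (u j ω))) := by
    intro ω
    have e : ∀ j ∈ J, ENNReal.ofReal (w j * Real.exp (-ψ j)) * ENNReal.ofReal (Real.exp (u j ω)) =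
        ENNReal.ofReal (w j * Real.exp (u j ω - ψ j)) := fun j hj => by
      rw [← ENNReal.ofReal_mul (mul_nonneg (hw j hj) (Real.exp_pos _).le), mul_assoc,
        ← Real.exp_add, add_comm (-ψ j), sub_eq_add_neg]
    have hn : ∀ j ∈ J, 0 ≤ w j * Real.exp (u j ω - ψ j) := fun j hj =>
      mul_nonneg (hw j hj) (Real.exp_pos _).le
    rw [Finset.sum_congr rfl e, ← ENNReal.ofReal_sum_of_nonneg hn,
      ← ENNReal.ofReal_add (by linarith) (Finset.sum_nonneg hn),
      ← ENNReal.ofReal_mul (Real.exp_pos _).le]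
    refine ENNReal.ofReal_le_ofReal ?_
    have h1 := hconv fun j => u j ω - ψ j
    have h2 : ∑ j ∈ J, w j * u j ω = ∑ j ∈ J, w j * ψ j + ∑ j ∈ J, w j * (u j ω - ψ j) := by
      rw [← Finset.sum_add_distrib]; exact Finset.sum_congr rfl fun j _ => by ring
    rw [h2, Real.exp_add]
    gcongr
  have hm : ∀ j ∈ J, Measurable fun ω =>
      ENNReal.ofReal (w j * Real.exp (-ψ j)) * ENNReal.ofReal (Real.exp (u j ω)) :=
    fun j hj => ((hu j hj).exp.ennreal_ofReal).const_mul _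
  refine (lintegral_mono hpt).trans ?_
  rw [lintegral_const_mul' _ _ ENNReal.ofReal_ne_top, lintegral_add_left measurable_const,
    lintegral_finsetSum J hm]
  conv_rhs => rw [← mul_one (ENNReal.ofReal (Real.exp (∑ j ∈ J, w j * ψ j)))]
  gcongr
  have h3 : ∀ j ∈ J, ∫⁻ ω, ENNReal.ofReal (w j * Real.exp (-ψ j)) *
      ENNReal.ofReal (Real.exp (u j ω)) ∂P ≤ ENNReal.ofReal (w j) := by
    intro j hj
    rw [lintegral_const_mul' _ _ ENNReal.ofReal_ne_top]
    refine (mul_le_mul_right (hψ j hj) _).trans (le_of_eq ?_)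
    rw [← ENNReal.ofReal_mul (mul_nonneg (hw j hj) (Real.exp_pos _).le), mul_assoc, ← Real.exp_add]
    simp
  refine (add_le_add_right (Finset.sum_le_sum h3) _).trans ?_
  rw [← ENNReal.ofReal_sum_of_nonneg hw, lintegral_const, measure_univ, mul_one,
    ← ENNReal.ofReal_add (by linarith) (Finset.sum_nonneg hw), ← hW]
  simp

end Deviations

end EmpiricalWasserstein

namespace EmpiricalWasserstein

/-! ### Exponential moments of the inner transport cost -/

section Chaining

lemma sum_range_pow_succ_le_one {ρ : ℝ} (h0 : 0 ≤ ρ) (h1 : ρ ≤ 1 / 2) (M : ℕ) :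
    ∑ l ∈ Finset.range M, ρ ^ (l + 1) ≤ 1 := by
  have h : ∀ M : ℕ, ∑ l ∈ Finset.range M, ρ ^ (l + 1) ≤ 1 - (1 / 2) ^ M := by
    intro M
    induction M with
    | zero => simp
    | succ M ih =>
      rw [Finset.sum_range_succ]
      have : ρ ^ (M + 1) ≤ (1 / 2) ^ (M + 1) := by gcongr
      have e : (1 / 2 : ℝ) ^ (M + 1) = (1 / 2) ^ M / 2 := by rw [pow_succ]; ring
      linarith
  have := h M
  have h2 : (0 : ℝ) ≤ (1 / 2) ^ M := by positivity
  linarith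

/-- A growing geometric sum is comparable with its last term. With θ = 2^(α/2-p) this says that the
finest level carries the entropy cost. -/
lemma sum_range_pow_succ_le {θ : ℝ} (h : 1 < θ) (M : ℕ) :
    ∑ l ∈ Finset.range M, θ ^ (l + 1) ≤ θ / (θ - 1) * θ ^ M := by
  have h1 : 0 < θ - 1 := by linarith
  simp_rw [pow_succ]
  rw [← Finset.sum_mul, geom_sum_eq h.ne', div_mul_eq_mul_div, div_mul_eq_mul_div]
  exact div_le_div_of_nonneg_right (by nlinarith) h1.le

/-- Choice, for one level of one shell, of the convexity weight `w` and of the Laplace parameter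
`L`. The product `w * L` is prescribed by the coefficient of the deficit, and `w` must stay below
the share v·2^(-pl), which is summable over shells and levels. The minimum offers two exponents:
entropy plus Gaussian term, or the deterministic bound of the deficit by n h. -/
lemma chaining_term_le {n h c b lam p α B : ℝ} (hp : 1 ≤ p) (hα : 2 * p < α) (hB : 0 ≤ B)
    (hn : 0 < n) (hh : 0 < h) (hc : 0 < c) (hb : 0 < b) (hl : 0 < lam) (l : ℕ) :
    ∃ L w : ℝ, 0 ≤ L ∧ 0 ≤ w ∧ w ≤ c * h ^ ((α - p) / α) / b * ((2 : ℝ) ^ (-p)) ^ l ∧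
      w * L = lam * c * ((2 : ℝ) ^ (-p)) ^ l / n ∧
      w * min (B * ((2 : ℝ) ^ α) ^ l + n * h * (L ^ 2 / 2)) (L * (n * h)) ≤
        c * h ^ ((α - p) / α) / b *
          ((B + 1) * (lam * b * n ^ ((α - p) / α - 1)) *
            (((2 : ℝ) ^ (α / 2 - p)) ^ l * (n * h) ^ (1 / 2 - (α - p) / α)) +
            ((2 : ℝ) ^ (-p)) ^ l * (lam * b * n ^ ((α - p) / α - 1)) ^ (α / (α - p))) := by
  have hα0 : 0 < α := by linarith
  have hαp : 0 < α - p := by linarith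
  set η := (α - p) / α with hη
  have hη0 : 0 < η := by positivity
  have hη1 : η ≤ 1 := by rw [hη, div_le_one hα0]; linarith
  have hη2 : 1 ≤ α / (α - p) ∧ α / (α - p) ≤ 2 := by
    constructor
    · rw [le_div_iff₀ hαp]; linarith
    · rw [div_le_iff₀ hαp]; linarith
  have hηs : η * (α / (α - p)) = 1 := by rw [hη]; field_simp
  set s := α / (α - p) with hs
  set m := n * h with hm
  have hm0 : 0 < m := by positivity
  set ρ := (2 : ℝ) ^ (-p) with hρ
  set σ := (2 : ℝ) ^ α with hσ
  have hρ0 : 0 < ρ := by positivity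
  have hσ0 : 0 < σ := by positivity
  -- The smallest admissible `L`: it corresponds to giving `w` its full share.
  set τ := lam * b / (n * h ^ η) with hτ
  have hτ0 : 0 < τ := by positivity
  set v := c * h ^ η / b with hv
  have hv0 : 0 < v := by positivity
  set y := lam * b * n ^ (η - 1) with hy
  have hy0 : 0 < y := by positivity
  have I1 : lam * c = n * τ * v := by
    rw [hτ, hv]; field_simp
  have I2 : m * τ ^ s = y ^ s := by
    have e1 : τ = lam * b * n ^ (-1 : ℝ) * h ^ (-η) := by
      rw [hτ, Real.rpow_neg_one, Real.rpow_neg hh.le, div_eq_mul_inv, mul_inv]; ring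
    have hlb : 0 ≤ lam * b := by positivity
    rw [e1, hy, Real.mul_rpow (by positivity) (by positivity), Real.mul_rpow hlb (by positivity),
      Real.mul_rpow hlb (by positivity), ← Real.rpow_mul hn.le, ← Real.rpow_mul hh.le,
      ← Real.rpow_mul hn.le, show -η * s = -1 by linarith, show (η - 1) * s = 1 - s by linarith,
      show -1 * s = -s by ring, Real.rpow_neg_one, Real.rpow_sub hn, Real.rpow_neg hn.le,
      Real.rpow_one, hm]
    field_simp
  have I3 : lam * c / n * m ^ η = v * y := by
    rw [hm, Real.mul_rpow hn.le hh.le, hv, hy, Real.rpow_sub hn, Real.rpow_one]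
    field_simp
  have hz0 : 0 < Real.sqrt (σ ^ l / m) := Real.sqrt_pos.2 (by positivity)
  -- The value √(σ^l/m) balances the entropy σ^l against m L². For τ ≤ 1 take the larger of it and
  -- τ, with the Gaussian exponent, and use τ² ≤ τ^s as s ≤ 2. For τ > 1 the deterministic exponent
  -- τ m suffices, since τ ≤ τ^s as s ≥ 1. In both cases m τ^s = y^s no longer depends on the shell.
  by_cases hτ1 : τ ≤ 1
  · set L := max (Real.sqrt (σ ^ l / m)) τ with hL
    have hL0 : 0 < L := lt_max_of_lt_right hτ0
    have hw0 : 0 ≤ lam * c * ρ ^ l / (n * L) := by positivity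
    refine ⟨L, lam * c * ρ ^ l / (n * L), hL0.le, hw0, ?_, by field_simp, ?_⟩
    · rw [I1, div_le_iff₀ (by positivity)]
      have : τ ≤ L := le_max_right _ _
      calc n * τ * v * ρ ^ l ≤ n * L * v * ρ ^ l := by gcongr
        _ = _ := by ring
    · refine (mul_le_mul_of_nonneg_left (min_le_left _ _) hw0).trans ?_
      have hsq : Real.sqrt (σ ^ l / m) * Real.sqrt (σ ^ l * m) = σ ^ l := by
        rw [← Real.sqrt_mul (by positivity)]
        rw [show σ ^ l / m * (σ ^ l * m) = (σ ^ l) ^ 2 by field_simp]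
        exact Real.sqrt_sq (by positivity)
      have hsq2 : m * Real.sqrt (σ ^ l / m) = Real.sqrt (σ ^ l * m) := by
        nth_rewrite 1 [← Real.sqrt_sq hm0.le]
        rw [← Real.sqrt_mul (by positivity)]
        congr 1
        field_simp
      have h1 : σ ^ l / L ≤ Real.sqrt (σ ^ l * m) := by
        rw [div_le_iff₀ hL0]
        calc σ ^ l = Real.sqrt (σ ^ l / m) * Real.sqrt (σ ^ l * m) := hsq.symm
          _ ≤ L * Real.sqrt (σ ^ l * m) := by gcongr; exact le_max_left _ _
          _ = _ := mul_comm _ _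
      have h2 : m * L ≤ Real.sqrt (σ ^ l * m) + m * τ := by
        rw [← hsq2, ← mul_add]
        gcongr
        exact max_le (by linarith) (by linarith)
      have h3 : m * τ ^ 2 ≤ y ^ s := by
        rw [← I2]
        gcongr
        rw [← Real.rpow_natCast]
        exact Real.rpow_le_rpow_of_exponent_ge hτ0 hτ1 (by simpa using hη2.2)
      have h4 : lam * c / n * (ρ ^ l * Real.sqrt (σ ^ l * m)) =
          v * (y * (((2 : ℝ) ^ (α / 2 - p)) ^ l * m ^ (1 / 2 - η))) := by
        have e1 : Real.sqrt (σ ^ l * m) = ((2 : ℝ) ^ (α / 2)) ^ l * m ^ (1 / 2 : ℝ) := by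
          rw [Real.sqrt_eq_rpow, Real.mul_rpow (by positivity) hm0.le, hσ, ← Real.rpow_natCast,
            ← Real.rpow_natCast, ← Real.rpow_mul (by positivity), ← Real.rpow_mul (by positivity),
            ← Real.rpow_mul (by positivity)]
          congr 2
          ring
        have e2 : ρ ^ l * ((2 : ℝ) ^ (α / 2)) ^ l = ((2 : ℝ) ^ (α / 2 - p)) ^ l := by
          rw [← mul_pow, hρ, ← Real.rpow_add two_pos]
          congr 2
          ring
        have e3 : m ^ (1 / 2 : ℝ) = m ^ η * m ^ (1 / 2 - η) := by
          rw [← Real.rpow_add hm0]; congr 1; ring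
        calc lam * c / n * (ρ ^ l * Real.sqrt (σ ^ l * m))
            = (lam * c / n * m ^ η) * (ρ ^ l * ((2 : ℝ) ^ (α / 2)) ^ l * m ^ (1 / 2 - η)) := by
              rw [e1, e3]; ring
          _ = _ := by rw [I3, e2]; ring
      have hbr : (B * σ ^ l + m * (L ^ 2 / 2)) / L ≤
          (B + 1) * Real.sqrt (σ ^ l * m) + m * τ := by
        have e : (B * σ ^ l + m * (L ^ 2 / 2)) / L = B * (σ ^ l / L) + m * L / 2 := by
          field_simp
        rw [e]
        have h5 : B * (σ ^ l / L) ≤ B * Real.sqrt (σ ^ l * m) := by gcongr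
        have h6 : 0 ≤ m * L := by positivity
        linarith
      calc lam * c * ρ ^ l / (n * L) * (B * σ ^ l + m * (L ^ 2 / 2))
          = lam * c / n * ρ ^ l * ((B * σ ^ l + m * (L ^ 2 / 2)) / L) := by field_simp
        _ ≤ lam * c / n * ρ ^ l * ((B + 1) * Real.sqrt (σ ^ l * m) + m * τ) := by gcongr
        _ = (B + 1) * (lam * c / n * (ρ ^ l * Real.sqrt (σ ^ l * m))) +
              v * ρ ^ l * (m * τ ^ 2) := by rw [I1]; field_simp
        _ ≤ (B + 1) * (v * (y * (((2 : ℝ) ^ (α / 2 - p)) ^ l * m ^ (1 / 2 - η)))) +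
              v * ρ ^ l * y ^ s := by rw [h4]; gcongr
        _ = _ := by ring
  · push Not at hτ1
    refine ⟨τ, v * ρ ^ l, hτ0.le, by positivity, le_rfl, by rw [I1]; field_simp, ?_⟩
    refine (mul_le_mul_of_nonneg_left (min_le_right _ _) (by positivity)).trans ?_
    have h3 : τ * m ≤ y ^ s := by
      rw [← I2, mul_comm]
      gcongr
      calc τ = τ ^ (1 : ℝ) := (Real.rpow_one τ).symm
        _ ≤ τ ^ s := Real.rpow_le_rpow_of_exponent_le hτ1.le hη2.1
    calc v * ρ ^ l * (τ * m) ≤ v * ρ ^ l * y ^ s := by gcongr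
      _ = v * (ρ ^ l * y ^ s) := by ring
      _ ≤ _ := by
          gcongr
          have : 0 ≤ (B + 1) * y * (((2 : ℝ) ^ (α / 2 - p)) ^ l * m ^ (1 / 2 - η)) := by positivity
          linarith

variable {Ω κ : Type*} [MeasurableSpace Ω] {P : Measure Ω} [IsProbabilityMeasure P]

/-- The transport cost inside the shells, read off from the cell deficits `Y k l`. -/
noncomputable def innerCost (K : Finset κ) (c h : κ → ℝ) (M : κ → ℕ) (Y : κ → ℕ → Ω → ℝ)
    (n p : ℝ) (ω : Ω) : ℝ :=
  ∑ k ∈ K, c k * (((2 : ℝ) ^ (-p)) ^ M k * h k +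
    ∑ l ∈ Finset.range (M k), ((2 : ℝ) ^ (-p)) ^ (l + 1) * (Y k (l + 1) ω / n))

lemma two_rpow_neg_le_half {p : ℝ} (hp : 1 ≤ p) : (2 : ℝ) ^ (-p) ≤ 1 / 2 :=
  calc (2 : ℝ) ^ (-p) ≤ 2 ^ (-1 : ℝ) := Real.rpow_le_rpow_of_exponent_le one_le_two (by linarith)
    _ = 1 / 2 := by rw [Real.rpow_neg_one]; norm_num

/-- A deficit never exceeds n times the shell mass, so the inner cost has a deterministic bound;
beyond it the exponential term can be dropped. -/
lemma innerCost_le (K : Finset κ) {c h : κ → ℝ} (M : κ → ℕ) {Y : κ → ℕ → Ω → ℝ} {n p : ℝ}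
    (hp : 1 ≤ p) (hn : 0 < n) (hc : ∀ k, 0 < c k) (hh : ∀ k, 0 ≤ h k)
    (hY : ∀ k l ω, Y k l ω ≤ n * h k) (ω : Ω) :
    innerCost K c h M Y n p ω ≤ 2 * ∑ k ∈ K, c k * h k := by
  have hρ0 : 0 < (2 : ℝ) ^ (-p) := by positivity
  have hρ := two_rpow_neg_le_half hp
  rw [innerCost, Finset.mul_sum]
  refine Finset.sum_le_sum fun k _ => ?_
  have h1 : ((2 : ℝ) ^ (-p)) ^ M k * h k ≤ h k :=
    mul_le_of_le_one_left (hh k) (pow_le_one₀ hρ0.le (by linarith))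
  have h2 : ∑ l ∈ Finset.range (M k), ((2 : ℝ) ^ (-p)) ^ (l + 1) * (Y k (l + 1) ω / n) ≤ h k := by
    calc _ ≤ ∑ l ∈ Finset.range (M k), ((2 : ℝ) ^ (-p)) ^ (l + 1) * h k := by
          refine Finset.sum_le_sum fun l _ => ?_
          gcongr
          rw [div_le_iff₀ hn, mul_comm]
          exact hY _ _ _
      _ = (∑ l ∈ Finset.range (M k), ((2 : ℝ) ^ (-p)) ^ (l + 1)) * h k := by rw [Finset.sum_mul]
      _ ≤ 1 * h k := by
          gcongr
          · exact hh k
          · exact sum_range_pow_succ_le_one hρ0.le hρ _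
      _ = h k := one_mul _
  have := mul_le_mul_of_nonneg_left (add_le_add h1 h2) (hc k).le
  linarith

lemma measurable_innerCost (K : Finset κ) (c h : κ → ℝ) (M : κ → ℕ) {Y : κ → ℕ → Ω → ℝ} (n p : ℝ)
    (hYm : ∀ k l, Measurable (Y k l)) : Measurable (innerCost K c h M Y n p) := by
  unfold innerCost
  fun_prop

lemma lintegral_exp_innerCost_le (K : Finset κ) {c h : κ → ℝ} {M : κ → ℕ} {Y : κ → ℕ → Ω → ℝ}
    {n p α B b lam : ℝ} (hp : 1 ≤ p) (hα : 2 * p < α) (hB : 0 ≤ B) (hn : 0 < n)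
    (hc : ∀ k, 0 < c k) (hh : ∀ k, 0 ≤ h k)
    (hM : ∀ k, 1 ≤ M k → ((2 : ℝ) ^ α) ^ M k ≤ n * h k)
    (hM' : ∀ k, n * h k < ((2 : ℝ) ^ α) ^ (M k + 1))
    (hYm : ∀ k l, Measurable (Y k l)) (hY : ∀ k l ω, Y k l ω ≤ n * h k)
    (hYexp : ∀ k l, 1 ≤ l → l ≤ M k → ∀ s, 0 ≤ s →
      ∫⁻ ω, ENNReal.ofReal (Real.exp (s * Y k l ω)) ∂P ≤
        ENNReal.ofReal (Real.exp (B * ((2 : ℝ) ^ α) ^ l + n * h k * (s ^ 2 / 2))))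
    (hb : ∑ k ∈ K, c k * h k ^ ((α - p) / α) ≤ b) (hb0 : 0 < b) (hl : 0 < lam) :
    ∫⁻ ω, ENNReal.ofReal (Real.exp (lam * innerCost K c h M Y n p ω)) ∂P ≤
      ENNReal.ofReal (Real.exp
        ((2 ^ p + (B + 1) * ((2 : ℝ) ^ (α / 2 - p) / (2 ^ (α / 2 - p) - 1)) + 1) *
          (lam * b * n ^ ((α - p) / α - 1) +
            (lam * b * n ^ ((α - p) / α - 1)) ^ (α / (α - p))))) := by
  classical
  have hα0 : 0 < α := by linarith
  have hαp : 0 < α - p := by linarith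
  set η := (α - p) / α with hη
  have hη0 : 0 < η := by positivity
  set ρ := (2 : ℝ) ^ (-p) with hρdef
  have hρ0 : 0 < ρ := by positivity
  have hρ : ρ ≤ 1 / 2 := two_rpow_neg_le_half hp
  set y := lam * b * n ^ (η - 1) with hy
  have hy0 : 0 < y := by positivity
  set θ := (2 : ℝ) ^ (α / 2 - p) with hθ
  have hθ1 : 1 < θ := Real.one_lt_rpow one_lt_two (by linarith)
  have hσ1 : 1 < (2 : ℝ) ^ α := Real.one_lt_rpow one_lt_two hα0
  -- the coarse deterministic part
  have hdet : lam * ∑ k ∈ K, c k * (ρ ^ M k * h k) ≤ 2 ^ p * y := by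
    have hterm : ∀ k ∈ K, c k * (ρ ^ M k * h k) ≤ 2 ^ p * n ^ (η - 1) * (c k * h k ^ η) := by
      intro k _
      rcases (hh k).eq_or_lt with h0 | h0
      · rw [← h0, Real.zero_rpow hη0.ne']; simp
      · have hm0 : 0 < n * h k := by positivity
        -- Here ρ = σ^(η-1) and η - 1 ≤ 0, so the upper bound on n h from maximality of the depth
        -- controls the residual scale. Going from M+1 back to M costs the factor 2^p.
        have h1 : ρ ^ (M k + 1) ≤ (n * h k) ^ (η - 1) := by
          have e1 : ρ ^ (M k + 1) = (((2 : ℝ) ^ α) ^ (M k + 1)) ^ (η - 1) := by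
            rw [hρdef, ← Real.rpow_natCast, ← Real.rpow_natCast, ← Real.rpow_mul two_pos.le,
              ← Real.rpow_mul two_pos.le, ← Real.rpow_mul two_pos.le]
            congr 1
            rw [hη]; field_simp; ring
          rw [e1]
          refine Real.rpow_le_rpow_of_nonpos hm0 (hM' k).le ?_
          rw [hη, sub_nonpos, div_le_one hα0]; linarith
        have h2 : ρ ^ M k = 2 ^ p * ρ ^ (M k + 1) := by
          rw [pow_succ, hρdef, Real.rpow_neg two_pos.le]; field_simp
        have h3 : (n * h k) ^ (η - 1) * h k = n ^ (η - 1) * h k ^ η := by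
          rw [Real.mul_rpow hn.le h0.le, mul_assoc]
          congr 1
          rw [Real.rpow_sub_one h0.ne', div_mul_cancel₀ _ h0.ne']
        calc c k * (ρ ^ M k * h k) = c k * (2 ^ p * ρ ^ (M k + 1) * h k) := by rw [h2]
          _ ≤ c k * (2 ^ p * (n * h k) ^ (η - 1) * h k) := by
              have := (hc k).le
              gcongr
          _ = 2 ^ p * c k * ((n * h k) ^ (η - 1) * h k) := by ring
          _ = _ := by rw [h3]; ring
    calc lam * ∑ k ∈ K, c k * (ρ ^ M k * h k)
        ≤ lam * ∑ k ∈ K, 2 ^ p * n ^ (η - 1) * (c k * h k ^ η) :=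
          mul_le_mul_of_nonneg_left (Finset.sum_le_sum hterm) hl.le
      _ = lam * (2 ^ p * n ^ (η - 1) * ∑ k ∈ K, c k * h k ^ η) := by rw [← Finset.mul_sum]
      _ ≤ lam * (2 ^ p * n ^ (η - 1) * b) := by gcongr
      _ = _ := by rw [hy]; ring
  -- the random part
  set J := K.sigma fun k => Finset.range (M k) with hJ
  have hpos : ∀ j ∈ J, 0 < h j.1 ∧ j.2 + 1 ≤ M j.1 := by
    intro j hj
    have h1 := Finset.mem_range.1 (Finset.mem_sigma.1 hj).2
    have h2 := hM j.1 (by omega)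
    have h3 : 0 < n * h j.1 := lt_of_lt_of_le (by positivity) h2
    exact ⟨pos_of_mul_pos_right h3 hn.le, h1⟩
  have hex : ∀ j : (_ : κ) × ℕ, ∃ L w : ℝ, j ∈ J → 0 ≤ L ∧ 0 ≤ w ∧
      w ≤ c j.1 * h j.1 ^ η / b * ρ ^ (j.2 + 1) ∧ w * L = lam * c j.1 * ρ ^ (j.2 + 1) / n ∧
      w * min (B * ((2 : ℝ) ^ α) ^ (j.2 + 1) + n * h j.1 * (L ^ 2 / 2)) (L * (n * h j.1)) ≤
        c j.1 * h j.1 ^ η / b *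
          ((B + 1) * y * (θ ^ (j.2 + 1) * (n * h j.1) ^ (1 / 2 - η)) +
            ρ ^ (j.2 + 1) * y ^ (α / (α - p))) := by
    intro j
    by_cases hj : j ∈ J
    · obtain ⟨L, w, hLw⟩ := chaining_term_le hp hα hB hn (hpos j hj).1 (hc j.1) hb0 hl (j.2 + 1)
      exact ⟨L, w, fun _ => hLw⟩
    · exact ⟨0, 0, fun h => absurd h hj⟩
  choose L w hLw using hex
  have hvsum : ∑ k ∈ K, c k * h k ^ η / b ≤ 1 := by
    rw [← Finset.sum_div]; exact (div_le_one hb0).2 hb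
  have hv0 : ∀ k, 0 ≤ c k * h k ^ η / b := fun k => by
    have := (hc k).le
    have := hh k
    positivity
  have hw1 : ∑ j ∈ J, w j ≤ 1 := by
    calc ∑ j ∈ J, w j ≤ ∑ j ∈ J, c j.1 * h j.1 ^ η / b * ρ ^ (j.2 + 1) :=
          Finset.sum_le_sum fun j hj => (hLw j hj).2.2.1
      _ = ∑ k ∈ K, c k * h k ^ η / b * ∑ l ∈ Finset.range (M k), ρ ^ (l + 1) := by
          rw [hJ, Finset.sum_sigma]
          exact Finset.sum_congr rfl fun k _ => by dsimp only; rw [← Finset.mul_sum]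
      _ ≤ ∑ k ∈ K, c k * h k ^ η / b * 1 := by
          refine Finset.sum_le_sum fun k _ => mul_le_mul_of_nonneg_left ?_ (hv0 k)
          exact sum_range_pow_succ_le_one hρ0.le hρ _
      _ ≤ 1 := by simpa using hvsum
  have hmain := lintegral_exp_sum_le (P := P) J w
    (fun j => min (B * ((2 : ℝ) ^ α) ^ (j.2 + 1) + n * h j.1 * (L j ^ 2 / 2)) (L j * (n * h j.1)))
    (fun j ω => L j * Y j.1 (j.2 + 1) ω) (fun j hj => (hLw j hj).2.1) hw1
    (fun j _ => (hYm _ _).const_mul _) (fun j hj => by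
      rcases min_choice (B * ((2 : ℝ) ^ α) ^ (j.2 + 1) + n * h j.1 * (L j ^ 2 / 2))
        (L j * (n * h j.1)) with e | e <;> simp only [e]
      · exact hYexp _ _ (by omega) (hpos j hj).2 _ (hLw j hj).1
      · calc _ ≤ ∫⁻ _, ENNReal.ofReal (Real.exp (L j * (n * h j.1))) ∂P := by
              refine lintegral_mono fun ω => ENNReal.ofReal_le_ofReal (Real.exp_le_exp.2 ?_)
              exact mul_le_mul_of_nonneg_left (hY _ _ _) (hLw j hj).1
          _ = _ := by simp)
  have hψ : ∑ j ∈ J, w j * min (B * ((2 : ℝ) ^ α) ^ (j.2 + 1) + n * h j.1 * (L j ^ 2 / 2))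
      (L j * (n * h j.1)) ≤ (B + 1) * (θ / (θ - 1)) * y + y ^ (α / (α - p)) := by
    calc _ ≤ ∑ j ∈ J, c j.1 * h j.1 ^ η / b *
          ((B + 1) * y * (θ ^ (j.2 + 1) * (n * h j.1) ^ (1 / 2 - η)) +
            ρ ^ (j.2 + 1) * y ^ (α / (α - p))) :=
          Finset.sum_le_sum fun j hj => (hLw j hj).2.2.2.2
      _ = ∑ k ∈ K, c k * h k ^ η / b * ((B + 1) * y *
            ((n * h k) ^ (1 / 2 - η) * ∑ l ∈ Finset.range (M k), θ ^ (l + 1)) +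
            (∑ l ∈ Finset.range (M k), ρ ^ (l + 1)) * y ^ (α / (α - p))) := by
          rw [hJ, Finset.sum_sigma]
          refine Finset.sum_congr rfl fun k _ => ?_
          dsimp only
          rw [← Finset.mul_sum, Finset.sum_add_distrib, ← Finset.mul_sum, ← Finset.sum_mul,
            ← Finset.sum_mul, mul_comm (∑ l ∈ Finset.range (M k), θ ^ (l + 1))]
      _ ≤ ∑ k ∈ K, c k * h k ^ η / b * ((B + 1) * y * (θ / (θ - 1)) + y ^ (α / (α - p))) := by
          refine Finset.sum_le_sum fun k _ => mul_le_mul_of_nonneg_left ?_ (hv0 k)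
          refine add_le_add ?_ ?_
          · refine mul_le_mul_of_nonneg_left ?_ (by positivity)
            rcases Nat.eq_zero_or_pos (M k) with h0 | h0
            · rw [h0]
              simp only [Finset.range_zero, Finset.sum_empty, mul_zero]
              exact div_nonneg (by linarith) (by linarith)
            · have h1 := hM k h0
              have h2 : 0 < n * h k := lt_of_lt_of_le (by positivity) h1
              -- Since α/2 - p = α(η - 1/2), θ is a positive power of σ exactly because α > 2p. The
              -- lower bound on n h then makes the sum over levels cancel the factor (n h)^(1/2-η).
              have h3 : θ ^ M k ≤ (n * h k) ^ (η - 1 / 2) := by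
                have e : θ ^ M k = (((2 : ℝ) ^ α) ^ M k) ^ (η - 1 / 2) := by
                  rw [hθ, ← Real.rpow_natCast, ← Real.rpow_natCast, ← Real.rpow_mul two_pos.le,
                    ← Real.rpow_mul two_pos.le, ← Real.rpow_mul two_pos.le]
                  congr 1
                  rw [hη]; field_simp; ring
                rw [e]
                refine Real.rpow_le_rpow (by positivity) h1 ?_
                rw [hη, sub_nonneg, div_le_div_iff₀ two_pos hα0]
                linarith
              have h4 : 0 ≤ θ / (θ - 1) := div_nonneg (by linarith) (by linarith)
              calc (n * h k) ^ (1 / 2 - η) * ∑ l ∈ Finset.range (M k), θ ^ (l + 1)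
                  ≤ (n * h k) ^ (1 / 2 - η) * (θ / (θ - 1) * (n * h k) ^ (η - 1 / 2)) := by
                    gcongr
                    exact (sum_range_pow_succ_le hθ1 _).trans (mul_le_mul_of_nonneg_left h3 h4)
                _ = θ / (θ - 1) * ((n * h k) ^ (1 / 2 - η) * (n * h k) ^ (η - 1 / 2)) := by ring
                _ = θ / (θ - 1) := by rw [← Real.rpow_add h2]; simp
          · calc _ ≤ 1 * y ^ (α / (α - p)) := by
                  gcongr
                  exact sum_range_pow_succ_le_one hρ0.le hρ _
              _ = _ := one_mul _
      _ = (∑ k ∈ K, c k * h k ^ η / b) * ((B + 1) * y * (θ / (θ - 1)) + y ^ (α / (α - p))) := by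
          rw [Finset.sum_mul]
      _ ≤ 1 * ((B + 1) * y * (θ / (θ - 1)) + y ^ (α / (α - p))) := by
          refine mul_le_mul_of_nonneg_right hvsum ?_
          have h4 : 0 ≤ θ / (θ - 1) := div_nonneg (by linarith) (by linarith)
          positivity
      _ = _ := by ring
  have hsplit : ∀ ω, lam * innerCost K c h M Y n p ω =
      lam * ∑ k ∈ K, c k * (ρ ^ M k * h k) + ∑ j ∈ J, w j * (L j * Y j.1 (j.2 + 1) ω) := by
    intro ω
    have e1 : ∑ j ∈ J, w j * (L j * Y j.1 (j.2 + 1) ω) =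
        ∑ j ∈ J, lam * c j.1 * (ρ ^ (j.2 + 1) * (Y j.1 (j.2 + 1) ω / n)) := by
      refine Finset.sum_congr rfl fun j hj => ?_
      rw [← mul_assoc, (hLw j hj).2.2.2.1]; ring
    rw [e1, hJ, Finset.sum_sigma, innerCost, Finset.mul_sum, Finset.mul_sum,
      ← Finset.sum_add_distrib]
    refine Finset.sum_congr rfl fun k _ => ?_
    dsimp only
    rw [← Finset.mul_sum]
    ring
  have hfin : 2 ^ p * y + ((B + 1) * (θ / (θ - 1)) * y + y ^ (α / (α - p))) ≤
      (2 ^ p + (B + 1) * (θ / (θ - 1)) + 1) * (y + y ^ (α / (α - p))) := by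
    have h4 : 0 ≤ θ / (θ - 1) := div_nonneg (by linarith) (by linarith)
    have h5 : 0 ≤ y ^ (α / (α - p)) := by positivity
    have h6 : 0 ≤ (2 ^ p + (B + 1) * (θ / (θ - 1))) * y ^ (α / (α - p)) := by positivity
    nlinarith
  calc ∫⁻ ω, ENNReal.ofReal (Real.exp (lam * innerCost K c h M Y n p ω)) ∂P
      ≤ ∫⁻ ω, ENNReal.ofReal (Real.exp (2 ^ p * y)) *
          ENNReal.ofReal (Real.exp (∑ j ∈ J, w j * (L j * Y j.1 (j.2 + 1) ω))) ∂P := by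
        refine lintegral_mono fun ω => ?_
        rw [← ENNReal.ofReal_mul (Real.exp_pos _).le, ← Real.exp_add, hsplit]
        exact ENNReal.ofReal_le_ofReal (Real.exp_le_exp.2 (by linarith))
    _ ≤ ENNReal.ofReal (Real.exp (2 ^ p * y)) * ENNReal.ofReal (Real.exp
          ((B + 1) * (θ / (θ - 1)) * y + y ^ (α / (α - p)))) := by
        rw [lintegral_const_mul' _ _ ENNReal.ofReal_ne_top]
        gcongr
        exact hmain.trans (ENNReal.ofReal_le_ofReal (Real.exp_le_exp.2 hψ))
    _ ≤ _ := by
        rw [← ENNReal.ofReal_mul (Real.exp_pos _).le, ← Real.exp_add]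
        exact ENNReal.ofReal_le_ofReal (Real.exp_le_exp.2 hfin)

end Chaining

end EmpiricalWasserstein

namespace EmpiricalWasserstein

/-! ### Chernoff's bound for the inner cost -/

section Chernoff

/-- The rate obtained by optimising Chernoff's bound for `λ ↦ C (λ + λ ^ (s / (s - 1)))`. -/
noncomputable def chernoffRate (C s : ℝ) : ℝ :=
  min ((4 * C) ^ (-(s - 1)) / 2) (2 * (4 * C) ^ (-s))

lemma chernoffRate_pos {C s : ℝ} (hC : 0 < C) : 0 < chernoffRate C s :=
  lt_min (by positivity) (by positivity)

lemma exists_chernoff_exponent {C s ξ : ℝ} (hC : 1 ≤ C) (hs : 1 < s) (hξ : 4 * C ≤ ξ) :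
    ∃ y, 0 < y ∧ -(y * ξ) + C * (y + y ^ (s / (s - 1))) ≤ -(chernoffRate C s * ξ ^ s) := by
  have hξ0 : 0 < ξ := by linarith
  have hs1 : 0 < s - 1 := by linarith
  have h4 : 0 < 4 * C := by linarith
  -- With y = θ ξ^(s-1), each of C y and C y^(s/(s-1)) is at most a quarter of the gain y ξ = θ ξ^s,
  -- which leaves half of it.
  set θ := (4 * C) ^ (-(s - 1)) with hθ
  have hθ0 : 0 < θ := by positivity
  refine ⟨θ * ξ ^ (s - 1), by positivity, ?_⟩
  have e1 : θ * ξ ^ (s - 1) * ξ = θ * ξ ^ s := by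
    rw [mul_assoc]; congr 1
    rw [Real.rpow_sub_one hξ0.ne', div_mul_cancel₀ _ hξ0.ne']
  have e2 : (θ * ξ ^ (s - 1)) ^ (s / (s - 1)) = θ / (4 * C) * ξ ^ s := by
    rw [Real.mul_rpow hθ0.le (by positivity), ← Real.rpow_mul hξ0.le, mul_div_cancel₀ _ hs1.ne', hθ,
      ← Real.rpow_mul h4.le, show -(s - 1) * (s / (s - 1)) = -(s - 1) - 1 by field_simp; ring,
      Real.rpow_sub_one h4.ne']
  have e3 : C * (θ * ξ ^ (s - 1)) ≤ θ * ξ ^ s / 4 := by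
    rw [← e1]
    have : 0 ≤ θ * ξ ^ (s - 1) := by positivity
    nlinarith
  have e4 : C * (θ / (4 * C) * ξ ^ s) = θ * ξ ^ s / 4 := by field_simp
  have e5 : chernoffRate C s * ξ ^ s ≤ θ / 2 * ξ ^ s := by
    gcongr; exact min_le_left _ _
  rw [e2, mul_add, e4, e1]
  linarith

/-- For small ξ Chernoff's bound is not available, but the claimed exponential is then at least
e^(-2). The prefactor e² makes the estimate trivial there. -/
lemma chernoffRate_mul_le_two {C s ξ : ℝ} (hC : 1 ≤ C) (hs : 1 < s) (hξ0 : 0 ≤ ξ)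
    (hξ : ξ ≤ 4 * C) : chernoffRate C s * ξ ^ s ≤ 2 := by
  have h4 : 0 < 4 * C := by linarith
  calc chernoffRate C s * ξ ^ s ≤ 2 * (4 * C) ^ (-s) * (4 * C) ^ s := by
        refine mul_le_mul (min_le_right _ _) (Real.rpow_le_rpow hξ0 hξ (by linarith))
          (by positivity) (by positivity)
    _ = 2 := by rw [mul_assoc, ← Real.rpow_add h4]; simp

/-- The rate constant of the exponential term, in terms of the entropy constant `B`. -/
noncomputable def innerRate (p α B : ℝ) : ℝ :=
  chernoffRate (2 ^ p + (B + 1) * ((2 : ℝ) ^ (α / 2 - p) / (2 ^ (α / 2 - p) - 1)) + 1) (α / p)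

lemma one_le_innerRate_const {p α B : ℝ} (hα : 2 * p < α) (hB : 0 ≤ B) :
    1 ≤ 2 ^ p + (B + 1) * ((2 : ℝ) ^ (α / 2 - p) / (2 ^ (α / 2 - p) - 1)) + 1 := by
  have hθ1 : 1 < (2 : ℝ) ^ (α / 2 - p) := Real.one_lt_rpow one_lt_two (by linarith)
  have h4 : 0 ≤ (2 : ℝ) ^ (α / 2 - p) / (2 ^ (α / 2 - p) - 1) :=
    div_nonneg (by linarith) (by linarith)
  have : 0 ≤ 2 ^ p + (B + 1) * ((2 : ℝ) ^ (α / 2 - p) / (2 ^ (α / 2 - p) - 1)) := by positivity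
  linarith

lemma innerRate_pos {p α B : ℝ} (hα : 2 * p < α) (hB : 0 ≤ B) : 0 < innerRate p α B :=
  chernoffRate_pos (by linarith [one_le_innerRate_const hα hB])

variable {Ω κ : Type*} [MeasurableSpace Ω] {P : Measure Ω} [IsProbabilityMeasure P]

lemma measureReal_innerCost_le (K : Finset κ) {c h : κ → ℝ} {M : κ → ℕ} {Y : κ → ℕ → Ω → ℝ}
    {n p α B b x : ℝ} (hp : 1 ≤ p) (hα : 2 * p < α) (hB : 0 ≤ B) (hn : 0 < n)
    (hc : ∀ k, 0 < c k) (hh : ∀ k, 0 ≤ h k)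
    (hM : ∀ k, 1 ≤ M k → ((2 : ℝ) ^ α) ^ M k ≤ n * h k)
    (hM' : ∀ k, n * h k < ((2 : ℝ) ^ α) ^ (M k + 1))
    (hYm : ∀ k l, Measurable (Y k l)) (hY : ∀ k l ω, Y k l ω ≤ n * h k)
    (hYexp : ∀ k l, 1 ≤ l → l ≤ M k → ∀ s, 0 ≤ s →
      ∫⁻ ω, ENNReal.ofReal (Real.exp (s * Y k l ω)) ∂P ≤
        ENNReal.ofReal (Real.exp (B * ((2 : ℝ) ^ α) ^ l + n * h k * (s ^ 2 / 2))))
    (hb : ∑ k ∈ K, c k * h k ^ ((α - p) / α) ≤ b) (hb0 : 0 < b) (hx : 0 < x) :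
    P.real {ω | x < innerCost K c h M Y n p ω} ≤
      Real.exp 2 * Real.exp (-(n * innerRate p α B * (x / b) ^ (α / p))) := by
  have hp0 : 0 < p := by linarith
  have hα0 : 0 < α := by linarith
  have hαp : 0 < α - p := by linarith
  set η := (α - p) / α with hη
  set C := 2 ^ p + (B + 1) * ((2 : ℝ) ^ (α / 2 - p) / (2 ^ (α / 2 - p) - 1)) + 1 with hC
  have hC1 : 1 ≤ C := one_le_innerRate_const hα hB
  have hs : 1 < α / p := by rw [lt_div_iff₀ hp0]; linarith
  -- The normalised deviation: λx = yξ when y = λ b n^(η-1), and raising ξ to the power α/p restores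
  -- exactly one factor n because 1 - η = p/α.
  set ξ := x * n ^ (1 - η) / b with hξ
  have hξ0 : 0 < ξ := by positivity
  have hξs : n * innerRate p α B * (x / b) ^ (α / p) = chernoffRate C (α / p) * ξ ^ (α / p) := by
    have e : ξ = x / b * n ^ (1 - η) := by rw [hξ]; ring
    rw [e, Real.mul_rpow (by positivity) (by positivity), ← Real.rpow_mul hn.le,
      show (1 - η) * (α / p) = 1 by rw [hη]; field_simp; ring, Real.rpow_one, innerRate]
    ring
  rw [hξs]
  rcases le_total ξ (4 * C) with hξC | hξC
  · refine measureReal_le_one.trans ?_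
    rw [← Real.exp_add]
    exact Real.one_le_exp (by linarith [chernoffRate_mul_le_two hC1 hs hξ0.le hξC])
  · obtain ⟨y, hy0, hy⟩ := exists_chernoff_exponent hC1 hs hξC
    set lam := y * n ^ (1 - η) / b with hlam
    have hlam0 : 0 < lam := by positivity
    have hylam : lam * b * n ^ (η - 1) = y := by
      rw [hlam, div_mul_cancel₀ _ hb0.ne', mul_assoc, ← Real.rpow_add hn]; simp
    have hint := lintegral_exp_innerCost_le (P := P) K hp hα hB hn hc hh hM hM' hYm hY hYexp hb hb0
      hlam0
    rw [← hη, hylam, ← hC] at hint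
    have hmk := mul_meas_ge_le_lintegral (μ := P)
      (f := fun ω => ENNReal.ofReal (Real.exp (lam * innerCost K c h M Y n p ω)))
      (((measurable_innerCost K c h M n p hYm).const_mul lam).exp.ennreal_ofReal)
      (ENNReal.ofReal (Real.exp (lam * x)))
    have hsub : P {ω | x < innerCost K c h M Y n p ω} ≤
        P {ω | ENNReal.ofReal (Real.exp (lam * x)) ≤
          ENNReal.ofReal (Real.exp (lam * innerCost K c h M Y n p ω))} := by
      refine measure_mono fun ω hω => ENNReal.ofReal_le_ofReal (Real.exp_le_exp.2 ?_)
      have hω' : x < innerCost K c h M Y n p ω := hω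
      exact mul_le_mul_of_nonneg_left hω'.le hlam0.le
    have h1 : ENNReal.ofReal (Real.exp (lam * x)) * P {ω | x < innerCost K c h M Y n p ω} ≤
        ENNReal.ofReal (Real.exp (C * (y + y ^ (α / (α - p))))) :=
      (mul_le_mul_right hsub _).trans (hmk.trans hint)
    have h2 := ENNReal.toReal_mono ENNReal.ofReal_ne_top h1
    rw [ENNReal.toReal_mul, ENNReal.toReal_ofReal (Real.exp_pos _).le,
      ENNReal.toReal_ofReal (Real.exp_pos _).le] at h2
    have e : α / p / (α / p - 1) = α / (α - p) := by
      field_simp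
    rw [e] at hy
    have hlx : lam * x = y * ξ := by rw [hlam, hξ]; ring
    have h3 : P.real {ω | x < innerCost K c h M Y n p ω} ≤
        Real.exp (-(y * ξ) + C * (y + y ^ (α / (α - p)))) := by
      rw [Real.exp_add, Real.exp_neg, ← hlx, ← div_eq_inv_mul, le_div_iff₀ (Real.exp_pos _),
        mul_comm]
      exact h2
    calc _ ≤ Real.exp (-(y * ξ) + C * (y + y ^ (α / (α - p)))) := h3
      _ ≤ Real.exp (-(chernoffRate C (α / p) * ξ ^ (α / p))) := Real.exp_le_exp.2 hy
      _ ≤ _ := le_mul_of_one_le_left (Real.exp_pos _).le (Real.one_le_exp (by norm_num))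

end Chernoff

end EmpiricalWasserstein

namespace EmpiricalWasserstein

/-! ### Dyadic shells and the tree of cells inside a shell -/

section Shells

/-- The dyadic shell `2 ^ (k - 1) < d(x₀, x) ≤ 2 ^ k`. -/
def shell {E : Type*} [MetricSpace E] (x₀ : E) (k : ℤ) : Set E :=
  Metric.closedBall x₀ ((2 : ℝ) ^ k) \ Metric.closedBall x₀ ((2 : ℝ) ^ (k - 1))

lemma pairwise_disjoint_shell {E : Type*} [MetricSpace E] (x₀ : E) :
    Pairwise (Function.onFun Disjoint (shell x₀)) := by
  have key : ∀ k l : ℤ, k < l → Disjoint (shell x₀ k) (shell x₀ l) := by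
    intro k l hkl
    refine Set.disjoint_left.2 fun x hx hx' => hx'.2 ?_
    refine Metric.closedBall_subset_closedBall ?_ hx.1
    exact zpow_le_zpow_right₀ one_le_two (by omega)
  intro k l hkl
  rcases lt_or_gt_of_ne hkl with h | h
  · exact key k l h
  · exact (key l k h).symm

lemma edist_le_of_mem_shell {E : Type*} [MetricSpace E] {x₀ x : E} {k : ℤ}
    (hx : x ∈ shell x₀ k) : edist x₀ x ≤ ENNReal.ofReal ((2 : ℝ) ^ k) := by
  rw [edist_dist, dist_comm]
  exact ENNReal.ofReal_le_ofReal hx.1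

lemma dist_le_or_lt_of_notMem_shells {E : Type*} [MetricSpace E] {x₀ x : E} {a k₀ : ℤ}
    (hx : x ∉ ⋃ k ∈ Finset.Icc a k₀, shell x₀ k) :
    dist x x₀ ≤ (2 : ℝ) ^ (a - 1) ∨ (2 : ℝ) ^ k₀ < dist x x₀ := by
  by_contra! hcon
  have hpos : 0 < dist x x₀ := lt_trans (by positivity) hcon.1
  obtain ⟨m, hm1, hm2⟩ := exists_mem_Ioc_zpow hpos one_lt_two
  refine hx (mem_iUnion₂.2 ⟨m + 1, Finset.mem_Icc.2 ⟨?_, ?_⟩, hm2, ?_⟩)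
  · have := (zpow_lt_zpow_iff_right₀ (one_lt_two (α := ℝ))).1 (hcon.1.trans_le hm2)
    omega
  · have := (zpow_lt_zpow_iff_right₀ (one_lt_two (α := ℝ))).1 (hm1.trans_le hcon.2)
    omega
  · rw [add_sub_cancel_right]
    exact fun h => absurd (Metric.mem_closedBall.1 h) (not_le.2 hm1)

variable {E : Type*} [MetricSpace E] [MeasurableSpace E] [BorelSpace E]

lemma measurableSet_shell (x₀ : E) (k : ℤ) : MeasurableSet (shell x₀ k) :=
  Metric.isClosed_closedBall.measurableSet.diff Metric.isClosed_closedBall.measurableSet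

/-- Full outer measure of a possibly nonmeasurable `S` passes to every measurable superset. -/
lemma ae_mem_of_subset {μ : Measure E} [IsProbabilityMeasure μ] {S G : Set E} (hS : μ S = 1)
    (hG : MeasurableSet G) (h : S ⊆ G) : ∀ᵐ x ∂μ, x ∈ G := by
  exact (mem_ae_iff_prob_eq_one hG).2 (le_antisymm prob_le_one (hS ▸ measure_mono h))

/-- Nested partitions of a shell, and the partial couplings they produce. -/
lemma exists_shell_tree {S : Set E} {x₀ : E} {p α β : ℝ} (hp : 1 ≤ p)
    (h : HasCoveringDim S x₀ α β) (hβ : 0 < β) {μ : Measure E} [IsProbabilityMeasure μ]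
    (hS : μ S = 1) (k : ℤ) (M : ℕ) (hM : 1 ≤ M → 0 < μ (shell x₀ k)) :
    ∃ (T : ℕ → Finset E) (A : ℕ → E → Set E) (G : Set E),
      MeasurableSet G ∧ (∀ᵐ x ∂μ, x ∈ shell x₀ k → x ∈ G) ∧ (∀ l t, MeasurableSet (A l t)) ∧
      (∀ l, Pairwise (Function.onFun Disjoint (A l))) ∧ (∀ l t, A l t ⊆ shell x₀ k) ∧
      (∀ l, 1 ≤ l → ((T l).card : ℝ) ≤ β * (2 * 2 ^ l : ℝ) ^ α) ∧
      ∀ ν : Measure E, IsFiniteMeasure ν → (∀ᵐ x ∂ν, x ∈ shell x₀ k → x ∈ G) →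
        ∃ (π : Measure (E × E)) (μ' ν' : Measure E), π.fst + μ' = μ.restrict (shell x₀ k) ∧
          π.snd + ν' = ν.restrict (shell x₀ k) ∧
          μ' univ = μ (shell x₀ k) - ν (shell x₀ k) ∧ ν' univ = ν (shell x₀ k) - μ (shell x₀ k) ∧
          ∫⁻ z, edist z.1 z.2 ^ p ∂π ≤
            ENNReal.ofReal ((4 * 2 ^ k / 2 ^ M) ^ p) * μ (shell x₀ k) +
            ∑ l ∈ Finset.range M, ENNReal.ofReal ((4 * 2 ^ k / 2 ^ l) ^ p) *
              ∑ t ∈ T (l + 1), (μ (A (l + 1) t) - ν (A (l + 1) t)) := by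
  classical
  have hR : 0 < (2 : ℝ) ^ k := by positivity
  have hs := measurableSet_shell x₀ k
  obtain ⟨T, g, G, hGm, hSG, hGB, hT, hg, hnest, hdist, hT0, hcard⟩ :
      ∃ (T : ℕ → Finset E) (g : ℕ → E → E) (G : Set E),
        MeasurableSet G ∧ S ∩ Metric.closedBall x₀ (2 ^ k) ⊆ G ∧
        G ⊆ Metric.closedBall x₀ (2 ^ k) ∧
        (∀ l ≤ M, ∀ x, g l x ∈ T l) ∧ (∀ l ≤ M, ∀ t, MeasurableSet (g l ⁻¹' {t})) ∧
        (∀ l < M, ∀ x y, g (l + 1) x = g (l + 1) y → g l x = g l y) ∧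
        (∀ l ≤ M, ∀ x ∈ G, ∀ y ∈ G, g l x = g l y → dist x y ≤ 4 * 2 ^ k / 2 ^ l) ∧
        T 0 = {x₀} ∧ ∀ l, 1 ≤ l → ((T l).card : ℝ) ≤ β * (2 * 2 ^ l : ℝ) ^ α := by
    by_cases hne : (S ∩ Metric.closedBall x₀ (2 ^ k)).Nonempty
    · exact exists_nested_nets h hβ hR hne M
    -- A shell of positive mass meets `S`; if the ball misses `S`, no refinement is requested and
    -- the trivial partition will do.
    · have hM0 : M = 0 := by
        by_contra hM0
        refine (hM (by omega)).ne' ?_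
        have := ae_mem_of_subset hS hs.compl (fun x hx hx' => hne ⟨x, hx, hx'.1⟩)
        simpa [ae_iff] using this
      subst hM0
      refine ⟨fun l => if l = 0 then {x₀} else ∅, fun _ _ => x₀, Metric.closedBall x₀ (2 ^ k),
        Metric.isClosed_closedBall.measurableSet, inter_subset_right, subset_rfl, ?_, ?_, ?_, ?_,
        by simp, ?_⟩
      · intro l hl x; simp [Nat.le_zero.1 hl]
      · intro l _ t; exact MeasurableSet.const (x₀ = t)
      · intro l hl; omega
      · intro l hl x hx y hy _
        rw [Metric.mem_closedBall] at hx hy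
        have := dist_triangle_right x y x₀
        rw [Nat.le_zero.1 hl, pow_zero, div_one]
        linarith
      · intro l hl
        have : l ≠ 0 := by omega
        simp only [this, if_false, Finset.card_empty, Nat.cast_zero]
        positivity
  refine ⟨T, fun l t => if l ≤ M then g l ⁻¹' {t} ∩ shell x₀ k else ∅, G, hGm, ?_, ?_, ?_, ?_,
    hcard, ?_⟩
  · filter_upwards [ae_mem_of_subset hS (G := G ∪ (shell x₀ k)ᶜ) (hGm.union hs.compl)
      (fun x hx => by
        by_cases hxs : x ∈ shell x₀ k
        · exact Or.inl (hSG ⟨hx, hxs.1⟩)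
        · exact Or.inr hxs)] with x hx hxs
    exact hx.resolve_right fun h => h hxs
  · intro l t
    by_cases hl : l ≤ M
    · simpa only [hl, if_true] using (hg l hl t).inter hs
    · simp [hl]
  · intro l t t' htt
    by_cases hl : l ≤ M
    · simp only [Function.onFun, hl, if_true]
      refine Set.disjoint_left.2 fun x hx hx' => htt ?_
      have h1 : g l x = t := hx.1
      have h2 : g l x = t' := hx'.1
      exact h1.symm.trans h2
    · simp [Function.onFun, hl]
  · intro l t
    by_cases hl : l ≤ M
    · simp only [hl, if_true]; exact inter_subset_right
    · simp [hl]
  · intro ν _ hν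
    have hres : ∀ (m : Measure E) (l : ℕ), l ≤ M → ∀ t, m.restrict (shell x₀ k) (g l ⁻¹' {t}) =
        m (if l ≤ M then g l ⁻¹' {t} ∩ shell x₀ k else ∅) := by
      intro m l hl t
      rw [Measure.restrict_apply (hg l hl t), if_pos hl]
    have haeG : ∀ m : Measure E, (∀ᵐ x ∂m, x ∈ shell x₀ k → x ∈ G) →
        ∀ᵐ x ∂m.restrict (shell x₀ k), x ∈ G := fun m hm => (ae_restrict_iff' hs).2 hm
    have huniv : g 0 ⁻¹' {x₀} = univ := by
      refine eq_univ_of_forall fun x => ?_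
      have := hT 0 (Nat.zero_le _) x
      rw [hT0, Finset.mem_singleton] at this
      exact this
    obtain ⟨π, μ', ν', h1, h2, h3, h4, h5⟩ := exists_coupling_chain
      (fun z : E × E => edist z.1 z.2 ^ p) (G := G) T g
      (fun l => ENNReal.ofReal ((4 * 2 ^ k / 2 ^ l) ^ p)) M hT hg hnest
      (fun l hl x hx y hy hxy => by
        have hd := hdist l hl x hx y hy hxy
        dsimp only
        rw [edist_dist, ENNReal.ofReal_rpow_of_nonneg dist_nonneg (by linarith)]
        exact ENNReal.ofReal_le_ofReal (Real.rpow_le_rpow dist_nonneg hd (by linarith)))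
      (μ.restrict (shell x₀ k)) (ν.restrict (shell x₀ k))
      (haeG μ (by
        filter_upwards [ae_mem_of_subset hS (G := G ∪ (shell x₀ k)ᶜ) (hGm.union hs.compl)
          (fun x hx => by
            by_cases hxs : x ∈ shell x₀ k
            · exact Or.inl (hSG ⟨hx, hxs.1⟩)
            · exact Or.inr hxs)] with x hx hxs
        exact hx.resolve_right fun h => h hxs)) (haeG ν hν)
    refine ⟨π, μ', ν', h1, h2, ?_, ?_, ?_⟩
    · have := h3 x₀ (by simp [hT0])
      simpa [huniv] using this
    · have := h4 x₀ (by simp [hT0])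
      simpa [huniv] using this
    · refine h5.trans (le_of_eq ?_)
      congr 1
      · simp
      · refine Finset.sum_congr rfl fun l hl => ?_
        congr 1
        refine Finset.sum_congr rfl fun t _ => ?_
        have hl' : l + 1 ≤ M := Finset.mem_range.1 hl
        rw [hres μ _ hl', hres ν _ hl']

end Shells

/-! ### Pathwise bound of the transport cost -/

section Master

variable {E Ω : Type*} [MetricSpace E] [PolishSpace E] [MeasurableSpace E] [BorelSpace E]
  [MeasurableSpace Ω] {P : Measure Ω} [IsProbabilityMeasure P] {μ : Measure E}
  [IsProbabilityMeasure μ] {n : ℕ} {X : Fin n → Ω → E} {S : Set E} {x₀ : E} {p α β : ℝ}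

/-- A point outside the finitely many shells is either within 2^(a-1) of `x₀` or beyond 2^k₀; the
first kind contributes at most the power of that radius. -/
lemma lintegral_compl_shells_le (hp : 0 ≤ p) (ν : Measure E) [IsProbabilityMeasure ν] (a k₀ : ℤ) :
    ∫⁻ x in (⋃ k ∈ Finset.Icc a k₀, shell x₀ k)ᶜ, edist x₀ x ^ p ∂ν ≤
      ENNReal.ofReal (((2 : ℝ) ^ (a - 1)) ^ p) +
        ∫⁻ x in (Metric.closedBall x₀ (2 ^ k₀))ᶜ, edist x₀ x ^ p ∂ν := by
  have hU : MeasurableSet (⋃ k ∈ Finset.Icc a k₀, shell x₀ k) :=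
    Finset.measurableSet_biUnion _ fun k _ => measurableSet_shell x₀ k
  have hB : MeasurableSet (Metric.closedBall x₀ ((2 : ℝ) ^ k₀))ᶜ :=
    Metric.isClosed_closedBall.measurableSet.compl
  rw [← lintegral_indicator hU.compl, ← lintegral_indicator hB]
  calc _ ≤ ∫⁻ x, (ENNReal.ofReal (((2 : ℝ) ^ (a - 1)) ^ p) +
        (Metric.closedBall x₀ ((2 : ℝ) ^ k₀))ᶜ.indicator (fun x => edist x₀ x ^ p) x) ∂ν := by
        refine lintegral_mono fun x => ?_
        by_cases hx : x ∈ (⋃ k ∈ Finset.Icc a k₀, shell x₀ k)ᶜ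
        · rw [indicator_of_mem hx]
          rcases dist_le_or_lt_of_notMem_shells hx with h | h
          · refine le_add_right ?_
            rw [edist_dist, dist_comm, ENNReal.ofReal_rpow_of_nonneg dist_nonneg hp]
            exact ENNReal.ofReal_le_ofReal (Real.rpow_le_rpow dist_nonneg h hp)
          · refine le_add_left ?_
            rw [indicator_of_mem]
            exact fun h' => absurd (Metric.mem_closedBall.1 h') (not_le.2 h)
        · rw [indicator_of_notMem hx]; exact zero_le
    _ = _ := by
        rw [lintegral_add_left measurable_const]
        simp

/-- Truncated subtraction in `ℝ≥0∞` is the positive part, so the leftover mass produced by the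
couplings is the real-valued deficit divided by n. -/
lemma measureReal_sub_hits_le_deficit (hn : 0 < n) {ι : Type*} (T : Finset ι) {A : ι → Set E}
    (hA : ∀ t, MeasurableSet (A t)) (ω : Ω) :
    ∑ t ∈ T, (μ (A t) - empiricalMeasure (fun i => X i ω) (A t)) =
      ENNReal.ofReal (deficit μ X T A ω / n) := by
  have hn' : (0 : ℝ) < n := by exact_mod_cast hn
  rw [deficit, Finset.sum_div, ENNReal.ofReal_sum_of_nonneg
    fun t _ => div_nonneg (le_max_right _ _) hn'.le]
  refine Finset.sum_congr rfl fun t _ => ?_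
  rw [empiricalMeasure_apply hn (hA t), ← ofReal_measureReal,
    ← ENNReal.ofReal_sub _ (div_nonneg (hits_nonneg _ _) hn'.le)]
  rcases le_total (hits X (A t) ω) (n * μ.real (A t)) with h | h
  · rw [max_eq_left (by linarith)]
    congr 1
    field_simp
  · rw [max_eq_right (by linarith), zero_div, ENNReal.ofReal_zero, ENNReal.ofReal_eq_zero,
      sub_nonpos, le_div_iff₀ hn', mul_comm]
    exact h

/-- The pathwise bound of the transport cost by inner costs, shell fluctuations and tails. -/
lemma exists_innerCost_bound (hn : 0 < n) (hX : ∀ i, Measurable (X i)) (hind : iIndepFun X P)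
    (hlaw : ∀ i, P.map (X i) = μ) (hS : μ S = 1) (hp : 1 ≤ p) (hα : 2 * p < α) (hβ : 0 < β)
    (hcov : HasCoveringDim S x₀ α β) :
    ∃ (M : ℤ → ℕ) (Y : ℤ → ℕ → Ω → ℝ),
      (∀ k, 1 ≤ M k → ((2 : ℝ) ^ α) ^ M k ≤ n * μ.real (shell x₀ k)) ∧
      (∀ k, n * μ.real (shell x₀ k) < ((2 : ℝ) ^ α) ^ (M k + 1)) ∧
      (∀ k l, Measurable (Y k l)) ∧ (∀ k l ω, Y k l ω ≤ n * μ.real (shell x₀ k)) ∧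
      (∀ k l, 1 ≤ l → l ≤ M k → ∀ s, 0 ≤ s →
        ∫⁻ ω, ENNReal.ofReal (Real.exp (s * Y k l ω)) ∂P ≤
          ENNReal.ofReal (Real.exp (β * 2 ^ α * ((2 : ℝ) ^ α) ^ l +
            n * μ.real (shell x₀ k) * (s ^ 2 / 2)))) ∧
      ∀ a k₀ : ℤ, ∀ᵐ ω ∂P, (∀ i, X i ω ∈ Metric.closedBall x₀ ((2 : ℝ) ^ k₀)) →
        wassersteinPow p μ (empiricalMeasure fun i => X i ω) ≤
          ENNReal.ofReal (8 ^ p * innerCost (Finset.Icc a k₀) (fun k => ((2 : ℝ) ^ k) ^ p)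
            (fun k => μ.real (shell x₀ k)) M Y n p ω) +
          2 ^ (p - 1) * (ENNReal.ofReal (∑ k ∈ Finset.Icc a k₀, ((2 : ℝ) ^ k) ^ p / n *
              |hits X (shell x₀ k) ω - n * μ.real (shell x₀ k)|) +
            2 * ENNReal.ofReal (((2 : ℝ) ^ (a - 1)) ^ p) +
            ∫⁻ x in (Metric.closedBall x₀ (2 ^ k₀))ᶜ, edist x₀ x ^ p ∂μ) := by
  have hn' : (0 : ℝ) < n := by exact_mod_cast hn
  have hσ : 1 < (2 : ℝ) ^ α := Real.one_lt_rpow one_lt_two (by linarith)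
  -- The depth is the largest M with 2^(αM) ≤ n μ(shell), and 0 when n μ(shell) < 1. As there are of
  -- order 2^(αM) cells, finer cells would mostly contain no sample point.
  have hMex : ∀ k : ℤ, ∃ M : ℕ, (1 ≤ M → ((2 : ℝ) ^ α) ^ M ≤ n * μ.real (shell x₀ k)) ∧
      n * μ.real (shell x₀ k) < ((2 : ℝ) ^ α) ^ (M + 1) := by
    intro k
    rcases lt_or_ge (n * μ.real (shell x₀ k)) 1 with h | h
    · exact ⟨0, by simp, by simpa using h.trans hσ⟩
    · obtain ⟨M, h1, h2⟩ := exists_nat_pow_near h hσ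
      exact ⟨M, fun _ => h1, h2⟩
  choose M hM1 hM2 using hMex
  have hpos : ∀ k, 1 ≤ M k → 0 < μ (shell x₀ k) := by
    intro k hk
    have h1 : 0 < n * μ.real (shell x₀ k) := lt_of_lt_of_le (by positivity) (hM1 k hk)
    have h2 : 0 < μ.real (shell x₀ k) := pos_of_mul_pos_right h1 hn'.le
    exact (ENNReal.toReal_pos_iff.1 h2).1
  choose T A G hGm hGμ hAm hAd hAs hcard hcoup using fun k =>
    exists_shell_tree hp hcov hβ hS k (M k) (hpos k)
  refine ⟨M, fun k l => deficit μ X (T k l) (A k l), hM1, hM2,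
    fun k l => measurable_deficit _ (hAm k l) hX,
    fun k l ω => deficit_le _ (hAm k l) (hAd k l) (hAs k l) ω, ?_, ?_⟩
  · intro k l hl _ s hs
    refine (lintegral_exp_deficit_le (T k l) (hAm k l) (hAd k l) (hAs k l) hX hind hlaw hs).trans
      (ENNReal.ofReal_le_ofReal ?_)
    rw [Real.exp_add]
    refine mul_le_mul_of_nonneg_right ?_ (Real.exp_pos _).le
    -- The number of subfamilies is bounded by exp(number of cells), and the covering bound gives
    -- the entropy constant β·2^α per unit of (2^α)^l.
    have h1 : (2 : ℝ) ^ (T k l).card ≤ Real.exp 1 ^ (T k l).card := by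
      gcongr; linarith [Real.add_one_le_exp 1]
    refine h1.trans ?_
    rw [← Real.exp_nat_mul, mul_one]
    refine Real.exp_le_exp.2 ((hcard k l hl).trans (le_of_eq ?_))
    rw [Real.mul_rpow two_pos.le (by positivity), ← Real.rpow_natCast, ← Real.rpow_natCast,
      ← Real.rpow_mul two_pos.le, ← Real.rpow_mul two_pos.le, mul_comm α, mul_assoc]
  · intro a k₀
    have hgood : ∀ᵐ ω ∂P, ∀ k i, X i ω ∈ shell x₀ k → X i ω ∈ G k := by
      refine ae_all_iff.2 fun k => ae_all_iff.2 fun i => ?_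
      have := hGμ k
      rw [← hlaw i] at this
      exact ae_of_ae_map (hX i).aemeasurable this
    filter_upwards [hgood] with ω hω hball
    set ν := empiricalMeasure fun i => X i ω with hν
    have hνprob : IsProbabilityMeasure ν := isProbabilityMeasure_empiricalMeasure hn ω
    have hνG : ∀ k, ∀ᵐ x ∂ν, x ∈ shell x₀ k → x ∈ G k := by
      intro k
      have hm : MeasurableSet (shell x₀ k ∩ (G k)ᶜ) :=
        (measurableSet_shell x₀ k).inter (hGm k).compl
      have h0 : ν (shell x₀ k ∩ (G k)ᶜ) = 0 := by
        rw [hν, empiricalMeasure_apply hn hm, hits, Finset.sum_eq_zero]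
        · simp
        · exact fun i _ => indicator_of_notMem (fun h => h.2 (hω k i h.1)) _
      rw [ae_iff]
      convert h0 using 2
      ext x
      simp
    choose π μ' ν' h1 h2 h3 h4 h5 using fun k => hcoup k ν inferInstance (hνG k)
    refine (wassersteinPow_le_of_shells hp x₀ μ ν (Finset.Icc a k₀) (shell x₀)
      (measurableSet_shell x₀) (pairwise_disjoint_shell x₀) π μ' ν'
      (fun k => ENNReal.ofReal ((2 : ℝ) ^ k)) (fun k x hx => edist_le_of_mem_shell hx)
      (fun k _ => h1 k) (fun k _ => h2 k)).trans ?_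
    refine add_le_add ?_ (mul_le_mul_right ?_ _)
    · rw [innerCost, Finset.mul_sum, ENNReal.ofReal_sum_of_nonneg]
      · refine Finset.sum_le_sum fun k _ => (h5 k).trans ?_
        have e : ∀ l ∈ Finset.range (M k), ENNReal.ofReal ((4 * 2 ^ k / 2 ^ l) ^ p) *
            ∑ t ∈ T k (l + 1), (μ (A k (l + 1) t) - ν (A k (l + 1) t)) =
            ENNReal.ofReal ((4 * 2 ^ k / 2 ^ l) ^ p *
              (deficit μ X (T k (l + 1)) (A k (l + 1)) ω / n)) := by
          intro l _
          rw [hν, measureReal_sub_hits_le_deficit hn _ (hAm k (l + 1)),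
            ← ENNReal.ofReal_mul (by positivity)]
        have hnn : ∀ l ∈ Finset.range (M k), 0 ≤ ((4 * 2 ^ k / 2 ^ l : ℝ) ^ p *
              (deficit μ X (T k (l + 1)) (A k (l + 1)) ω / n)) := fun l _ => by
          have := deficit_nonneg (μ := μ) (X := X) (T k (l + 1)) (A k (l + 1)) ω
          positivity
        rw [Finset.sum_congr rfl e, ← ofReal_measureReal, ← ENNReal.ofReal_mul (by positivity),
          ← ENNReal.ofReal_sum_of_nonneg hnn, ← ENNReal.ofReal_add (by positivity)
            (Finset.sum_nonneg hnn)]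
        refine ENNReal.ofReal_le_ofReal ?_
        have hpw : ∀ l : ℕ, (4 * 2 ^ k / 2 ^ l : ℝ) ^ p =
            4 ^ p * ((2 : ℝ) ^ k) ^ p * ((2 : ℝ) ^ (-p)) ^ l := by
          intro l
          rw [Real.div_rpow (by positivity) (by positivity), Real.mul_rpow (by positivity)
            (by positivity), Real.rpow_neg two_pos.le, inv_pow, ← Real.rpow_natCast 2 l,
            ← Real.rpow_mul two_pos.le, ← Real.rpow_natCast, ← Real.rpow_mul two_pos.le,
            mul_comm (l : ℝ) p, div_eq_mul_inv]
        -- The diameter constant contributes 4^p. The further 2^p comes from the shift between the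
        -- scale l at which mass moves and the weight ρ^(l+1) used in the inner cost.
        have h8 : (8 : ℝ) ^ p = 4 ^ p * 2 ^ p := by
          rw [← Real.mul_rpow (by norm_num) (by norm_num)]; norm_num
        have h2p : 1 ≤ (2 : ℝ) ^ p := Real.one_le_rpow one_le_two (by linarith)
        have hρ2 : (2 : ℝ) ^ (-p) * 2 ^ p = 1 := by rw [← Real.rpow_add two_pos]; simp
        simp_rw [hpw]
        rw [mul_left_comm, mul_add, mul_add, Finset.mul_sum, Finset.mul_sum, h8]
        refine add_le_add ?_ (Finset.sum_le_sum fun l _ => ?_)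
        · have h6 : 0 ≤ 4 ^ p * ((2 : ℝ) ^ k) ^ p * (((2 : ℝ) ^ (-p)) ^ M k *
            μ.real (shell x₀ k)) := by positivity
          calc _ = 4 ^ p * ((2 : ℝ) ^ k) ^ p * (((2 : ℝ) ^ (-p)) ^ M k *
                μ.real (shell x₀ k)) * 1 := by ring
            _ ≤ 4 ^ p * ((2 : ℝ) ^ k) ^ p * (((2 : ℝ) ^ (-p)) ^ M k *
                μ.real (shell x₀ k)) * 2 ^ p := by gcongr
            _ = _ := by ring
        · refine le_of_eq ?_
          calc _ = 4 ^ p * ((2 : ℝ) ^ k) ^ p * ((2 : ℝ) ^ (-p)) ^ l *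
                (deficit μ X (T k (l + 1)) (A k (l + 1)) ω / n) * ((2 : ℝ) ^ (-p) * 2 ^ p) := by
                rw [hρ2, mul_one]
            _ = _ := by rw [pow_succ]; ring
      · intro k _
        have : ∀ l, 0 ≤ deficit μ X (T k l) (A k l) ω := fun l => deficit_nonneg _ _ _
        have h7 : 0 ≤ ∑ l ∈ Finset.range (M k), ((2 : ℝ) ^ (-p)) ^ (l + 1) *
            (deficit μ X (T k (l + 1)) (A k (l + 1)) ω / n) :=
          Finset.sum_nonneg fun l _ => by have := this (l + 1); positivity
        positivity
    · rw [add_assoc]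
      refine add_le_add ?_ ?_
      · rw [ENNReal.ofReal_sum_of_nonneg fun k _ => by positivity]
        refine Finset.sum_le_sum fun k _ => ?_
        rw [h3 k, h4 k, hν, empiricalMeasure_apply hn (measurableSet_shell x₀ k),
          ← ofReal_measureReal, ← ENNReal.ofReal_sub _ (div_nonneg (hits_nonneg _ _) hn'.le),
          ← ENNReal.ofReal_sub _ measureReal_nonneg,
          ENNReal.ofReal_rpow_of_nonneg (by positivity) (by linarith), div_mul_eq_mul_div,
          mul_div_assoc, ENNReal.ofReal_mul (by positivity)]
        gcongr
        have e : |hits X (shell x₀ k) ω - n * μ.real (shell x₀ k)| / n =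
            |hits X (shell x₀ k) ω / n - μ.real (shell x₀ k)| := by
          rw [← abs_of_pos hn', ← abs_div, abs_of_pos hn']
          congr 1
          field_simp
        rw [e]
        rcases le_total (hits X (shell x₀ k) ω / n) (μ.real (shell x₀ k)) with h | h
        · rw [ENNReal.ofReal_of_nonpos (p := hits X (shell x₀ k) ω / n - _) (by linarith), add_zero,
            abs_of_nonpos (by linarith), neg_sub]
        · rw [ENNReal.ofReal_of_nonpos (p := μ.real (shell x₀ k) - _) (by linarith), zero_add,
            abs_of_nonneg (by linarith)]
      · have hν0 : ∫⁻ x in (Metric.closedBall x₀ ((2 : ℝ) ^ k₀))ᶜ, edist x₀ x ^ p ∂ν = 0 := by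
          refine setLIntegral_measure_zero _ _ ?_
          rw [hν, empiricalMeasure_apply hn Metric.isClosed_closedBall.measurableSet.compl, hits,
            Finset.sum_eq_zero]
          · simp
          · exact fun i _ => indicator_of_notMem (notMem_compl_iff.2 (hball i)) _
        have i1 := lintegral_compl_shells_le (x₀ := x₀) (by linarith : 0 ≤ p) μ a k₀
        have i2 := lintegral_compl_shells_le (x₀ := x₀) (by linarith : 0 ≤ p) ν a k₀
        rw [hν0, add_zero] at i2
        refine (add_le_add i1 i2).trans (le_of_eq ?_)
        ring

end Master

end EmpiricalWasserstein

namespace EmpiricalWasserstein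

/-! ### Splitting the deviation event -/

section DeviationBound

variable {E Ω : Type*} [MetricSpace E] [PolishSpace E] [MeasurableSpace E] [BorelSpace E]
  [MeasurableSpace Ω] {P : Measure Ω} [IsProbabilityMeasure P] {μ : Measure E}
  [IsProbabilityMeasure μ] {n : ℕ} {X : Fin n → Ω → E} {S : Set E} {x₀ : E} {p α β : ℝ}

/-- The budget x is divided into quarters: inner cost, shell fluctuations, the small ball, and the
mass of μ outside the large ball. The last two are deterministic by hypothesis, so a deviation
forces one of the first two to be large or some sample point to leave the large ball; a union bound
finishes. -/
lemma devProb_le (hn : 0 < n) (hX : ∀ i, Measurable (X i)) (hind : iIndepFun X P)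
    (hlaw : ∀ i, P.map (X i) = μ) (hS : μ S = 1) (hp : 1 ≤ p) (hα : 2 * p < α) (hβ : 0 < β)
    (hcov : HasCoveringDim S x₀ α β) {a k₀ : ℤ} {x q b : ℝ} (hq : 1 ≤ q) (hx : 0 < x) (hb0 : 0 < b)
    (hb : ∑ k ∈ Finset.Icc a k₀, ((2 : ℝ) ^ k) ^ p * μ.real (shell x₀ k) ^ ((α - p) / α) ≤ b)
    (ha : 2 ^ p * ((2 : ℝ) ^ (a - 1)) ^ p ≤ x / 4)
    (htail : 2 ^ (p - 1) * ∫⁻ y in (Metric.closedBall x₀ (2 ^ k₀))ᶜ, edist x₀ y ^ p ∂μ ≤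
      ENNReal.ofReal (x / 4)) :
    devProb P X μ p x ≤
      Real.exp 2 *
          Real.exp (-(n * innerRate p α (β * 2 ^ α) * (x / (4 * 8 ^ p) / b) ^ (α / p))) *
        (if x / (4 * 8 ^ p) < 2 * ∑ k ∈ Finset.Icc a k₀, ((2 : ℝ) ^ k) ^ p * μ.real (shell x₀ k)
          then 1 else 0) +
      (4 * Real.exp 2 * q ^ q + 1) *
        (∑ k ∈ Finset.Icc a k₀, ((2 : ℝ) ^ k) ^ p / n *
          ((n * μ.real (shell x₀ k)) ^ (1 / 2 : ℝ) + (n * μ.real (shell x₀ k)) ^ (1 / q))) ^ q /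
        (x / (2 * 2 ^ p)) ^ q +
      n * (tail x₀ μ (2 ^ k₀)).toReal := by
  have hn' : (0 : ℝ) < n := by exact_mod_cast hn
  have h2p : (2 : ℝ) ^ p = 2 * 2 ^ (p - 1) := by
    rw [Real.rpow_sub_one two_ne_zero]; ring
  obtain ⟨M, Y, hM, hM', hYm, hY, hYexp, hbound⟩ :=
    exists_innerCost_bound hn hX hind hlaw hS hp hα hβ hcov
  set K := Finset.Icc a k₀ with hK
  set c : ℤ → ℝ := fun k => ((2 : ℝ) ^ k) ^ p with hc
  set h : ℤ → ℝ := fun k => μ.real (shell x₀ k) with hh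
  have hc0 : ∀ k, 0 < c k := fun k => by positivity
  have hh0 : ∀ k, 0 ≤ h k := fun k => measureReal_nonneg
  set D : Ω → ℝ := fun ω => ∑ k ∈ K, c k / n * |hits X (shell x₀ k) ω - n * h k| with hD
  have hD0 : ∀ ω, 0 ≤ D ω := fun ω => Finset.sum_nonneg fun k _ => by
    have := (hc0 k).le; positivity
  set S₁ : Set Ω := {ω | x / (4 * 8 ^ p) < innerCost K c h M Y n p ω} with hS₁
  set S₂ : Set Ω := {ω | x / (2 * 2 ^ p) ≤ D ω} with hS₂
  set S₃ : Set Ω := ⋃ i, X i ⁻¹' (Metric.closedBall x₀ ((2 : ℝ) ^ k₀))ᶜ with hS₃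
  have hincl : ∀ᵐ ω ∂P,
      ω ∈ {ω | ENNReal.ofReal x < wassersteinPow p μ (empiricalMeasure fun i => X i ω)} →
        ω ∈ S₁ ∪ S₂ ∪ S₃ := by
    filter_upwards [hbound a k₀] with ω hω hωx
    by_contra hcon
    simp only [mem_union, not_or] at hcon
    obtain ⟨⟨c1, c2⟩, c3⟩ := hcon
    have hball : ∀ i, X i ω ∈ Metric.closedBall x₀ ((2 : ℝ) ^ k₀) := by
      intro i
      by_contra hi
      exact c3 (mem_iUnion.2 ⟨i, hi⟩)
    have c1' : innerCost K c h M Y n p ω ≤ x / (4 * 8 ^ p) := not_lt.1 c1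
    have c2' : D ω < x / (2 * 2 ^ p) := not_le.1 c2
    refine absurd hωx (not_lt.2 ((hω hball).trans ?_))
    have e1 : ENNReal.ofReal (8 ^ p * innerCost K c h M Y n p ω) ≤ ENNReal.ofReal (x / 4) := by
      refine ENNReal.ofReal_le_ofReal ?_
      calc (8 : ℝ) ^ p * innerCost K c h M Y n p ω ≤ 8 ^ p * (x / (4 * 8 ^ p)) := by gcongr
        _ = x / 4 := by field_simp
    have e0 : (2 : ℝ≥0∞) ^ (p - 1) = ENNReal.ofReal ((2 : ℝ) ^ (p - 1)) := by
      rw [← ENNReal.ofReal_rpow_of_pos two_pos]; simp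
    have e2 : (2 : ℝ≥0∞) ^ (p - 1) * ENNReal.ofReal (D ω) ≤ ENNReal.ofReal (x / 4) := by
      rw [e0, ← ENNReal.ofReal_mul (by positivity)]
      refine ENNReal.ofReal_le_ofReal ?_
      calc (2 : ℝ) ^ (p - 1) * D ω ≤ 2 ^ (p - 1) * (x / (2 * 2 ^ p)) := by gcongr
        _ = x / 4 := by rw [h2p]; field_simp; norm_num
    have e3 : (2 : ℝ≥0∞) ^ (p - 1) * (2 * ENNReal.ofReal (((2 : ℝ) ^ (a - 1)) ^ p)) ≤
        ENNReal.ofReal (x / 4) := by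
      rw [e0, show (2 : ℝ≥0∞) = ENNReal.ofReal 2 by simp, ← ENNReal.ofReal_mul (by norm_num),
        ← ENNReal.ofReal_mul (by positivity)]
      refine ENNReal.ofReal_le_ofReal (le_trans (le_of_eq ?_) ha)
      rw [h2p]; ring
    calc _ ≤ ENNReal.ofReal (x / 4) + (ENNReal.ofReal (x / 4) + ENNReal.ofReal (x / 4) +
          ENNReal.ofReal (x / 4)) := by
          rw [mul_add, mul_add]
          exact add_le_add e1 (add_le_add (add_le_add e2 e3) htail)
      _ = ENNReal.ofReal x := by
          have : 0 ≤ x / 4 := by positivity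
          rw [← ENNReal.ofReal_add this this, ← ENNReal.ofReal_add (by linarith) this,
            ← ENNReal.ofReal_add this (by linarith)]
          congr 1; ring
  have hS₃P : P.real S₃ ≤ n * (tail x₀ μ (2 ^ k₀)).toReal := by
    calc P.real S₃ ≤ ∑ i, P.real (X i ⁻¹' (Metric.closedBall x₀ ((2 : ℝ) ^ k₀))ᶜ) :=
          measureReal_iUnion_fintype_le _
      _ = ∑ _i : Fin n, (tail x₀ μ (2 ^ k₀)).toReal := by
          refine Finset.sum_congr rfl fun i _ => ?_
          rw [tail, ← hlaw i, Measure.map_apply (hX i)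
            Metric.isClosed_closedBall.measurableSet.compl, measureReal_def]
      _ = _ := by simp
  have hS₂P := measureReal_sum_centered_hits_le (P := P) (μ := μ) K (shell x₀)
    (measurableSet_shell x₀) (fun k => c k / n) (fun k => by have := (hc0 k).le; positivity) hq
    (x := x / (2 * 2 ^ p)) (by positivity) hX hind hlaw
  have hS₁P : P.real S₁ ≤ Real.exp 2 *
          Real.exp (-(n * innerRate p α (β * 2 ^ α) * (x / (4 * 8 ^ p) / b) ^ (α / p))) *
        (if x / (4 * 8 ^ p) < 2 * ∑ k ∈ K, c k * h k then 1 else 0) := by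
    split_ifs with hif
    · rw [mul_one]
      exact measureReal_innerCost_le K hp hα (by positivity) hn' hc0 hh0 hM hM' hYm hY hYexp hb hb0
        (by positivity)
    · rw [mul_zero]
      have : S₁ = ∅ := by
        refine eq_empty_of_forall_notMem fun ω hω => hif ?_
        have hω' : x / (4 * 8 ^ p) < innerCost K c h M Y n p ω := hω
        exact hω'.trans_le (innerCost_le K M hp hn' hc0 hh0 hY ω)
      rw [this, measureReal_empty]
  calc devProb P X μ p x ≤ P.real (S₁ ∪ S₂ ∪ S₃) :=
        ENNReal.toReal_mono (measure_ne_top _ _) (measure_mono_ae hincl)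
    _ ≤ P.real S₁ + P.real S₂ + P.real S₃ :=
        (measureReal_union_le _ _).trans (add_le_add_left (measureReal_union_le _ _) _)
    _ ≤ _ := add_le_add (add_le_add hS₁P hS₂P) hS₃P

end DeviationBound

/-! ### Shell sums, tail integrals and weak moments -/

section Tails

lemma sum_zpow_rpow_le {θ : ℝ} (hθ : 0 < θ) (a k₀ : ℤ) :
    ∑ k ∈ Finset.Icc a k₀, ((2 : ℝ) ^ k) ^ θ ≤ 2 ^ θ / (2 ^ θ - 1) * ((2 : ℝ) ^ k₀) ^ θ := by
  have h1 : 1 < (2 : ℝ) ^ θ := Real.one_lt_rpow one_lt_two hθ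
  have h2 : 0 < (2 : ℝ) ^ θ - 1 := by linarith
  rcases lt_or_ge k₀ a with h | h
  · rw [Finset.Icc_eq_empty (by omega), Finset.sum_empty]; positivity
  · induction k₀, h using Int.leInduction with
    | base =>
      rw [Finset.Icc_self, Finset.sum_singleton]
      refine le_mul_of_one_le_left (by positivity) ?_
      rw [le_div_iff₀ h2]; linarith
    | succ m hm ih =>
      rw [← Finset.insert_Icc_right_eq_Icc_add_one (by omega), Finset.sum_insert (by simp)]
      have e : ((2 : ℝ) ^ (m + 1)) ^ θ = 2 ^ θ * ((2 : ℝ) ^ m) ^ θ := by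
        rw [zpow_add_one₀ two_ne_zero, mul_comm, Real.mul_rpow two_pos.le (by positivity)]
      rw [e]
      have h3 : 0 < ((2 : ℝ) ^ m) ^ θ := by positivity
      calc _ ≤ 2 ^ θ * ((2 : ℝ) ^ m) ^ θ + 2 ^ θ / (2 ^ θ - 1) * ((2 : ℝ) ^ m) ^ θ := by gcongr
        _ = _ := by field_simp; ring

variable {E : Type*} [MetricSpace E] [MeasurableSpace E] [BorelSpace E] {μ : Measure E}
  [IsProbabilityMeasure μ] {x₀ : E}

lemma antitone_tail (x₀ : E) (μ : Measure E) : Antitone (tail x₀ μ) := fun _ _ hst =>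
  measure_mono (compl_subset_compl.2 (Metric.closedBall_subset_closedBall hst))

lemma tail_le_one (x₀ : E) (μ : Measure E) [IsProbabilityMeasure μ] (t : ℝ) : tail x₀ μ t ≤ 1 :=
  prob_le_one

lemma measure_shell_le_tail (k : ℤ) : μ (shell x₀ k) ≤ tail x₀ μ (2 ^ (k - 1)) :=
  measure_mono fun _ hx => hx.2

lemma measureReal_shell_le_tail (k : ℤ) :
    μ.real (shell x₀ k) ≤ (tail x₀ μ (2 ^ (k - 1))).toReal :=
  ENNReal.toReal_mono (measure_ne_top _ _) (measure_shell_le_tail k)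

/-- Dyadic sums are dominated by the integral of the tail. -/
lemma sum_shell_rpow_le_lintegral {p γ : ℝ} (hp : 1 ≤ p) (hγ : 0 ≤ γ) (K : Finset ℤ) :
    ∑ k ∈ K, ENNReal.ofReal (((2 : ℝ) ^ k) ^ p) * μ (shell x₀ k) ^ γ ≤
      4 ^ p * ∫⁻ t in Ioi (0 : ℝ), tail x₀ μ t ^ γ * ENNReal.ofReal (t ^ (p - 1)) := by
  -- On this interval the tail is still at least the mass of shell k, and its length is a quarter of
  -- 2^k; the lower bound for t^(p-1) then yields the factor 4^p. The intervals are disjoint, so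
  -- nothing is counted twice.
  set J : ℤ → Set ℝ := fun k => Ioc ((2 : ℝ) ^ (k - 2)) (2 ^ (k - 1)) with hJ
  have hJd : Pairwise (Function.onFun Disjoint J) := by
    have key : ∀ k l : ℤ, k < l → Disjoint (J k) (J l) := by
      intro k l hkl
      refine Set.disjoint_left.2 fun t ht ht' => ?_
      have : (2 : ℝ) ^ (k - 1) ≤ 2 ^ (l - 2) := zpow_le_zpow_right₀ one_le_two (by omega)
      exact absurd (ht.2.trans this) (not_le.2 ht'.1)
    intro k l hkl
    rcases lt_or_gt_of_ne hkl with h | h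
    · exact key k l h
    · exact (key l k h).symm
  have hterm : ∀ k, ENNReal.ofReal (((2 : ℝ) ^ k) ^ p) * μ (shell x₀ k) ^ γ ≤
      4 ^ p * ∫⁻ t in J k, tail x₀ μ t ^ γ * ENNReal.ofReal (t ^ (p - 1)) := by
    intro k
    set d := (2 : ℝ) ^ (k - 2) with hd
    have hd0 : 0 < d := by positivity
    have hd1 : (2 : ℝ) ^ (k - 1) = d + d := by
      rw [hd, ← two_mul, ← zpow_one_add₀ two_ne_zero]; congr 1; ring
    have hd2 : (2 : ℝ) ^ k = 4 * d := by
      rw [hd, zpow_sub₀ two_ne_zero]; norm_num; ring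
    have h4 : (4 : ℝ≥0∞) ^ p = ENNReal.ofReal (4 ^ p) := by
      rw [← ENNReal.ofReal_rpow_of_pos (by norm_num)]; simp
    calc ENNReal.ofReal (((2 : ℝ) ^ k) ^ p) * μ (shell x₀ k) ^ γ
        = 4 ^ p * ∫⁻ _ in J k, μ (shell x₀ k) ^ γ * ENNReal.ofReal (d ^ (p - 1)) := by
          rw [setLIntegral_const, hJ]
          simp only
          rw [Real.volume_Ioc, hd1, ← hd, add_sub_cancel_right, mul_assoc,
            ← ENNReal.ofReal_mul (by positivity), Real.rpow_sub_one hd0.ne',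
            div_mul_cancel₀ _ hd0.ne', h4, mul_left_comm, ← ENNReal.ofReal_mul (by positivity), hd2,
            Real.mul_rpow (by norm_num) hd0.le, mul_comm]
      _ ≤ _ := by
          refine mul_le_mul_right (setLIntegral_mono' measurableSet_Ioc fun t ht => ?_) _
          have ht1 : d < t := ht.1
          gcongr
          exact (measure_shell_le_tail k).trans (antitone_tail x₀ μ ht.2)
  calc _ ≤ ∑ k ∈ K, 4 ^ p * ∫⁻ t in J k, tail x₀ μ t ^ γ * ENNReal.ofReal (t ^ (p - 1)) :=
        Finset.sum_le_sum fun k _ => hterm k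
    _ = 4 ^ p * ∫⁻ t in ⋃ k ∈ K, J k, tail x₀ μ t ^ γ * ENNReal.ofReal (t ^ (p - 1)) := by
        rw [← Finset.mul_sum, lintegral_biUnion_finset (fun i _ j _ h => hJd h)
          fun k _ => measurableSet_Ioc]
    _ ≤ _ := by
        refine mul_le_mul_right (lintegral_mono_set ?_) _
        exact iUnion₂_subset fun k _ t ht => lt_trans (by positivity) ht.1

lemma sum_shell_rpow_le_toReal {p γ : ℝ} (hp : 1 ≤ p) (hγ : 0 ≤ γ) (K : Finset ℤ)
    (hI : ∫⁻ t in Ioi (0 : ℝ), tail x₀ μ t ^ γ * ENNReal.ofReal (t ^ (p - 1)) ≠ ∞) :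
    ∑ k ∈ K, ((2 : ℝ) ^ k) ^ p * μ.real (shell x₀ k) ^ γ ≤
      4 ^ p * (∫⁻ t in Ioi (0 : ℝ), tail x₀ μ t ^ γ * ENNReal.ofReal (t ^ (p - 1))).toReal := by
  have h := ENNReal.toReal_mono (ENNReal.mul_ne_top (by finiteness) hI)
    (sum_shell_rpow_le_lintegral (μ := μ) (x₀ := x₀) hp hγ K)
  rw [ENNReal.toReal_mul, ENNReal.toReal_sum fun k _ => ENNReal.mul_ne_top ENNReal.ofReal_ne_top
    (ENNReal.rpow_ne_top_of_nonneg hγ (measure_ne_top _ _))] at h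
  refine le_trans (le_of_eq ?_) (h.trans (le_of_eq ?_))
  · refine Finset.sum_congr rfl fun k _ => ?_
    rw [ENNReal.toReal_mul, ENNReal.toReal_ofReal (by positivity), ← ENNReal.toReal_rpow,
      measureReal_def]
  · rw [← ENNReal.toReal_rpow]; simp

/-- On shell k the radius 2^k is at most twice the distance to `x₀`. This converts the deterministic
bound of the inner cost into the cutoff at a multiple of the moment. -/
lemma sum_shell_le_moment {p : ℝ} (hp : 1 ≤ p) (K : Finset ℤ) (hm : momentPow x₀ μ p ≠ ∞) :
    ∑ k ∈ K, ((2 : ℝ) ^ k) ^ p * μ.real (shell x₀ k) ≤ 2 ^ p * (momentPow x₀ μ p).toReal := by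
  have h1 : ∑ k ∈ K, ENNReal.ofReal (((2 : ℝ) ^ k) ^ p) * μ (shell x₀ k) ≤
      2 ^ p * momentPow x₀ μ p := by
    calc _ ≤ ∑ k ∈ K, 2 ^ p * ∫⁻ y in shell x₀ k, edist x₀ y ^ p ∂μ := by
          refine Finset.sum_le_sum fun k _ => ?_
          rw [← setLIntegral_const, ← lintegral_const_mul' _ _ (by finiteness)]
          refine setLIntegral_mono' (measurableSet_shell x₀ k) fun y hy => ?_
          have hy2 : (2 : ℝ) ^ (k - 1) < dist x₀ y := by
            rw [dist_comm]; exact not_le.1 fun h => hy.2 h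
          rw [← ENNReal.mul_rpow_of_nonneg _ _ (by linarith), edist_dist,
            ← ENNReal.ofReal_rpow_of_pos (by positivity)]
          refine ENNReal.rpow_le_rpow ?_ (by linarith)
          rw [show (2 : ℝ≥0∞) = ENNReal.ofReal 2 by simp, ← ENNReal.ofReal_mul two_pos.le]
          refine ENNReal.ofReal_le_ofReal ?_
          calc (2 : ℝ) ^ k = 2 * 2 ^ (k - 1) := by
                rw [← zpow_one_add₀ two_ne_zero]; congr 1; ring
            _ ≤ 2 * dist x₀ y := by gcongr
      _ = 2 ^ p * ∫⁻ y in ⋃ k ∈ K, shell x₀ k, edist x₀ y ^ p ∂μ := by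
          rw [← Finset.mul_sum, lintegral_biUnion_finset
            (fun i _ j _ h => pairwise_disjoint_shell x₀ h) fun k _ => measurableSet_shell x₀ k]
      _ ≤ _ := mul_le_mul_right (setLIntegral_le_lintegral _ _) _
  have h := ENNReal.toReal_mono (ENNReal.mul_ne_top (by finiteness) hm) h1
  rw [ENNReal.toReal_mul, ENNReal.toReal_sum fun k _ => ENNReal.mul_ne_top ENNReal.ofReal_ne_top
    (measure_ne_top _ _)] at h
  refine le_trans (le_of_eq ?_) (h.trans (le_of_eq ?_))
  · refine Finset.sum_congr rfl fun k _ => ?_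
    rw [ENNReal.toReal_mul, ENNReal.toReal_ofReal (by positivity), measureReal_def]
  · rw [← ENNReal.toReal_rpow]; simp

lemma tail_toReal_le {q t : ℝ} (ht : 0 < t) (hw : weakMomentPow x₀ μ q ≠ ∞) :
    (tail x₀ μ t).toReal ≤ (weakMomentPow x₀ μ q).toReal * t ^ (-q) := by
  have h1 : ENNReal.ofReal (t ^ q) * tail x₀ μ t ≤ weakMomentPow x₀ μ q :=
    le_iSup₂ (f := fun t (_ : 0 ≤ t) => ENNReal.ofReal (t ^ q) * tail x₀ μ t) t ht.le
  have h2 := ENNReal.toReal_mono hw h1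
  rw [ENNReal.toReal_mul, ENNReal.toReal_ofReal (by positivity)] at h2
  rw [Real.rpow_neg ht.le, ← div_eq_mul_inv, le_div_iff₀ (by positivity), mul_comm]
  exact h2

lemma tail_le_ofReal {q t : ℝ} (ht : 0 < t) (hw : weakMomentPow x₀ μ q ≠ ∞) :
    tail x₀ μ t ≤ ENNReal.ofReal ((weakMomentPow x₀ μ q).toReal * t ^ (-q)) :=
  (ENNReal.le_ofReal_iff_toReal_le ((tail_le_one x₀ μ t).trans_lt ENNReal.one_lt_top).ne
    (by positivity)).2 (tail_toReal_le ht hw)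

lemma lintegral_Ioi_rpow {a T : ℝ} (ha : a < -1) (hT : 0 < T) :
    ∫⁻ t in Ioi T, ENNReal.ofReal (t ^ a) = ENNReal.ofReal (-T ^ (a + 1) / (a + 1)) := by
  rw [← integral_Ioi_rpow_of_lt ha hT, ofReal_integral_eq_lintegral_ofReal
    (integrableOn_Ioi_rpow_of_lt ha hT)]
  filter_upwards [ae_restrict_mem measurableSet_Ioi] with t ht
  exact Real.rpow_nonneg (hT.trans ht).le _

lemma lintegral_Ioc_rpow {p T : ℝ} (hp : 0 < p) (hT : 0 ≤ T) :
    ∫⁻ t in Ioc 0 T, ENNReal.ofReal (t ^ (p - 1)) = ENNReal.ofReal (T ^ p / p) := by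
  have hint : IntervalIntegrable (fun t : ℝ => t ^ (p - 1)) volume 0 T :=
    intervalIntegral.intervalIntegrable_rpow' (by linarith)
  rw [← ofReal_integral_eq_lintegral_ofReal ((intervalIntegrable_iff_integrableOn_Ioc_of_le hT).1
    hint), ← intervalIntegral.integral_of_le hT, integral_rpow (Or.inl (by linarith))]
  · rw [sub_add_cancel, Real.zero_rpow hp.ne', sub_zero]
  · filter_upwards [ae_restrict_mem measurableSet_Ioc] with t ht
    exact Real.rpow_nonneg ht.1.le _

/-- The contribution of the complement of a ball to the moment, under a weak moment condition. -/
lemma lintegral_compl_closedBall_le {p r T : ℝ} (hp : 1 ≤ p) (hr : 1 < r) (hT : 0 < T)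
    (hw : weakMomentPow x₀ μ (r * p) ≠ ∞) :
    ∫⁻ y in (Metric.closedBall x₀ T)ᶜ, edist x₀ y ^ p ∂μ ≤
      ENNReal.ofReal (r / (r - 1) * (weakMomentPow x₀ μ (r * p)).toReal * T ^ (p - r * p)) := by
  have hp0 : 0 < p := by linarith
  have hrp : 0 < r * p - p := by nlinarith
  set w := (weakMomentPow x₀ μ (r * p)).toReal with hwdef
  have hw0 : 0 ≤ w := ENNReal.toReal_nonneg
  have hB : MeasurableSet (Metric.closedBall x₀ T)ᶜ :=
    Metric.isClosed_closedBall.measurableSet.compl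
  -- Layer cake for the distance set to 0 inside the ball: up to level T the superlevel sets lie
  -- outside the ball of radius T, and beyond T they give the tail at t. The two ranges contribute 1
  -- and 1/(r-1), whose sum is r/(r-1).
  set f : E → ℝ := (Metric.closedBall x₀ T)ᶜ.indicator (fun y => dist y x₀) with hf
  have hf0 : 0 ≤ f := fun y => indicator_nonneg (fun _ _ => dist_nonneg) y
  have hfm : Measurable f := (continuous_id.dist continuous_const).measurable.indicator hB
  have e1 : ∫⁻ y in (Metric.closedBall x₀ T)ᶜ, edist x₀ y ^ p ∂μ =
      ∫⁻ y, ENNReal.ofReal (f y ^ p) ∂μ := by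
    rw [← lintegral_indicator hB]
    refine lintegral_congr fun y => ?_
    by_cases hy : y ∈ (Metric.closedBall x₀ T)ᶜ
    · rw [hf, indicator_of_mem hy, indicator_of_mem hy, edist_dist, dist_comm,
        ENNReal.ofReal_rpow_of_nonneg dist_nonneg hp0.le]
    · rw [hf, indicator_of_notMem hy, indicator_of_notMem hy, Real.zero_rpow hp0.ne',
        ENNReal.ofReal_zero]
  rw [e1, lintegral_rpow_eq_lintegral_meas_lt_mul μ (Filter.Eventually.of_forall hf0)
    hfm.aemeasurable hp0, ← Ioc_union_Ioi_eq_Ioi hT.le,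
    lintegral_union measurableSet_Ioi (Ioc_disjoint_Ioi le_rfl)]
  have hlt1 : ∀ t ∈ Ioc 0 T, μ {y | t < f y} * ENNReal.ofReal (t ^ (p - 1)) ≤
      ENNReal.ofReal (w * T ^ (-(r * p))) * ENNReal.ofReal (t ^ (p - 1)) := by
    intro t ht
    gcongr
    refine le_trans (measure_mono fun y hy => ?_) (tail_le_ofReal hT hw)
    by_contra hy'
    have hy2 : t < f y := hy
    rw [hf, indicator_of_notMem hy'] at hy2
    exact absurd hy2 (not_lt.2 ht.1.le)
  have hlt2 : ∀ t ∈ Ioi T, μ {y | t < f y} * ENNReal.ofReal (t ^ (p - 1)) ≤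
      ENNReal.ofReal w * ENNReal.ofReal (t ^ (p - 1 - r * p)) := by
    intro t ht
    have ht0 : 0 < t := hT.trans ht
    have h3 : μ {y | t < f y} ≤ ENNReal.ofReal (w * t ^ (-(r * p))) := by
      refine le_trans (measure_mono fun y hy => ?_) (tail_le_ofReal ht0 hw)
      have hy2 : t < f y := hy
      by_cases hy' : y ∈ (Metric.closedBall x₀ T)ᶜ
      · rw [hf, indicator_of_mem hy'] at hy2
        exact fun h => absurd (Metric.mem_closedBall.1 h) (not_le.2 hy2)
      · rw [hf, indicator_of_notMem hy'] at hy2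
        exact absurd hy2 (not_lt.2 ht0.le)
    calc _ ≤ ENNReal.ofReal (w * t ^ (-(r * p))) * ENNReal.ofReal (t ^ (p - 1)) := by gcongr
      _ = _ := by
          rw [← ENNReal.ofReal_mul (by positivity), ← ENNReal.ofReal_mul hw0, mul_assoc,
            ← Real.rpow_add ht0]
          ring_nf
  calc _ ≤ ENNReal.ofReal p * ((∫⁻ t in Ioc 0 T, ENNReal.ofReal (w * T ^ (-(r * p))) *
          ENNReal.ofReal (t ^ (p - 1))) +
          ∫⁻ t in Ioi T, ENNReal.ofReal w * ENNReal.ofReal (t ^ (p - 1 - r * p))) := 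
        mul_le_mul_right (add_le_add (setLIntegral_mono' measurableSet_Ioc hlt1)
          (setLIntegral_mono' measurableSet_Ioi hlt2)) _
    _ = _ := by
        rw [lintegral_const_mul' _ _ ENNReal.ofReal_ne_top,
          lintegral_const_mul' _ _ ENNReal.ofReal_ne_top, lintegral_Ioc_rpow hp0 hT.le,
          lintegral_Ioi_rpow (by linarith) hT, ← ENNReal.ofReal_mul (by positivity),
          ← ENNReal.ofReal_mul hw0, ← ENNReal.ofReal_add (by positivity), ← ENNReal.ofReal_mul hp0.le]
        · congr 1
          have e2 : T ^ (-(r * p)) * T ^ p = T ^ (p - r * p) := by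
            rw [← Real.rpow_add hT]; ring_nf
          have e3 : p - 1 - r * p + 1 = p - r * p := by ring
          have hr1 : r - 1 ≠ 0 := by linarith
          have e4 : p - r * p = -(p * (r - 1)) := by ring
          rw [e3, mul_div_assoc', mul_assoc w, e2]
          generalize T ^ (p - r * p) = V
          rw [e4]
          field_simp
          ring
        · refine mul_nonneg hw0 (div_nonneg_of_nonpos ?_ (by linarith))
          have : 0 ≤ T ^ (p - 1 - r * p + 1) := by positivity
          linarith

/-- Layer cake, together with H ≤ H^γ since H ≤ 1. Besides giving finiteness, it shows that the
moment vanishes whenever the tail integral does, which settles the degenerate case. -/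
lemma momentPow_le_lintegral {p γ : ℝ} (hp : 1 ≤ p) (hγ : γ ≤ 1) :
    momentPow x₀ μ p ≤
      ENNReal.ofReal p * ∫⁻ t in Ioi (0 : ℝ), tail x₀ μ t ^ γ * ENNReal.ofReal (t ^ (p - 1)) := by
  have hp0 : 0 < p := by linarith
  have e1 : momentPow x₀ μ p = ∫⁻ y, ENNReal.ofReal (dist y x₀ ^ p) ∂μ := by
    refine lintegral_congr fun y => ?_
    rw [edist_dist, dist_comm, ENNReal.ofReal_rpow_of_nonneg dist_nonneg hp0.le]
  have hm : Measurable fun y : E => dist y x₀ := (continuous_id.dist continuous_const).measurable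
  rw [e1, lintegral_rpow_eq_lintegral_meas_lt_mul μ (Filter.Eventually.of_forall fun _ =>
    dist_nonneg) hm.aemeasurable hp0]
  gcongr with t
  have h2 : {a | t < dist a x₀} = (Metric.closedBall x₀ t)ᶜ := by
    ext y; simp
  calc μ {a | t < dist a x₀} = tail x₀ μ t ^ (1 : ℝ) := by rw [h2, ENNReal.rpow_one]; rfl
    _ ≤ tail x₀ μ t ^ γ := ENNReal.rpow_le_rpow_of_exponent_ge (tail_le_one _ _ _) hγ

/-- Below 1 use H ≤ 1; above 1 the weak moment makes the integrand at most a multiple of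
t^(p-1-rpγ), which is integrable because rγ > 1. -/
lemma lintegral_tail_rpow_lt_top {p r γ : ℝ} (hp : 1 ≤ p) (hγ : 0 ≤ γ) (hrγ : 1 < r * γ)
    (hw : weakMomentPow x₀ μ (r * p) ≠ ∞) :
    ∫⁻ t in Ioi (0 : ℝ), tail x₀ μ t ^ γ * ENNReal.ofReal (t ^ (p - 1)) < ∞ := by
  have hp0 : 0 < p := by linarith
  set w := (weakMomentPow x₀ μ (r * p)).toReal with hwdef
  have hw0 : 0 ≤ w := ENNReal.toReal_nonneg
  rw [← Ioc_union_Ioi_eq_Ioi zero_le_one, lintegral_union measurableSet_Ioi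
    (Ioc_disjoint_Ioi le_rfl)]
  refine ENNReal.add_lt_top.2 ⟨?_, ?_⟩
  · calc _ ≤ ∫⁻ t in Ioc (0 : ℝ) 1, ENNReal.ofReal (t ^ (p - 1)) := by
          refine lintegral_mono fun t => ?_
          exact mul_le_of_le_one_left' (ENNReal.rpow_le_one (tail_le_one _ _ _) hγ)
      _ < ∞ := by rw [lintegral_Ioc_rpow hp0 zero_le_one]; exact ENNReal.ofReal_lt_top
  · calc _ ≤ ∫⁻ t in Ioi (1 : ℝ), ENNReal.ofReal (w ^ γ) *
          ENNReal.ofReal (t ^ (-(r * p) * γ + (p - 1))) := by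
          refine setLIntegral_mono' measurableSet_Ioi fun t ht => ?_
          have ht0 : (0 : ℝ) < t := zero_lt_one.trans ht
          calc _ ≤ ENNReal.ofReal (w * t ^ (-(r * p))) ^ γ * ENNReal.ofReal (t ^ (p - 1)) := by
                gcongr
                exact tail_le_ofReal ht0 hw
            _ = _ := by
                rw [ENNReal.ofReal_rpow_of_nonneg (by positivity) hγ,
                  Real.mul_rpow hw0 (by positivity), ← Real.rpow_mul ht0.le,
                  ENNReal.ofReal_mul (by positivity), mul_assoc,
                  ← ENNReal.ofReal_mul (by positivity), ← Real.rpow_add ht0]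
      _ < ∞ := by
          rw [lintegral_const_mul' _ _ ENNReal.ofReal_ne_top, lintegral_Ioi_rpow (by nlinarith)
            zero_lt_one]
          exact ENNReal.mul_lt_top ENNReal.ofReal_lt_top ENNReal.ofReal_lt_top

/-- Integrability of the tail yields a weak moment. -/
lemma weakMomentPow_le_lintegral {p γ : ℝ} (hp : 1 ≤ p) (hγ : 0 < γ) :
    weakMomentPow x₀ μ (1 / γ * p) ≤ (ENNReal.ofReal p *
      ∫⁻ t in Ioi (0 : ℝ), tail x₀ μ t ^ γ * ENNReal.ofReal (t ^ (p - 1))) ^ (1 / γ) := by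
  have hp0 : 0 < p := by linarith
  refine iSup₂_le fun t ht => ?_
  have h1 : ENNReal.ofReal (t ^ p) * tail x₀ μ t ^ γ ≤ ENNReal.ofReal p *
      ∫⁻ t in Ioi (0 : ℝ), tail x₀ μ t ^ γ * ENNReal.ofReal (t ^ (p - 1)) := by
    calc ENNReal.ofReal (t ^ p) * tail x₀ μ t ^ γ
        = ENNReal.ofReal p * ∫⁻ s in Ioc 0 t, tail x₀ μ t ^ γ * ENNReal.ofReal (s ^ (p - 1)) := by
          rw [lintegral_const_mul _ (by fun_prop), lintegral_Ioc_rpow hp0 ht, mul_left_comm,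
            ← ENNReal.ofReal_mul hp0.le, mul_div_cancel₀ _ hp0.ne', mul_comm]
      -- The tail is nonincreasing, so its value at the endpoint t is a lower bound on the whole
      -- interval.
      _ ≤ ENNReal.ofReal p * ∫⁻ s in Ioc 0 t, tail x₀ μ s ^ γ * ENNReal.ofReal (s ^ (p - 1)) := by
          refine mul_le_mul_right (setLIntegral_mono' measurableSet_Ioc fun s hs => ?_) _
          gcongr
          exact antitone_tail x₀ μ hs.2
      _ ≤ _ := mul_le_mul_right (lintegral_mono_set fun s hs => hs.1) _
  calc ENNReal.ofReal (t ^ (1 / γ * p)) * tail x₀ μ t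
      = (ENNReal.ofReal (t ^ p) * tail x₀ μ t ^ γ) ^ (1 / γ) := by
        rw [ENNReal.mul_rpow_of_nonneg _ _ (by positivity), ← ENNReal.rpow_mul,
          mul_one_div_cancel hγ.ne', ENNReal.rpow_one,
          ENNReal.ofReal_rpow_of_nonneg (by positivity) (by positivity), ← Real.rpow_mul ht,
          mul_comm p]
    _ ≤ _ := ENNReal.rpow_le_rpow h1 (by positivity)

end Tails

end EmpiricalWasserstein

/-! ### Shell sums under a weak moment, and truncation -/

namespace EmpiricalWasserstein

lemma exists_zpow_rpow_le_and_le {p y : ℝ} (hp : 0 < p) (hy : 0 < y) :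
    ∃ k : ℤ, ((2 : ℝ) ^ k) ^ p ≤ y ∧ y ≤ 2 ^ p * ((2 : ℝ) ^ k) ^ p := by
  obtain ⟨k, hk1, hk2⟩ := exists_mem_Ico_zpow (Real.rpow_pos_of_pos hy (1 / p)) one_lt_two
  have e : (y ^ (1 / p)) ^ p = y := by
    rw [← Real.rpow_mul hy.le, one_div_mul_cancel hp.ne', Real.rpow_one]
  refine ⟨k, ?_, ?_⟩
  · calc _ ≤ (y ^ (1 / p)) ^ p := by gcongr
      _ = y := e
  · calc y = (y ^ (1 / p)) ^ p := e.symm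
      _ ≤ ((2 : ℝ) ^ (k + 1)) ^ p := by gcongr
      _ = _ := by
        rw [zpow_add_one₀ two_ne_zero, mul_comm, Real.mul_rpow two_pos.le (by positivity)]

/-- The constant in the bound for a dyadic sum over the shells below a truncation level. -/
noncomputable def geomConst (p r γ : ℝ) : ℝ :=
  2 ^ (r * p * γ) * (2 ^ (p * (1 - r * γ)) / (2 ^ (p * (1 - r * γ)) - 1))

lemma geomConst_pos {p r γ : ℝ} (hp : 0 < p) (h : r * γ < 1) : 0 < geomConst p r γ := by
  have h1 : 1 < (2 : ℝ) ^ (p * (1 - r * γ)) :=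
    Real.one_lt_rpow one_lt_two (mul_pos hp (by linarith))
  have h2 : 0 < (2 : ℝ) ^ (p * (1 - r * γ)) - 1 := by linarith
  unfold geomConst
  positivity

/-- The constant in the bound for the contribution of the points outside a ball. -/
noncomputable def truncConst (p r : ℝ) : ℝ :=
  2 ^ (r * p) + 4 * (2 ^ (p - 1) * (r / (r - 1)) * 2 ^ (p * (r - 1)))

lemma truncConst_pos {p r : ℝ} (hr : 1 < r) : 0 < truncConst p r := by
  have : 0 < r - 1 := by linarith
  unfold truncConst
  positivity

section ShellSums

variable {E : Type*} [MetricSpace E] [MeasurableSpace E] [BorelSpace E] {μ : Measure E}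
  [IsProbabilityMeasure μ] {x₀ : E}

/-- The weak moment bounds the term of shell k by a multiple of 2^(kθ) with θ = p(1 - rγ) > 0. The
largest shell therefore dominates, and its radius is limited by 2^(k₀p) ≤ N x. Measuring the weak
moment by `Q` in units of x^r N^(r-1) makes the powers of x and N collapse. -/
lemma sum_shell_rpow_le_geomConst {p r γ x N Q : ℝ} (hp : 1 ≤ p) (hγ : 0 < γ)
    (hrγ : r * γ < 1) (hx : 0 < x) (hN : 0 < N) (hQ : 0 ≤ Q)
    (hw : weakMomentPow x₀ μ (r * p) ≠ ∞)
    (hwQ : (weakMomentPow x₀ μ (r * p)).toReal ≤ Q * (x ^ r * N ^ (r - 1))) (a : ℤ) {k₀ : ℤ}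
    (hk₀ : ((2 : ℝ) ^ k₀) ^ p ≤ N * x) :
    ∑ k ∈ Finset.Icc a k₀, ((2 : ℝ) ^ k) ^ p * μ.real (shell x₀ k) ^ γ ≤
      geomConst p r γ * (x * Q ^ γ * N ^ (1 - γ)) := by
  have hp0 : 0 < p := by linarith
  set θ := p * (1 - r * γ) with hθ
  have hθ0 : 0 < θ := mul_pos hp0 (by linarith)
  have hterm : ∀ k : ℤ, ((2 : ℝ) ^ k) ^ p * μ.real (shell x₀ k) ^ γ ≤
      2 ^ (r * p * γ) * Q ^ γ * (x ^ r * N ^ (r - 1)) ^ γ * ((2 : ℝ) ^ k) ^ θ := by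
    intro k
    have hk : (0 : ℝ) < 2 ^ k := by positivity
    have h1 : μ.real (shell x₀ k) ≤
        2 ^ (r * p) * Q * (x ^ r * N ^ (r - 1)) * ((2 : ℝ) ^ k) ^ (-(r * p)) := by
      have e : ((2 : ℝ) ^ (k - 1)) ^ (-(r * p)) = 2 ^ (r * p) * ((2 : ℝ) ^ k) ^ (-(r * p)) := by
        rw [zpow_sub_one₀ two_ne_zero, Real.mul_rpow hk.le (by positivity),
          Real.inv_rpow two_pos.le, Real.rpow_neg two_pos.le, inv_inv, mul_comm]
      calc _ ≤ _ := measureReal_shell_le_tail k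
        _ ≤ _ := tail_toReal_le (by positivity) hw
        _ ≤ Q * (x ^ r * N ^ (r - 1)) * ((2 : ℝ) ^ (k - 1)) ^ (-(r * p)) := by gcongr
        _ = _ := by rw [e]; ring
    calc _ ≤ ((2 : ℝ) ^ k) ^ p *
          (2 ^ (r * p) * Q * (x ^ r * N ^ (r - 1)) * ((2 : ℝ) ^ k) ^ (-(r * p))) ^ γ := by gcongr
      _ = 2 ^ (r * p * γ) * Q ^ γ * (x ^ r * N ^ (r - 1)) ^ γ *
          (((2 : ℝ) ^ k) ^ p * ((2 : ℝ) ^ k) ^ (-(r * p) * γ)) := by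
          rw [Real.mul_rpow (by positivity) (by positivity),
            Real.mul_rpow (by positivity) (by positivity), Real.mul_rpow (by positivity) hQ,
            ← Real.rpow_mul two_pos.le, ← Real.rpow_mul hk.le]
          ring
      _ = _ := by
          rw [← Real.rpow_add hk]
          congr 2; rw [hθ]; ring
  have hT : ((2 : ℝ) ^ k₀) ^ θ ≤ (N * x) ^ (1 - r * γ) := by
    rw [hθ, Real.rpow_mul (by positivity)]
    exact Real.rpow_le_rpow (by positivity) hk₀ (by linarith)
  have h2 : 0 < (2 : ℝ) ^ θ - 1 := by linarith [Real.one_lt_rpow one_lt_two hθ0]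
  have e3 : (x ^ r * N ^ (r - 1)) ^ γ * (N * x) ^ (1 - r * γ) = x * N ^ (1 - γ) := by
    have ex : x ^ (r * γ) * x ^ (1 - r * γ) = x := by
      rw [← Real.rpow_add hx]; simp
    have en : N ^ ((r - 1) * γ) * N ^ (1 - r * γ) = N ^ (1 - γ) := by
      rw [← Real.rpow_add hN]; ring_nf
    rw [Real.mul_rpow (by positivity) (by positivity), Real.mul_rpow hN.le hx.le,
      ← Real.rpow_mul hx.le, ← Real.rpow_mul hN.le]
    calc _ = (x ^ (r * γ) * x ^ (1 - r * γ)) * (N ^ ((r - 1) * γ) * N ^ (1 - r * γ)) := by ring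
      _ = _ := by rw [ex, en]
  calc _ ≤ ∑ k ∈ Finset.Icc a k₀,
        2 ^ (r * p * γ) * Q ^ γ * (x ^ r * N ^ (r - 1)) ^ γ * ((2 : ℝ) ^ k) ^ θ :=
        Finset.sum_le_sum fun k _ => hterm k
    _ ≤ 2 ^ (r * p * γ) * Q ^ γ * (x ^ r * N ^ (r - 1)) ^ γ *
        (2 ^ θ / (2 ^ θ - 1) * (N * x) ^ (1 - r * γ)) := by
        rw [← Finset.mul_sum]
        gcongr
        exact (sum_zpow_rpow_le hθ0 a k₀).trans (by gcongr)
    _ = geomConst p r γ * Q ^ γ * ((x ^ r * N ^ (r - 1)) ^ γ * (N * x) ^ (1 - r * γ)) := by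
        rw [geomConst]; ring
    _ = _ := by rw [e3]; ring

lemma sum_shell_fluctuation_eq {N q : ℝ} (hN : 0 < N) (p : ℝ) (K : Finset ℤ) :
    ∑ k ∈ K, ((2 : ℝ) ^ k) ^ p / N *
        ((N * μ.real (shell x₀ k)) ^ (1 / 2 : ℝ) + (N * μ.real (shell x₀ k)) ^ (1 / q)) =
      N ^ (-(1 / 2) : ℝ) * ∑ k ∈ K, ((2 : ℝ) ^ k) ^ p * μ.real (shell x₀ k) ^ (1 / 2 : ℝ) +
      N ^ (1 / q - 1) * ∑ k ∈ K, ((2 : ℝ) ^ k) ^ p * μ.real (shell x₀ k) ^ (1 / q) := by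
  rw [Finset.mul_sum, Finset.mul_sum, ← Finset.sum_add_distrib]
  refine Finset.sum_congr rfl fun k _ => ?_
  have hh : 0 ≤ μ.real (shell x₀ k) := measureReal_nonneg
  have e1 : N ^ (-(1 / 2) : ℝ) = N ^ (1 / 2 : ℝ) / N := by
    rw [← Real.rpow_sub_one hN.ne']; norm_num
  rw [Real.mul_rpow hN.le hh, Real.mul_rpow hN.le hh, e1, Real.rpow_sub_one hN.ne']
  ring

end ShellSums

section Truncation

variable {E Ω : Type*} [MetricSpace E] [PolishSpace E] [MeasurableSpace E] [BorelSpace E]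
  [MeasurableSpace Ω] {P : Measure Ω} [IsProbabilityMeasure P] {μ : Measure E}
  [IsProbabilityMeasure μ] {n : ℕ} {X : Fin n → Ω → E} {S : Set E} {x₀ : E} {p α β : ℝ}

/-- With 2^(k₀p) of order n x, both n H(2^k₀) and the mean transport cost from outside the ball,
relative to x, are multiples of `Q`. The radii are fixed before `q` and `b`, which leaves each case
free to choose how the remaining sums are bounded. -/
lemma exists_devProb_le_add_truncConst (hn : 0 < n) (hX : ∀ i, Measurable (X i))
    (hind : iIndepFun X P) (hlaw : ∀ i, P.map (X i) = μ) (hS : μ S = 1) (hp : 1 ≤ p)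
    (hα : 2 * p < α) (hβ : 0 < β) (hcov : HasCoveringDim S x₀ α β) {r x Q : ℝ} (hr : 1 < r)
    (hx : 0 < x) (hQ : 0 ≤ Q) (hw : weakMomentPow x₀ μ (r * p) ≠ ∞)
    (hwQ : (weakMomentPow x₀ μ (r * p)).toReal ≤ Q * (x ^ r * (n : ℝ) ^ (r - 1))) :
    ∃ a k₀ : ℤ, ((2 : ℝ) ^ k₀) ^ p ≤ n * x ∧ ∀ q b : ℝ, 1 ≤ q → 0 < b →
      ∑ k ∈ Finset.Icc a k₀, ((2 : ℝ) ^ k) ^ p * μ.real (shell x₀ k) ^ ((α - p) / α) ≤ b →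
      devProb P X μ p x ≤
        Real.exp 2 *
            Real.exp (-(n * innerRate p α (β * 2 ^ α) * (x / (4 * 8 ^ p) / b) ^ (α / p))) *
          (if x / (4 * 8 ^ p) < 2 * ∑ k ∈ Finset.Icc a k₀, ((2 : ℝ) ^ k) ^ p * μ.real (shell x₀ k)
            then 1 else 0) +
        (4 * Real.exp 2 * q ^ q + 1) *
          ((n : ℝ) ^ (-(1 / 2) : ℝ) * ∑ k ∈ Finset.Icc a k₀,
              ((2 : ℝ) ^ k) ^ p * μ.real (shell x₀ k) ^ (1 / 2 : ℝ) +
            (n : ℝ) ^ (1 / q - 1) * ∑ k ∈ Finset.Icc a k₀,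
              ((2 : ℝ) ^ k) ^ p * μ.real (shell x₀ k) ^ (1 / q)) ^ q / (x / (2 * 2 ^ p)) ^ q +
        truncConst p r * Q := by
  have hp0 : 0 < p := by linarith
  have hN : (0 : ℝ) < n := by exact_mod_cast hn
  have hr1 : 0 < r - 1 := by linarith
  obtain ⟨k₀, hk1, hk2⟩ := exists_zpow_rpow_le_and_le hp0 (mul_pos hN hx)
  -- The shells will start at index a+1, whose inner radius is 2^a, so this choice makes the small
  -- ball fit its quarter of the budget.
  obtain ⟨a, ha, -⟩ := exists_zpow_rpow_le_and_le hp0 (show 0 < x / 4 / 2 ^ p by positivity)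
  have ha' : 2 ^ p * ((2 : ℝ) ^ (a + 1 - 1)) ^ p ≤ x / 4 := by
    rw [add_sub_cancel_right, mul_comm]
    exact (le_div_iff₀ (by positivity)).1 ha
  refine ⟨a + 1, k₀, hk1, fun q b hq hb0 hb => ?_⟩
  have hT : (0 : ℝ) < 2 ^ k₀ := by positivity
  set w := (weakMomentPow x₀ μ (r * p)).toReal with hwdef
  have hT' : ((2 : ℝ) ^ k₀) ^ p ≥ n * x / 2 ^ p := by
    rw [ge_iff_le, div_le_iff₀ (by positivity), mul_comm _ ((2 : ℝ) ^ p)]; exact hk2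
  have hy : 0 < n * x / (2 : ℝ) ^ p := by positivity
  have e1 : x ^ r * (n : ℝ) ^ (r - 1) * (n * x / 2 ^ p) ^ (-r) * n = 2 ^ (r * p) := by
    rw [Real.rpow_neg hy.le, Real.div_rpow (by positivity) (by positivity),
      Real.mul_rpow hN.le hx.le, Real.rpow_sub_one hN.ne', ← Real.rpow_mul two_pos.le, mul_comm p r]
    have : (n : ℝ) ^ r ≠ 0 := by positivity
    have : x ^ r ≠ 0 := by positivity
    field_simp
  have htailn : n * (tail x₀ μ (2 ^ k₀)).toReal ≤ 2 ^ (r * p) * Q := by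
    have h1 : ((2 : ℝ) ^ k₀) ^ (-(r * p)) ≤ (n * x / 2 ^ p) ^ (-r) := by
      rw [show -(r * p) = p * -r by ring, Real.rpow_mul hT.le]
      exact Real.rpow_le_rpow_of_nonpos hy hT' (by linarith)
    calc _ ≤ n * (Q * (x ^ r * (n : ℝ) ^ (r - 1)) * (n * x / 2 ^ p) ^ (-r)) := by
          gcongr
          exact (tail_toReal_le hT hw).trans (by gcongr)
      _ = Q * (x ^ r * (n : ℝ) ^ (r - 1) * (n * x / 2 ^ p) ^ (-r) * n) := by ring
      _ = _ := by rw [e1, mul_comm]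
  set C := 2 ^ (p - 1) * (r / (r - 1)) * 2 ^ (p * (r - 1)) with hC
  have hC0 : 0 < C := by positivity
  have hmom : 2 ^ (p - 1) * (r / (r - 1) * w * ((2 : ℝ) ^ k₀) ^ (p - r * p)) ≤ C * Q * x := by
    have h1 : ((2 : ℝ) ^ k₀) ^ (p - r * p) ≤ (n * x / 2 ^ p) ^ (-(r - 1)) := by
      rw [show p - r * p = p * -(r - 1) by ring, Real.rpow_mul hT.le]
      exact Real.rpow_le_rpow_of_nonpos hy hT' (by linarith)
    have e2 : x ^ r * (n : ℝ) ^ (r - 1) * (n * x / 2 ^ p) ^ (-(r - 1)) = 2 ^ (p * (r - 1)) * x := by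
      rw [Real.rpow_neg hy.le, Real.div_rpow (by positivity) (by positivity),
        Real.mul_rpow hN.le hx.le, Real.rpow_sub_one hx.ne', ← Real.rpow_mul two_pos.le]
      have : (n : ℝ) ^ (r - 1) ≠ 0 := by positivity
      have : x ^ r ≠ 0 := by positivity
      field_simp
    calc _ ≤ 2 ^ (p - 1) * (r / (r - 1) * (Q * (x ^ r * (n : ℝ) ^ (r - 1))) *
          (n * x / 2 ^ p) ^ (-(r - 1))) := by gcongr
      _ = 2 ^ (p - 1) * (r / (r - 1)) * Q *
          (x ^ r * (n : ℝ) ^ (r - 1) * (n * x / 2 ^ p) ^ (-(r - 1))) := by ring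
      _ = _ := by rw [e2, hC]; ring
  have htrunc : truncConst p r = 2 ^ (r * p) + 4 * C := rfl
  rcases le_or_gt (C * Q) (1 / 4) with hsmall | hlarge
  · have htail : 2 ^ (p - 1) * ∫⁻ y in (Metric.closedBall x₀ (2 ^ k₀))ᶜ, edist x₀ y ^ p ∂μ ≤
        ENNReal.ofReal (x / 4) := by
      have e0 : (2 : ℝ≥0∞) ^ (p - 1) = ENNReal.ofReal ((2 : ℝ) ^ (p - 1)) := by
        rw [← ENNReal.ofReal_rpow_of_pos two_pos]; simp
      calc _ ≤ (2 : ℝ≥0∞) ^ (p - 1) *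
            ENNReal.ofReal (r / (r - 1) * w * ((2 : ℝ) ^ k₀) ^ (p - r * p)) :=
            mul_le_mul_right (lintegral_compl_closedBall_le hp hr hT hw) _
        _ ≤ _ := by
            rw [e0, ← ENNReal.ofReal_mul (by positivity)]
            refine ENNReal.ofReal_le_ofReal (hmom.trans ?_)
            nlinarith
    have h := devProb_le hn hX hind hlaw hS hp hα hβ hcov hq hx hb0 hb ha' htail
    rw [sum_shell_fluctuation_eq hN] at h
    refine h.trans (add_le_add_right (htailn.trans ?_) _)
    rw [htrunc]
    gcongr
    linarith
  -- If the outer mass does not fit its quarter, `Q` is bounded below; the summand 4C in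
  -- `truncConst` makes the bound exceed 1.
  · have h1 : devProb P X μ p x ≤ 1 := measureReal_le_one
    have h2 : 1 ≤ truncConst p r * Q := by
      rw [htrunc, add_mul]
      have : 0 ≤ (2 : ℝ) ^ (r * p) * Q := by positivity
      linarith
    have hq0 : 0 < q := by linarith
    refine (h1.trans h2).trans (le_add_of_nonneg_left (add_nonneg ?_ ?_))
    · split_ifs <;> positivity
    · have : ∀ γ : ℝ, 0 ≤ ∑ k ∈ Finset.Icc (a + 1) k₀,
          ((2 : ℝ) ^ k) ^ p * μ.real (shell x₀ k) ^ γ := fun γ =>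
        Finset.sum_nonneg fun k _ => by positivity
      have h3 := this (1 / 2)
      have h4 := this (1 / q)
      positivity

end Truncation

end EmpiricalWasserstein

/-! ### The exponential term and the shell fluctuations -/

namespace EmpiricalWasserstein

/-- The rate in the exponential term of the deviation bounds. -/
noncomputable def expRate (p α β : ℝ) : ℝ :=
  innerRate p α (β * 2 ^ α) * (1 / (4 * 8 ^ p * 4 ^ p)) ^ (α / p)

lemma expRate_pos {p α β : ℝ} (hα : 2 * p < α) (hβ : 0 < β) : 0 < expRate p α β := by
  have := innerRate_pos hα (B := β * 2 ^ α) (by positivity)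
  unfold expRate
  positivity

/-- The threshold, in units of the moment, above which the exponential term vanishes. -/
noncomputable def expCutoff (p : ℝ) : ℝ := 8 * 8 ^ p * 2 ^ p

lemma expCutoff_pos (p : ℝ) : 0 < expCutoff p := by unfold expCutoff; positivity

lemma exp_neg_le_rpow_div {s z : ℝ} (hs : 0 < s) (hz : 0 < z) : Real.exp (-z) ≤ s ^ s / z ^ s := by
  rw [Real.exp_neg, le_div_iff₀ (by positivity), inv_mul_le_iff₀ (Real.exp_pos z), mul_comm]
  exact rpow_le_rpow_self_mul_exp hs hz.le

section ExpTerm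

variable {E : Type*} [MetricSpace E] [MeasurableSpace E] [BorelSpace E] {μ : Measure E}
  [IsProbabilityMeasure μ] {x₀ : E} {p α : ℝ}

lemma exponent_mem (hp : 1 ≤ p) (hα : 2 * p < α) : 1 / 2 < (α - p) / α ∧ (α - p) / α < 1 := by
  have hα0 : 0 < α := by linarith
  exact ⟨by rw [lt_div_iff₀ hα0]; linarith, by rw [div_lt_one hα0]; linarith⟩

lemma momentPow_le_tailIntegral (hp : 1 ≤ p) (hα : 2 * p < α) :
    momentPow x₀ μ p ≤ ENNReal.ofReal p * tailIntegral x₀ μ α p :=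
  momentPow_le_lintegral hp (exponent_mem hp hα).2.le

lemma momentPow_lt_top_of_tailIntegral_lt_top (hp : 1 ≤ p) (hα : 2 * p < α)
    (hI : tailIntegral x₀ μ α p < ∞) : momentPow x₀ μ p < ∞ :=
  (momentPow_le_tailIntegral hp hα).trans_lt (ENNReal.mul_lt_top ENNReal.ofReal_lt_top hI)

lemma tailIntegral_two_mul (hp : 1 ≤ p) : tailIntegral x₀ μ (2 * p) p =
    ∫⁻ t in Ioi (0 : ℝ), tail x₀ μ t ^ (1 / 2 : ℝ) * ENNReal.ofReal (t ^ (p - 1)) := by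
  rw [tailIntegral, show (2 * p - p) / (2 * p) = 1 / 2 by field_simp; ring]

lemma tailIntegral_le_tailIntegral_two_mul (hp : 1 ≤ p) (hα : 2 * p < α) :
    tailIntegral x₀ μ α p ≤ tailIntegral x₀ μ (2 * p) p := by
  rw [tailIntegral_two_mul hp, tailIntegral]
  refine lintegral_mono fun t => ?_
  dsimp only
  gcongr ?_ * _
  exact ENNReal.rpow_le_rpow_of_exponent_ge (tail_le_one _ _ _) (exponent_mem hp hα).1.le

lemma expTerm_nonneg (c κ : ℝ) (n : ℕ) (x : ℝ) : 0 ≤ expTerm x₀ μ p α c κ n x := by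
  unfold expTerm
  split_ifs <;> positivity

/-- The exponential term decays at least polynomially. -/
lemma expTerm_le_rpow (hp : 1 ≤ p) (hα : 2 * p < α) (hI : tailIntegral x₀ μ α p < ∞) {c κ x : ℝ}
    {n : ℕ} (hn : 0 < n) (hc : 0 < c) (hx : 0 < x) :
    expTerm x₀ μ p α c κ n x ≤ Real.exp 2 * (p / (α - p) / c) ^ (p / (α - p)) *
      ((tailIntegral x₀ μ α p).toReal ^ (α / (α - p)) /
        (x ^ (α / (α - p)) * (n : ℝ) ^ (p / (α - p)))) := by
  have hN : (0 : ℝ) < n := by exact_mod_cast hn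
  have hαp : 0 < α - p := by linarith
  set s := p / (α - p) with hs
  have hs0 : 0 < s := by positivity
  set I := (tailIntegral x₀ μ α p).toReal with hIdef
  have hI0 : 0 ≤ I := ENNReal.toReal_nonneg
  rcases hI0.eq_or_lt with h0 | h0
  · have hm : (momentPow x₀ μ p).toReal = 0 := by
      have h1 : tailIntegral x₀ μ α p = 0 :=
        ((ENNReal.toReal_eq_zero_iff _).1 h0.symm).resolve_right hI.ne
      have h2 := momentPow_le_tailIntegral (x₀ := x₀) (μ := μ) hp hα
      rw [h1, mul_zero, nonpos_iff_eq_zero] at h2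
      rw [h2, ENNReal.toReal_zero]
    rw [expTerm, hm, mul_zero, if_neg (not_le.2 hx), mul_zero]
    positivity
  · set z := n * c * (x / I) ^ (α / p) with hz
    have hz0 : 0 < z := by positivity
    have hzs : z ^ s = c ^ s * (x ^ (α / (α - p)) * (n : ℝ) ^ s) / I ^ (α / (α - p)) := by
      have hp0 : p ≠ 0 := by positivity
      rw [hz, Real.mul_rpow (by positivity) (by positivity), Real.mul_rpow hN.le hc.le,
        ← Real.rpow_mul (by positivity), show α / p * s = α / (α - p) by rw [hs]; field_simp,
        Real.div_rpow hx.le hI0]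
      ring
    have h2 := exp_neg_le_rpow_div hs0 hz0
    calc expTerm x₀ μ p α c κ n x ≤ Real.exp 2 * Real.exp (-z) * 1 := by
          rw [expTerm]
          gcongr
          split_ifs <;> norm_num
      _ ≤ Real.exp 2 * (s ^ s / z ^ s) := by rw [mul_one]; gcongr
      _ = _ := by
          rw [hzs, Real.div_rpow hs0.le hc.le]
          field_simp

/-- The bound for the inner part is dominated by the exponential term. -/
lemma exists_innerTerm_le_expTerm (hp : 1 ≤ p) (hα : 2 * p < α)
    (hI : tailIntegral x₀ μ α p < ∞) (β : ℝ) (K : Finset ℤ) {x : ℝ} (n : ℕ) (hx : 0 < x) :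
    ∃ b, 0 < b ∧ ∑ k ∈ K, ((2 : ℝ) ^ k) ^ p * μ.real (shell x₀ k) ^ ((α - p) / α) ≤ b ∧
      Real.exp 2 *
          Real.exp (-(n * innerRate p α (β * 2 ^ α) * (x / (4 * 8 ^ p) / b) ^ (α / p))) *
        (if x / (4 * 8 ^ p) < 2 * ∑ k ∈ K, ((2 : ℝ) ^ k) ^ p * μ.real (shell x₀ k)
          then 1 else 0) ≤
      expTerm x₀ μ p α (expRate p α β) (expCutoff p) n x := by
  have hη := exponent_mem hp hα
  have hα0 : 0 < α := by linarith
  have hm := momentPow_lt_top_of_tailIntegral_lt_top hp hα hI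
  have hsum := sum_shell_rpow_le_toReal (μ := μ) (x₀ := x₀) hp (γ := (α - p) / α) (by linarith) K
    hI.ne
  have hmom := sum_shell_le_moment (μ := μ) (x₀ := x₀) hp K hm.ne
  change _ ≤ 4 ^ p * (tailIntegral x₀ μ α p).toReal at hsum
  set I := (tailIntegral x₀ μ α p).toReal with hIdef
  have hI0 : 0 ≤ I := ENNReal.toReal_nonneg
  have hcut : x / (4 * 8 ^ p) < 2 * ∑ k ∈ K, ((2 : ℝ) ^ k) ^ p * μ.real (shell x₀ k) →
      x ≤ expCutoff p * (momentPow x₀ μ p).toReal := by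
    intro h
    rw [div_lt_iff₀ (by positivity)] at h
    calc x ≤ _ := h.le
      _ ≤ 2 * (2 ^ p * (momentPow x₀ μ p).toReal) * (4 * 8 ^ p) := by gcongr
      _ = _ := by rw [expCutoff]; ring
  rcases hI0.eq_or_lt with h0 | h0
  · refine ⟨1, one_pos, hsum.trans (by rw [← h0]; simp), ?_⟩
    have hm0 : (momentPow x₀ μ p).toReal = 0 := by
      have h1 : tailIntegral x₀ μ α p = 0 :=
        ((ENNReal.toReal_eq_zero_iff _).1 h0.symm).resolve_right hI.ne
      have h2 := momentPow_le_tailIntegral (x₀ := x₀) (μ := μ) hp hα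
      rw [h1, mul_zero, nonpos_iff_eq_zero] at h2
      rw [h2, ENNReal.toReal_zero]
    rw [if_neg, mul_zero]
    · exact expTerm_nonneg _ _ _ _
    · intro h
      have := hcut h
      rw [hm0, mul_zero] at this
      linarith
  · refine ⟨4 ^ p * I, by positivity, hsum, ?_⟩
    rw [expTerm, ← hIdef]
    have e : n * innerRate p α (β * 2 ^ α) * (x / (4 * 8 ^ p) / (4 ^ p * I)) ^ (α / p) =
        n * expRate p α β * (x / I) ^ (α / p) := by
      rw [expRate, show x / (4 * 8 ^ p) / (4 ^ p * I) = 1 / (4 * 8 ^ p * 4 ^ p) * (x / I) by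
        field_simp, Real.mul_rpow (by positivity) (by positivity)]
      ring
    rw [e]
    refine mul_le_mul_of_nonneg_left ?_ (by positivity)
    split_ifs with h1 h2 h2
    · exact le_rfl
    · exact absurd (hcut h1) h2
    · exact zero_le_one
    · exact le_rfl

end ExpTerm

/-- The constant in front of the fluctuations of the numbers of points in the shells. -/
noncomputable def fluctConst (p q : ℝ) : ℝ := (4 * Real.exp 2 * q ^ q + 1) * (2 * 2 ^ p) ^ q

lemma fluctConst_pos {p q : ℝ} (hq : 0 < q) : 0 < fluctConst p q := by
  unfold fluctConst; positivity

lemma fluct_eq {p q A x : ℝ} (hA : 0 ≤ A) (hx : 0 < x) :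
    (4 * Real.exp 2 * q ^ q + 1) * A ^ q / (x / (2 * 2 ^ p)) ^ q =
      fluctConst p q * (A / x) ^ q := by
  rw [fluctConst, Real.div_rpow hx.le (by positivity), Real.div_rpow hA hx.le]
  field_simp

lemma rpow_add_le_two_rpow_mul {u v q : ℝ} (hu : 0 ≤ u) (hv : 0 ≤ v) (hq : 1 ≤ q) :
    (u + v) ^ q ≤ 2 ^ (q - 1) * (u ^ q + v ^ q) := by
  have h := NNReal.rpow_add_le_mul_rpow_add_rpow ⟨u, hu⟩ ⟨v, hv⟩ hq
  exact_mod_cast h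

section Bounds

variable {E Ω : Type*} [MetricSpace E] [PolishSpace E] [MeasurableSpace E] [BorelSpace E]
  [MeasurableSpace Ω] {P : Measure Ω} [IsProbabilityMeasure P] {μ : Measure E}
  [IsProbabilityMeasure μ] {n : ℕ} {X : Fin n → Ω → E} {S : Set E} {x₀ : E} {p α β : ℝ}

lemma rpow_mul_sum_shell_le {r γ x Q : ℝ} (hn : 0 < n) (hp : 1 ≤ p) (hγ : 0 < γ)
    (hrγ : r * γ < 1) (hx : 0 < x) (hQ : 0 ≤ Q) (hw : weakMomentPow x₀ μ (r * p) ≠ ∞)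
    (hwQ : (weakMomentPow x₀ μ (r * p)).toReal ≤ Q * (x ^ r * (n : ℝ) ^ (r - 1))) (a : ℤ) {k₀ : ℤ}
    (hk₀ : ((2 : ℝ) ^ k₀) ^ p ≤ n * x) :
    (n : ℝ) ^ (γ - 1) * ∑ k ∈ Finset.Icc a k₀, ((2 : ℝ) ^ k) ^ p * μ.real (shell x₀ k) ^ γ ≤
      geomConst p r γ * Q ^ γ * x := by
  have hN : (0 : ℝ) < n := by exact_mod_cast hn
  have e : (n : ℝ) ^ (γ - 1) * (n : ℝ) ^ (1 - γ) = 1 := by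
    rw [← Real.rpow_add hN]; simp
  calc _ ≤ (n : ℝ) ^ (γ - 1) * (geomConst p r γ * (x * Q ^ γ * (n : ℝ) ^ (1 - γ))) := by
        gcongr
        exact sum_shell_rpow_le_geomConst hp hγ hrγ hx hN hQ hw hwQ a hk₀
    _ = geomConst p r γ * Q ^ γ * x * ((n : ℝ) ^ (γ - 1) * (n : ℝ) ^ (1 - γ)) := by ring
    _ = _ := by rw [e, mul_one]

lemma sum_shell_rpow_nonneg (K : Finset ℤ) (p γ : ℝ) :
    0 ≤ ∑ k ∈ K, ((2 : ℝ) ^ k) ^ p * μ.real (shell x₀ k) ^ γ :=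
  Finset.sum_nonneg fun k _ => by positivity

/-- The constant bounding the fluctuations when the weak moment has order below `2p`. -/
noncomputable def lowConst (p r : ℝ) : ℝ :=
  fluctConst p 2 * (2 * geomConst p r (1 / 2)) ^ (2 : ℝ)

/-- At q = 2 both shell sums have exponent 1/2, and r < 2 makes them geometric. Each is of order
Q^(1/2) x, so squaring gives `Q`. -/
lemma fluct_le_of_lt_two {r x Q : ℝ} (hn : 0 < n) (hp : 1 ≤ p) (hr : r < 2) (hx : 0 < x)
    (hQ : 0 ≤ Q) (hw : weakMomentPow x₀ μ (r * p) ≠ ∞)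
    (hwQ : (weakMomentPow x₀ μ (r * p)).toReal ≤ Q * (x ^ r * (n : ℝ) ^ (r - 1))) (a : ℤ) {k₀ : ℤ}
    (hk₀ : ((2 : ℝ) ^ k₀) ^ p ≤ n * x) :
    (4 * Real.exp 2 * 2 ^ (2 : ℝ) + 1) *
          ((n : ℝ) ^ (-(1 / 2) : ℝ) * ∑ k ∈ Finset.Icc a k₀,
              ((2 : ℝ) ^ k) ^ p * μ.real (shell x₀ k) ^ (1 / 2 : ℝ) +
            (n : ℝ) ^ (1 / 2 - 1 : ℝ) * ∑ k ∈ Finset.Icc a k₀,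
              ((2 : ℝ) ^ k) ^ p * μ.real (shell x₀ k) ^ (1 / 2 : ℝ)) ^ (2 : ℝ) /
        (x / (2 * 2 ^ p)) ^ (2 : ℝ) ≤ lowConst p r * Q := by
  have h := rpow_mul_sum_shell_le (γ := 1 / 2) hn hp (by norm_num) (by linarith) hx hQ hw hwQ a hk₀
  have hs := sum_shell_rpow_nonneg (μ := μ) (x₀ := x₀) (Finset.Icc a k₀) p (1 / 2)
  have hG : 0 < geomConst p r (1 / 2) := geomConst_pos (by linarith) (by linarith)
  rw [show (-(1 / 2) : ℝ) = 1 / 2 - 1 by norm_num, ← two_mul, fluct_eq (by positivity) hx, lowConst,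
    mul_assoc]
  refine mul_le_mul_of_nonneg_left ?_ (fluctConst_pos two_pos).le
  calc _ ≤ (2 * geomConst p r (1 / 2) * Q ^ (1 / 2 : ℝ)) ^ (2 : ℝ) := by
        refine Real.rpow_le_rpow (by positivity) ?_ (by norm_num)
        rw [div_le_iff₀ hx]
        linarith
    _ = _ := by
        rw [Real.mul_rpow (by positivity) (by positivity), ← Real.rpow_mul hQ]
        norm_num

/-- The constant bounding the fluctuations when the weak moment has order above `2p`. -/
noncomputable def highConst (p q r : ℝ) : ℝ :=
  fluctConst p q * (2 ^ (q - 1) * ((4 ^ p) ^ q + geomConst p r (1 / q) ^ q))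

lemma rpow_mul_sum_shell_half_div_le {x : ℝ} (hp : 1 ≤ p) (hx : 0 < x)
    (hI : tailIntegral x₀ μ (2 * p) p < ∞) (K : Finset ℤ) :
    (n : ℝ) ^ (-(1 / 2) : ℝ) * (∑ k ∈ K, ((2 : ℝ) ^ k) ^ p *
      μ.real (shell x₀ k) ^ (1 / 2 : ℝ)) / x ≤
    4 ^ p * ((tailIntegral x₀ μ (2 * p) p).toReal / (x * (n : ℝ) ^ (1 / 2 : ℝ))) := by
  have h := sum_shell_rpow_le_toReal (μ := μ) (x₀ := x₀) hp (γ := 1 / 2) (by norm_num) K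
    (by rw [← tailIntegral_two_mul hp]; exact hI.ne)
  rw [← tailIntegral_two_mul hp] at h
  calc _ ≤ (n : ℝ) ^ (-(1 / 2) : ℝ) * (4 ^ p * (tailIntegral x₀ μ (2 * p) p).toReal) / x := by
        gcongr
    _ = _ := by
        rw [Real.rpow_neg (by positivity)]
        simp only [div_eq_mul_inv, mul_inv]
        ring

/-- The exponent-1/2 sum is bounded by I_{2p,p}, while q > r makes the exponent-1/q sum geometric,
of order Q^(1/q) x; the power q separates them into the two polynomial terms. -/
lemma fluct_le_of_two_lt {q r x Q : ℝ} (hn : 0 < n) (hp : 1 ≤ p) (hr : 1 < r) (hq : r < q)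
    (hx : 0 < x) (hQ : 0 ≤ Q) (hI : tailIntegral x₀ μ (2 * p) p < ∞)
    (hw : weakMomentPow x₀ μ (r * p) ≠ ∞)
    (hwQ : (weakMomentPow x₀ μ (r * p)).toReal ≤ Q * (x ^ r * (n : ℝ) ^ (r - 1))) (a : ℤ) {k₀ : ℤ}
    (hk₀ : ((2 : ℝ) ^ k₀) ^ p ≤ n * x) :
    (4 * Real.exp 2 * q ^ q + 1) *
          ((n : ℝ) ^ (-(1 / 2) : ℝ) * ∑ k ∈ Finset.Icc a k₀,
              ((2 : ℝ) ^ k) ^ p * μ.real (shell x₀ k) ^ (1 / 2 : ℝ) +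
            (n : ℝ) ^ (1 / q - 1 : ℝ) * ∑ k ∈ Finset.Icc a k₀,
              ((2 : ℝ) ^ k) ^ p * μ.real (shell x₀ k) ^ (1 / q)) ^ q /
        (x / (2 * 2 ^ p)) ^ q ≤
      highConst p q r *
        ((tailIntegral x₀ μ (2 * p) p).toReal ^ q / (x ^ q * (n : ℝ) ^ (q / 2)) + Q) := by
  have hN : (0 : ℝ) < n := by exact_mod_cast hn
  have hq0 : 0 < q := by linarith
  have hrq : r * (1 / q) < 1 := by rw [mul_one_div, div_lt_one hq0]; exact hq
  have h := rpow_mul_sum_shell_le (γ := 1 / q) hn hp (by positivity) hrq hx hQ hw hwQ a hk₀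
  have h' := rpow_mul_sum_shell_half_div_le (n := n) hp hx hI (Finset.Icc a k₀)
  have hs := sum_shell_rpow_nonneg (μ := μ) (x₀ := x₀) (Finset.Icc a k₀) p (1 / 2)
  have hs' := sum_shell_rpow_nonneg (μ := μ) (x₀ := x₀) (Finset.Icc a k₀) p (1 / q)
  have hG : 0 < geomConst p r (1 / q) := geomConst_pos (by linarith) hrq
  set I := (tailIntegral x₀ μ (2 * p) p).toReal with hIdef
  have hI0 : 0 ≤ I := ENNReal.toReal_nonneg
  rw [fluct_eq (by positivity) hx, highConst, mul_assoc, add_div]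
  refine mul_le_mul_of_nonneg_left ?_ (fluctConst_pos hq0).le
  calc _ ≤ (4 ^ p * (I / (x * (n : ℝ) ^ (1 / 2 : ℝ))) +
        geomConst p r (1 / q) * Q ^ (1 / q)) ^ q := by
        refine Real.rpow_le_rpow (by positivity) (add_le_add h' ?_) hq0.le
        rw [div_le_iff₀ hx]
        exact h
    _ ≤ 2 ^ (q - 1) * ((4 ^ p * (I / (x * (n : ℝ) ^ (1 / 2 : ℝ)))) ^ q +
        (geomConst p r (1 / q) * Q ^ (1 / q)) ^ q) :=
        rpow_add_le_two_rpow_mul (by positivity) (by positivity) (by linarith)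
    _ = 2 ^ (q - 1) * ((4 ^ p) ^ q * (I ^ q / (x ^ q * (n : ℝ) ^ (q / 2))) +
        geomConst p r (1 / q) ^ q * Q) := by
        rw [Real.mul_rpow (by positivity) (by positivity),
          Real.mul_rpow (by positivity) (by positivity), ← Real.rpow_mul hQ,
          one_div_mul_cancel hq0.ne', Real.rpow_one, Real.div_rpow hI0 (by positivity),
          Real.mul_rpow hx.le (by positivity), ← Real.rpow_mul hN.le,
          show 1 / 2 * q = q / 2 by ring]
    _ ≤ _ := by
        rw [mul_assoc]
        gcongr
        have h1 : 0 ≤ I ^ q / (x ^ q * (n : ℝ) ^ (q / 2)) := by positivity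
        have h2 : 0 < ((4 : ℝ) ^ p) ^ q := by positivity
        have h3 : 0 < geomConst p r (1 / q) ^ q := by positivity
        nlinarith [mul_nonneg h2.le hQ, mul_nonneg h3.le h1]

/-- The constant bounding the fluctuations when `I_{2p,p}` is finite. -/
noncomputable def midConst (p : ℝ) : ℝ := fluctConst p 2 * (2 * 4 ^ p) ^ (2 : ℝ)

lemma fluct_le_tailIntegral {x : ℝ} (hn : 0 < n) (hp : 1 ≤ p) (hx : 0 < x)
    (hI : tailIntegral x₀ μ (2 * p) p < ∞) (K : Finset ℤ) :
    (4 * Real.exp 2 * 2 ^ (2 : ℝ) + 1) *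
          ((n : ℝ) ^ (-(1 / 2) : ℝ) * ∑ k ∈ K,
              ((2 : ℝ) ^ k) ^ p * μ.real (shell x₀ k) ^ (1 / 2 : ℝ) +
            (n : ℝ) ^ (1 / 2 - 1 : ℝ) * ∑ k ∈ K,
              ((2 : ℝ) ^ k) ^ p * μ.real (shell x₀ k) ^ (1 / 2 : ℝ)) ^ (2 : ℝ) /
        (x / (2 * 2 ^ p)) ^ (2 : ℝ) ≤
      midConst p * ((tailIntegral x₀ μ (2 * p) p).toReal ^ 2 / (x ^ 2 * n)) := by
  have hN : (0 : ℝ) < n := by exact_mod_cast hn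
  have h := rpow_mul_sum_shell_half_div_le (n := n) hp hx hI K
  have hs := sum_shell_rpow_nonneg (μ := μ) (x₀ := x₀) K p (1 / 2)
  rw [show (1 / 2 - 1 : ℝ) = -(1 / 2) by norm_num, ← two_mul, fluct_eq (by positivity) hx, midConst,
    mul_assoc]
  set I := (tailIntegral x₀ μ (2 * p) p).toReal with hIdef
  have hI0 : 0 ≤ I := ENNReal.toReal_nonneg
  refine mul_le_mul_of_nonneg_left ?_ (fluctConst_pos two_pos).le
  calc _ ≤ (2 * 4 ^ p * (I / (x * (n : ℝ) ^ (1 / 2 : ℝ)))) ^ (2 : ℝ) := by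
        refine Real.rpow_le_rpow (by positivity) ?_ (by norm_num)
        rw [mul_div_assoc, mul_assoc]
        gcongr
    _ = _ := by
        rw [Real.mul_rpow (by positivity) (by positivity), Real.div_rpow hI0 (by positivity),
          Real.mul_rpow hx.le (by positivity), ← Real.rpow_mul hN.le]
        norm_num

end Bounds

end EmpiricalWasserstein

namespace EmpiricalWasserstein

/-! ### Deviation bounds in the individual regimes -/

section Deviation

variable {E Ω : Type*} [MetricSpace E] [PolishSpace E] [MeasurableSpace E] [BorelSpace E]
  [MeasurableSpace Ω] {P : Measure Ω} [IsProbabilityMeasure P] {μ : Measure E}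
  [IsProbabilityMeasure μ] {n : ℕ} {X : Fin n → Ω → E} {S : Set E} {x₀ : E} {p α β : ℝ}

lemma exists_devProb_le_expTerm_add (hn : 0 < n) (hX : ∀ i, Measurable (X i))
    (hind : iIndepFun X P) (hlaw : ∀ i, P.map (X i) = μ) (hS : μ S = 1) (hp : 1 ≤ p)
    (hα : 2 * p < α) (hβ : 0 < β) (hcov : HasCoveringDim S x₀ α β) {r x Q : ℝ} (hr : 1 < r)
    (hx : 0 < x) (hQ : 0 ≤ Q) (hw : weakMomentPow x₀ μ (r * p) ≠ ∞)
    (hwQ : (weakMomentPow x₀ μ (r * p)).toReal ≤ Q * (x ^ r * (n : ℝ) ^ (r - 1)))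
    (hI : tailIntegral x₀ μ α p < ∞) :
    ∃ a k₀ : ℤ, ((2 : ℝ) ^ k₀) ^ p ≤ n * x ∧ ∀ q : ℝ, 1 ≤ q →
      devProb P X μ p x ≤ expTerm x₀ μ p α (expRate p α β) (expCutoff p) n x +
        (4 * Real.exp 2 * q ^ q + 1) *
          ((n : ℝ) ^ (-(1 / 2) : ℝ) * ∑ k ∈ Finset.Icc a k₀,
              ((2 : ℝ) ^ k) ^ p * μ.real (shell x₀ k) ^ (1 / 2 : ℝ) +
            (n : ℝ) ^ (1 / q - 1) * ∑ k ∈ Finset.Icc a k₀,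
              ((2 : ℝ) ^ k) ^ p * μ.real (shell x₀ k) ^ (1 / q)) ^ q / (x / (2 * 2 ^ p)) ^ q +
        truncConst p r * Q := by
  obtain ⟨a, k₀, hk₀, h⟩ := exists_devProb_le_add_truncConst hn hX hind hlaw hS hp hα hβ hcov hr hx
    hQ hw hwQ
  obtain ⟨b, hb0, hb, hexp⟩ := exists_innerTerm_le_expTerm hp hα hI β (Finset.Icc a k₀) n hx
  exact ⟨a, k₀, hk₀, fun q hq => (h q b hq hb0 hb).trans (by gcongr)⟩

lemma devProb_le_of_weakMoment_lt_two (hn : 0 < n) (hX : ∀ i, Measurable (X i))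
    (hind : iIndepFun X P) (hlaw : ∀ i, P.map (X i) = μ) (hS : μ S = 1) (hp : 1 ≤ p)
    (hα : 2 * p < α) (hβ : 0 < β) (hcov : HasCoveringDim S x₀ α β) {r x Q : ℝ} (hr : 1 < r)
    (hr2 : r < 2) (hx : 0 < x) (hQ : 0 ≤ Q) (hw : weakMomentPow x₀ μ (r * p) ≠ ∞)
    (hwQ : (weakMomentPow x₀ μ (r * p)).toReal ≤ Q * (x ^ r * (n : ℝ) ^ (r - 1)))
    (hI : tailIntegral x₀ μ α p < ∞) :
    devProb P X μ p x ≤ expTerm x₀ μ p α (expRate p α β) (expCutoff p) n x +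
      (lowConst p r + truncConst p r) * Q := by
  obtain ⟨a, k₀, hk₀, h⟩ := exists_devProb_le_expTerm_add hn hX hind hlaw hS hp hα hβ hcov hr hx
    hQ hw hwQ hI
  have h1 := h 2 one_le_two
  have h2 := fluct_le_of_lt_two hn hp hr2 hx hQ hw hwQ a hk₀
  linarith

lemma devProb_le_of_two_lt_weakMoment (hn : 0 < n) (hX : ∀ i, Measurable (X i))
    (hind : iIndepFun X P) (hlaw : ∀ i, P.map (X i) = μ) (hS : μ S = 1) (hp : 1 ≤ p)
    (hα : 2 * p < α) (hβ : 0 < β) (hcov : HasCoveringDim S x₀ α β) {q r x Q : ℝ} (hr : 1 < r)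
    (hq : r < q) (hx : 0 < x) (hQ : 0 ≤ Q) (hw : weakMomentPow x₀ μ (r * p) ≠ ∞)
    (hwQ : (weakMomentPow x₀ μ (r * p)).toReal ≤ Q * (x ^ r * (n : ℝ) ^ (r - 1)))
    (hI : tailIntegral x₀ μ (2 * p) p < ∞) :
    devProb P X μ p x ≤ expTerm x₀ μ p α (expRate p α β) (expCutoff p) n x +
      (highConst p q r + truncConst p r) *
        ((tailIntegral x₀ μ (2 * p) p).toReal ^ q / (x ^ q * (n : ℝ) ^ (q / 2)) + Q) := by
  obtain ⟨a, k₀, hk₀, h⟩ := exists_devProb_le_expTerm_add hn hX hind hlaw hS hp hα hβ hcov hr hx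
    hQ hw hwQ ((tailIntegral_le_tailIntegral_two_mul hp hα).trans_lt hI)
  have h1 := h q (by linarith)
  have h2 := fluct_le_of_two_lt hn hp hr hq hx hQ hI hw hwQ a hk₀
  have h3 : 0 ≤ truncConst p r *
      ((tailIntegral x₀ μ (2 * p) p).toReal ^ q / (x ^ q * (n : ℝ) ^ (q / 2))) :=
    mul_nonneg (truncConst_pos hr).le (by positivity)
  rw [add_mul, mul_add (truncConst p r)]
  linarith

lemma weakMomentPow_toReal_le {γ r : ℝ} (hp : 1 ≤ p) (hγ : 0 < γ) (hr : r = 1 / γ)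
    (hI : ∫⁻ t in Ioi (0 : ℝ), tail x₀ μ t ^ γ * ENNReal.ofReal (t ^ (p - 1)) < ∞) :
    weakMomentPow x₀ μ (r * p) ≠ ∞ ∧ (weakMomentPow x₀ μ (r * p)).toReal ≤
      (p * (∫⁻ t in Ioi (0 : ℝ), tail x₀ μ t ^ γ * ENNReal.ofReal (t ^ (p - 1))).toReal) ^ r := by
  subst hr
  have h := weakMomentPow_le_lintegral (μ := μ) (x₀ := x₀) hp hγ
  have hfin := ENNReal.rpow_ne_top_of_nonneg (one_div_nonneg.2 hγ.le)
    (ENNReal.mul_ne_top (ENNReal.ofReal_ne_top (r := p)) hI.ne)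
  refine ⟨ne_top_of_le_ne_top hfin h, (ENNReal.toReal_mono hfin h).trans (le_of_eq ?_)⟩
  rw [← ENNReal.toReal_rpow, ENNReal.toReal_mul, ENNReal.toReal_ofReal (by linarith)]

/-- Finiteness of I_{2p,p} gives a weak moment of order 2p, so truncation works with r = 2. At this
endpoint rγ = 1 and the geometric estimate is lost, so the fluctuations are bounded by I_{2p,p}
directly. -/
lemma devProb_le_of_tailIntegral_two_mul (hn : 0 < n) (hX : ∀ i, Measurable (X i))
    (hind : iIndepFun X P) (hlaw : ∀ i, P.map (X i) = μ) (hS : μ S = 1) (hp : 1 ≤ p)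
    (hα : 2 * p < α) (hβ : 0 < β) (hcov : HasCoveringDim S x₀ α β) {x : ℝ} (hx : 0 < x)
    (hI : tailIntegral x₀ μ (2 * p) p < ∞) :
    devProb P X μ p x ≤ expTerm x₀ μ p α (expRate p α β) (expCutoff p) n x +
      (midConst p + truncConst p 2 * p ^ 2) *
        ((tailIntegral x₀ μ (2 * p) p).toReal ^ 2 / (x ^ 2 * n)) := by
  have hN : (0 : ℝ) < n := by exact_mod_cast hn
  obtain ⟨hw, hwI⟩ := weakMomentPow_toReal_le (x₀ := x₀) (μ := μ) hp (γ := 1 / 2) (r := 2)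
    (by norm_num) (by norm_num) (by rw [← tailIntegral_two_mul hp]; exact hI)
  rw [← tailIntegral_two_mul hp] at hwI
  set I := (tailIntegral x₀ μ (2 * p) p).toReal with hIdef
  have hwQ : (weakMomentPow x₀ μ (2 * p)).toReal ≤
      p ^ 2 * (I ^ 2 / (x ^ 2 * n)) * (x ^ (2 : ℝ) * (n : ℝ) ^ (2 - 1 : ℝ)) := by
    refine hwI.trans (le_of_eq ?_)
    norm_num
    field_simp
  obtain ⟨a, k₀, hk₀, h⟩ := exists_devProb_le_expTerm_add hn hX hind hlaw hS hp hα hβ hcov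
    one_lt_two hx (by positivity) hw hwQ ((tailIntegral_le_tailIntegral_two_mul hp hα).trans_lt hI)
  have h1 := h 2 one_le_two
  have h2 := fluct_le_tailIntegral (μ := μ) (x₀ := x₀) hn hp hx hI (Finset.Icc a k₀)
  rw [add_mul, mul_assoc (truncConst p 2)]
  linarith

/-- The constant in the bound under finiteness of `I_{α,p}`. -/
noncomputable def integralConst (p α β : ℝ) : ℝ :=
  Real.exp 2 * (p / (α - p) / expRate p α β) ^ (p / (α - p)) +
    (lowConst p (α / (α - p)) + truncConst p (α / (α - p))) * p ^ (α / (α - p))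

/-- Finiteness of I_{α,p} gives a weak moment of order rp with r = α/(α-p), which lies in (1, 2). At
this r all terms, including the exponential one, have the same polynomial order. -/
lemma devProb_le_of_tailIntegral (hn : 0 < n) (hX : ∀ i, Measurable (X i))
    (hind : iIndepFun X P) (hlaw : ∀ i, P.map (X i) = μ) (hS : μ S = 1) (hp : 1 ≤ p)
    (hα : 2 * p < α) (hβ : 0 < β) (hcov : HasCoveringDim S x₀ α β) {x : ℝ} (hx : 0 < x)
    (hI : tailIntegral x₀ μ α p < ∞) :
    devProb P X μ p x ≤ integralConst p α β *
      ((tailIntegral x₀ μ α p).toReal ^ (α / (α - p)) /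
        (x ^ (α / (α - p)) * (n : ℝ) ^ (p / (α - p)))) := by
  have hN : (0 : ℝ) < n := by exact_mod_cast hn
  have hαp : 0 < α - p := by linarith
  have hη := exponent_mem hp hα
  set r := α / (α - p) with hr
  have hr1 : 1 < r := by rw [hr, lt_div_iff₀ hαp]; linarith
  have hr2 : r < 2 := by rw [hr, div_lt_iff₀ hαp]; linarith
  have hrp : r - 1 = p / (α - p) := by rw [hr]; field_simp; ring
  obtain ⟨hw, hwI⟩ := weakMomentPow_toReal_le (x₀ := x₀) (μ := μ) hp (γ := (α - p) / α) (r := r)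
    (by linarith) (by rw [hr, one_div_div]) hI
  change _ ≤ (p * (tailIntegral x₀ μ α p).toReal) ^ r at hwI
  have hexp := expTerm_le_rpow (κ := expCutoff p) hp hα hI hn (expRate_pos hα hβ) hx
  rw [← hr] at hexp
  set I := (tailIntegral x₀ μ α p).toReal with hIdef
  have hI0 : 0 ≤ I := ENNReal.toReal_nonneg
  have hwQ : (weakMomentPow x₀ μ (r * p)).toReal ≤
      p ^ r * (I ^ r / (x ^ r * (n : ℝ) ^ (p / (α - p)))) * (x ^ r * (n : ℝ) ^ (r - 1)) := by
    refine hwI.trans (le_of_eq ?_)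
    rw [Real.mul_rpow (by linarith) hI0, hrp]
    field_simp
  have h := devProb_le_of_weakMoment_lt_two hn hX hind hlaw hS hp hα hβ hcov hr1 hr2 hx
    (by positivity) hw hwQ hI
  rw [integralConst, ← hr, add_mul, mul_assoc (lowConst p r + truncConst p r)]
  linarith

/-- The constant in the bound under a weak moment of low order. -/
noncomputable def weakConst (p α β r : ℝ) : ℝ :=
  Real.exp 2 * (p / (α - p) / (innerRate p α (β * 2 ^ α) *
    (1 / (4 * 8 ^ p * geomConst p r ((α - p) / α))) ^ (α / p))) ^ (p / (α - p)) +
    (lowConst p r + truncConst p r)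

/-- Here I_{α,p} may be infinite, but only the shells below the truncation radius enter the inner
cost, and their sum is geometric because r(α-p)/α < 1. That sum then plays the role of I_{α,p}. -/
lemma devProb_le_of_weakMoment_low (hn : 0 < n) (hX : ∀ i, Measurable (X i))
    (hind : iIndepFun X P) (hlaw : ∀ i, P.map (X i) = μ) (hS : μ S = 1) (hp : 1 ≤ p)
    (hα : 2 * p < α) (hβ : 0 < β) (hcov : HasCoveringDim S x₀ α β) {r x Q : ℝ} (hr : 1 < r)
    (hrα : r < α / (α - p)) (hx : 0 < x) (hQ : 0 < Q) (hw : weakMomentPow x₀ μ (r * p) ≠ ∞)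
    (hwQ : (weakMomentPow x₀ μ (r * p)).toReal ≤ Q * (x ^ r * (n : ℝ) ^ (r - 1))) :
    devProb P X μ p x ≤ weakConst p α β r * Q := by
  have hN : (0 : ℝ) < n := by exact_mod_cast hn
  have hp0 : 0 < p := by linarith
  have hα0 : 0 < α := by linarith
  have hαp : 0 < α - p := by linarith
  have hη := exponent_mem hp hα
  have hr2 : r < 2 := hrα.trans (by rw [div_lt_iff₀ hαp]; linarith)
  have hrη : r * ((α - p) / α) < 1 := by
    rw [lt_div_iff₀ hαp] at hrα
    rw [mul_div_assoc', div_lt_one hα0]; exact hrα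
  obtain ⟨a, k₀, hk₀, h⟩ := exists_devProb_le_add_truncConst hn hX hind hlaw hS hp hα hβ hcov hr hx
    hQ.le hw hwQ
  have hsum := sum_shell_rpow_le_geomConst hp (by linarith) hrη hx hN hQ.le hw hwQ a hk₀
  have hG : 0 < geomConst p r ((α - p) / α) := geomConst_pos hp0 hrη
  have h1 := h 2 _ one_le_two (by positivity) hsum
  have h2 := fluct_le_of_lt_two hn hp hr2 hx hQ.le hw hwQ a hk₀
  have hR := innerRate_pos hα (B := β * 2 ^ α) (by positivity)
  rw [weakConst]
  set G := geomConst p r ((α - p) / α) with hGdef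
  set R := innerRate p α (β * 2 ^ α) with hRdef
  set s := p / (α - p) with hs
  have hs0 : 0 < s := by positivity
  set R' := R * (1 / (4 * 8 ^ p * G)) ^ (α / p) with hR'
  have hR0 : 0 < R' := by positivity
  -- With this `b` both x and n cancel, so the exponential depends on `Q` alone; the choice s =
  -- p/(α-p) then bounds it by a multiple of `Q`.
  have hz : n * R * (x / (4 * 8 ^ p) /
      (G * (x * Q ^ ((α - p) / α) * (n : ℝ) ^ (1 - (α - p) / α)))) ^ (α / p) =
      R' / Q ^ ((α - p) / p) := by
    have e1 : (Q ^ ((α - p) / α)) ^ (α / p) = Q ^ ((α - p) / p) := by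
      rw [← Real.rpow_mul hQ.le]; congr 1; field_simp
    have e2 : ((n : ℝ) ^ (1 - (α - p) / α)) ^ (α / p) = n := by
      rw [← Real.rpow_mul hN.le, show (1 - (α - p) / α) * (α / p) = 1 by field_simp; ring,
        Real.rpow_one]
    rw [show x / (4 * 8 ^ p) / (G * (x * Q ^ ((α - p) / α) * (n : ℝ) ^ (1 - (α - p) / α))) =
      1 / (4 * 8 ^ p * G) / (Q ^ ((α - p) / α) * (n : ℝ) ^ (1 - (α - p) / α)) by field_simp,
      Real.div_rpow (by positivity) (by positivity) (α / p),
      Real.mul_rpow (x := Q ^ ((α - p) / α)) (by positivity) (by positivity), e1, e2, hR']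
    field_simp
  have hexp : Real.exp (-(R' / Q ^ ((α - p) / p))) ≤ (s / R') ^ s * Q := by
    refine (exp_neg_le_rpow_div hs0 (by positivity)).trans (le_of_eq ?_)
    have e1 : (Q ^ ((α - p) / p)) ^ s = Q := by
      rw [← Real.rpow_mul hQ.le, hs, div_mul_div_cancel₀ hp0.ne', div_self hαp.ne', Real.rpow_one]
    rw [Real.div_rpow (x := R') hR0.le (by positivity), e1, Real.div_rpow hs0.le hR0.le]
    field_simp
  have h3 : Real.exp 2 * Real.exp (-(R' / Q ^ ((α - p) / p))) *
        (if x / (4 * 8 ^ p) < 2 * ∑ k ∈ Finset.Icc a k₀, ((2 : ℝ) ^ k) ^ p * μ.real (shell x₀ k)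
          then 1 else 0) ≤ Real.exp 2 * ((s / R') ^ s * Q) * 1 := by
    gcongr
    split_ifs <;> norm_num
  rw [hz] at h1
  linarith

end Deviation

end EmpiricalWasserstein

/-! ### Assembling the five cases -/

theorem mainTheorem1 :
    ∃ (κ : ℝ → ℝ) (c : ℝ → ℝ → ℝ → ℝ)
      (C₁ : ℝ → ℝ → ℝ → ℝ) (C₂ : ℝ → ℝ) (C₃ : ℝ → ℝ → ℝ) (C₄ : ℝ → ℝ → ℝ → ℝ)
      (C₅ : ℝ → ℝ → ℝ → ℝ → ℝ),
      (∀ p, 0 < κ p) ∧ (∀ p α β, 0 < c p α β) ∧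
      (∀ p q r, 0 < C₁ p q r) ∧ (∀ p, 0 < C₂ p) ∧ (∀ p r, 0 < C₃ p r) ∧
      (∀ p α β, 0 < C₄ p α β) ∧ (∀ p α β r, 0 < C₅ p α β r) ∧
      ∀ (E : Type*) [MetricSpace E] [PolishSpace E] [MeasurableSpace E] [BorelSpace E]
        (Ω : Type*) [MeasurableSpace Ω] (P : Measure Ω) [IsProbabilityMeasure P]
        (μ : Measure E) [IsProbabilityMeasure μ]
        (n : ℕ) (X : Fin n → Ω → E) (S : Set E) (x₀ : E) (p α β : ℝ),
        0 < n → (∀ i, Measurable (X i)) → iIndepFun X P → (∀ i, P.map (X i) = μ) →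
        μ S = 1 → 1 ≤ p → 2 * p < α → 0 < β → HasCoveringDim S x₀ α β →
        -- weak moment of order `r p` with `r > 2`
        (∀ r : ℝ, 2 < r → weakMomentPow x₀ μ (r * p) < ∞ →
          momentPow x₀ μ p < ∞ ∧ tailIntegral x₀ μ α p < ∞ ∧ tailIntegral x₀ μ (2 * p) p < ∞ ∧
          ∀ q x : ℝ, r < q → 0 < x →
            devProb P X μ p x ≤ expTerm x₀ μ p α (c p α β) (κ p) n x +
              C₁ p q r *
                ((tailIntegral x₀ μ (2 * p) p).toReal ^ q / (x ^ q * (n : ℝ) ^ (q / 2)) +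
                  (weakMomentPow x₀ μ (r * p)).toReal / (x ^ r * (n : ℝ) ^ (r - 1)))) ∧
        -- `I_{2p,p} < ∞`
        (tailIntegral x₀ μ (2 * p) p < ∞ →
          momentPow x₀ μ p < ∞ ∧ tailIntegral x₀ μ α p < ∞ ∧
          ∀ x : ℝ, 0 < x →
            devProb P X μ p x ≤ expTerm x₀ μ p α (c p α β) (κ p) n x +
              C₂ p * ((tailIntegral x₀ μ (2 * p) p).toReal ^ 2 / (x ^ 2 * n))) ∧
        -- weak moment of order `r p` with `α / (α - p) < r < 2`
        (∀ r : ℝ, α / (α - p) < r → r < 2 → weakMomentPow x₀ μ (r * p) < ∞ →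
          momentPow x₀ μ p < ∞ ∧ tailIntegral x₀ μ α p < ∞ ∧
          ∀ x : ℝ, 0 < x →
            devProb P X μ p x ≤ expTerm x₀ μ p α (c p α β) (κ p) n x +
              C₃ p r * ((weakMomentPow x₀ μ (r * p)).toReal / (x ^ r * (n : ℝ) ^ (r - 1)))) ∧
        -- `I_{α,p} < ∞`
        (tailIntegral x₀ μ α p < ∞ →
          momentPow x₀ μ p < ∞ ∧
          ∀ x : ℝ, 0 < x →
            devProb P X μ p x ≤
              C₄ p α β * ((tailIntegral x₀ μ α p).toReal ^ (α / (α - p)) /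
                (x ^ (α / (α - p)) * (n : ℝ) ^ (p / (α - p))))) ∧
        -- weak moment of order `r p` with `1 < r < α / (α - p)`
        (∀ r : ℝ, 1 < r → r < α / (α - p) → weakMomentPow x₀ μ (r * p) < ∞ →
          momentPow x₀ μ p < ∞ ∧
          ∀ x : ℝ, 0 < x →
            devProb P X μ p x ≤
              C₅ p α β r *
                ((weakMomentPow x₀ μ (r * p)).toReal / (x ^ r * (n : ℝ) ^ (r - 1)))) := by
  classical
  -- The rate takes the default value 1 outside the admissible parameters, and maxima with 1 are
  -- taken in C₁ to C₅, because positivity is required for all real arguments.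
  refine ⟨expCutoff, fun p α β => if 2 * p < α ∧ 0 < β then expRate p α β else 1,
    fun p q r => max 1 (highConst p q r + truncConst p r),
    fun p => max 1 (midConst p + truncConst p 2 * p ^ 2),
    fun p r => max 1 (lowConst p r + truncConst p r), fun p α β => max 1 (integralConst p α β),
    fun p α β r => max 1 (weakConst p α β r), expCutoff_pos, ?_,
    fun _ _ _ => lt_max_of_lt_left one_pos, fun _ => lt_max_of_lt_left one_pos,
    fun _ _ => lt_max_of_lt_left one_pos, fun _ _ _ => lt_max_of_lt_left one_pos,
    fun _ _ _ _ => lt_max_of_lt_left one_pos, ?_⟩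
  · intro p α β
    dsimp only
    split_ifs with h
    · exact expRate_pos h.1 h.2
    · exact one_pos
  intro E _ _ _ _ Ω _ P _ μ _ n X S x₀ p α β hn hX hind hlaw hS hp hα hβ hcov
  have hN : (0 : ℝ) < n := by exact_mod_cast hn
  have hαp : 0 < α - p := by linarith
  have hη := exponent_mem hp hα
  dsimp only
  rw [if_pos ⟨hα, hβ⟩]
  have hmul : ∀ {r x : ℝ}, 0 < x → (weakMomentPow x₀ μ (r * p)).toReal ≤
      (weakMomentPow x₀ μ (r * p)).toReal / (x ^ r * (n : ℝ) ^ (r - 1)) *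
        (x ^ r * (n : ℝ) ^ (r - 1)) := fun {r x} hx =>
    (div_mul_cancel₀ _ (by positivity : x ^ r * (n : ℝ) ^ (r - 1) ≠ 0)).ge
  refine ⟨?_, ?_, ?_, ?_, ?_⟩
  · intro r hr hw
    have hI : tailIntegral x₀ μ (2 * p) p < ∞ := by
      rw [tailIntegral_two_mul hp]
      exact lintegral_tail_rpow_lt_top hp (by norm_num) (by linarith) hw.ne
    have hI' := (tailIntegral_le_tailIntegral_two_mul hp hα).trans_lt hI
    refine ⟨momentPow_lt_top_of_tailIntegral_lt_top hp hα hI', hI', hI, fun q x hq hx => ?_⟩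
    refine (devProb_le_of_two_lt_weakMoment hn hX hind hlaw hS hp hα hβ hcov (by linarith) hq hx
      (by positivity) hw.ne (hmul hx) hI).trans ?_
    gcongr
    exact le_max_right _ _
  · intro hI
    have hI' := (tailIntegral_le_tailIntegral_two_mul hp hα).trans_lt hI
    refine ⟨momentPow_lt_top_of_tailIntegral_lt_top hp hα hI', hI', fun x hx => ?_⟩
    refine (devProb_le_of_tailIntegral_two_mul hn hX hind hlaw hS hp hα hβ hcov hx hI).trans ?_
    gcongr
    exact le_max_right _ _
  · intro r hr hr2 hw
    have hr1 : 1 < r := lt_trans (by rw [lt_div_iff₀ hαp]; linarith) hr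
    have hI : tailIntegral x₀ μ α p < ∞ := by
      refine lintegral_tail_rpow_lt_top hp (by linarith) ?_ hw.ne
      rw [div_lt_iff₀ hαp] at hr
      rw [mul_div_assoc', lt_div_iff₀ (by linarith)]
      linarith
    refine ⟨momentPow_lt_top_of_tailIntegral_lt_top hp hα hI, hI, fun x hx => ?_⟩
    refine (devProb_le_of_weakMoment_lt_two hn hX hind hlaw hS hp hα hβ hcov hr1 hr2 hx
      (by positivity) hw.ne (hmul hx) hI).trans ?_
    gcongr
    exact le_max_right _ _
  · intro hI
    refine ⟨momentPow_lt_top_of_tailIntegral_lt_top hp hα hI, fun x hx => ?_⟩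
    refine (devProb_le_of_tailIntegral hn hX hind hlaw hS hp hα hβ hcov hx hI).trans ?_
    gcongr
    exact le_max_right _ _
  · intro r hr hrα hw
    refine ⟨?_, fun x hx => ?_⟩
    -- Exponent γ = 1 is used here, since I_{α,p} need not be finite; r > 1 is enough.
    · refine (momentPow_le_lintegral hp le_rfl).trans_lt (ENNReal.mul_lt_top
        ENNReal.ofReal_lt_top (lintegral_tail_rpow_lt_top hp zero_le_one ?_ hw.ne))
      linarith
    · set Q := (weakMomentPow x₀ μ (r * p)).toReal / (x ^ r * (n : ℝ) ^ (r - 1)) with hQ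
      have hQ0 : 0 ≤ Q := by positivity
      set C := max 1 (weakConst p α β r) with hC
      have hC0 : 0 < C := lt_max_of_lt_left one_pos
      -- The weak moment may vanish, whereas the low-order bound needs a strictly positive `Q`; it
      -- is enlarged slightly and the limit is taken.
      refine le_of_forall_pos_le_add fun ε hε => ?_
      have hε' : 0 < ε / C := by positivity
      calc devProb P X μ p x ≤ weakConst p α β r * (Q + ε / C) :=
            devProb_le_of_weakMoment_low hn hX hind hlaw hS hp hα hβ hcov hr hrα hx (by positivity)
              hw.ne ((hmul hx).trans (by gcongr; linarith))
        _ ≤ C * (Q + ε / C) := by gcongr; exact le_max_right _ _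
        _ = C * Q + ε := by field_simp
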